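/- Let $(M^n,g)$ be a closed, oriented Riemannian spin manifold of even dimension $n$, with Levi-Civita connection $\nabla$ and a chosen spin structure $\pi:P_{Spin}(M)\to M$ covering the oriented orthonormal frame bundle. Let $\mathfrak{spin}(n)=\operatorname{span}\{e_ie_j: i<j\}$ inside the Clifford algebra of $\mathbb{R}^n$ (with $e_i^2=-1$), with the inner product for which the $e_ie_j$, $i<j$, are orthonormal, and let $\tau:\mathfrak{spin}(n)\to\mathfrak{so}(n)$, $\tau(A)w=[A,w]$. Let $\omega=\tau^{-1}(\omega^{LC})$ be the spinorial Levi-Civita connection form on $P_{Spin}(M)$, $\mathcal{H}=\ker\omega$ its horizontal distribution, with the inner product pulled back from $TM$ by $\pi_*$, and $\Omega=d\omega+\frac12[\omega,\omega]$ its curvature. For $p\in P_{Spin}(M)$ and $A\in\mathfrak{spin}(n)$ define $\tau(A\cdot\Omega_p)\in\mathfrak{so}(\mathcal{H}_p)$ by $\langle\tau(A\cdot\Omega_p)v,w\rangle=2\langle A,\Omega_p(v,w)\rangle$. Fix $p\in P_{Spin}(M)$ with $\pi(p)=x$, and $v\in\mathcal{H}_p$. For $A\in\mathfrak{spin}(n)$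 near $0$ put $$\Psi(A)=\Big\langle v,\Big(\frac{I-\exp(-\tau(A\cdot\Omega_p)/2)}{\tau(A\cdot\Omega_p)/2}\Big)^{-1}v\Big\rangle ,$$ where $\frac{I-\exp(-T)}{T}$ stands for $\sum_{k\ge0}\frac{(-1)^kT^k}{(k+1)!}$. Then the operator in brackets is invertible for all $A$ near $0$, the function $\Psi$ is smooth at $A=0$, and its Grassmann evaluation $$\Psi(2e\wedge e^*):=\sum_{\alpha}\frac1{\alpha!}\,(\partial^\alpha\Psi)(0)\prod_{i<j}(2\,e^i\wedge e^j)^{\alpha_{ij}}\in\textstyle\bigwedge^{even}(\mathbb{R}^n)^*$$ (sum over all multi-indices $\alpha=(\alpha_{ij})_{i<j}$, partial derivatives in the coordinates $A=\sum_{i<j}a_{ij}e_ie_j$) satisfies, under the identification $\bigwedge(\mathbb{R}^n)^*\simeq\bigwedge T_x^*M$ given by the frame of $p$ and the identification $\pi_*:\mathcal{H}_p\simeq T_xM$, $$\Psi(2e\wedge e^*)=\Big\langle v,\frac{R_x}{2}\coth\Big(\frac{R_x}{2}\Big)v\Big\rangle .$$ Here $R_x=\sum_{i<j}R(b_i,b_j)\,b^i\wedge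 b^j\in\bigwedge^2T_x^*M\otimes\operatorname{End}(T_xM)$ is the Riemannian curvature of $M$ at $x$ ($b$ an orthonormal basis of $T_xM$ with dual basis $b^i$, and $R(X,Y)=[\nabla_X,\nabla_Y]-\nabla_{[X,Y]}$), and $z\coth z$ is evaluated at the nilpotent element $R_x/2$ by its power series. -/

import Mathlib

open Bundle Filter
open scoped Manifold ContDiff Topology

noncomputable section

/-! ### The Clifford algebra, the spin group and its Lie algebra -/

/-- Euclidean `n`-space, identified with its dual throughout. -/
abbrev Euc (n : ℕ) : Type := EuclideanSpace ℝ (Fin n)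

/-- The standard basis vector `e_i`. -/
def stdVec {n : ℕ} (i : Fin n) : Euc n := EuclideanSpace.single i 1

/-- The quadratic form `v ↦ -‖v‖ ^ 2`, so that `v * v = -‖v‖ ^ 2` in the Clifford algebra. -/
def cliffordForm (n : ℕ) : QuadraticForm ℝ (Euc n) :=
  -(LinearMap.BilinMap.toQuadraticMap (innerₗ (Euc n)))

theorem cliffordForm_apply {n : ℕ} (v : Euc n) : cliffordForm n v = -‖v‖ ^ 2 := by
  simp [cliffordForm]

/-- The Clifford algebra of Euclidean `n`-space. -/
abbrev Cl (n : ℕ) : Type := CliffordAlgebra (cliffordForm n)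

/-- `Spin(n)`, inside the Clifford algebra. -/
abbrev SpinGrp (n : ℕ) : Type := spinGroup (cliffordForm n)

/-- `Spin(n)` has the subspace topology of the finite-dimensional vector space `Cl n`. -/
instance spinGrpTopology (n : ℕ) : TopologicalSpace (SpinGrp n) :=
  TopologicalSpace.induced Subtype.val (moduleTopology ℝ (Cl n))

/-- The index set of the basis `e_i e_j`, `i < j`, of `𝔰𝔭𝔦𝔫(n)`. -/
abbrev Pairs (n : ℕ) : Type := {ij : Fin n × Fin n // ij.1 < ij.2}

/-- The Lie algebra `𝔰𝔭𝔦𝔫(n)`, in coordinates with respect to the basis `e_i e_j`, `i < j`; it has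
the inner product for which this basis is orthonormal. -/
abbrev SpinAlg (n : ℕ) : Type := EuclideanSpace ℝ (Pairs n)

/-- The basis element `e_i e_j` of `𝔰𝔭𝔦𝔫(n)`. -/
def SpinAlg.basisVec {n : ℕ} (ij : Pairs n) : SpinAlg n := EuclideanSpace.single ij 1

/-- The inclusion of `𝔰𝔭𝔦𝔫(n)` into the Clifford algebra. -/
def SpinAlg.toCl {n : ℕ} (A : SpinAlg n) : Cl n :=
  ∑ ij : Pairs n, A ij • (CliffordAlgebra.ι (cliffordForm n) (stdVec ij.1.1) *
    CliffordAlgebra.ι (cliffordForm n) (stdVec ij.1.2))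

/-- The isomorphism `τ : 𝔰𝔭𝔦𝔫(n) → 𝔰𝔬(n)`, the differential of `Spin(n) → SO(n)`; that is,
`τ(A) v = [A, v]` in the Clifford algebra (`SpinAlg.ι_tau`). -/
def SpinAlg.tau {n : ℕ} (A : SpinAlg n) (v : Euc n) : Euc n :=
  ∑ ij : Pairs n, (2 * A ij) • (v ij.1.1 • stdVec ij.1.2 - v ij.1.2 • stdVec ij.1.1)

theorem ι_mul_swap {n : ℕ} (v : Euc n) (i : Fin n) :
    CliffordAlgebra.ι (cliffordForm n) (stdVec i) * CliffordAlgebra.ι (cliffordForm n) v =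
      -(CliffordAlgebra.ι (cliffordForm n) v * CliffordAlgebra.ι (cliffordForm n) (stdVec i))
        - (2 * v i) • 1 := by
  have h := CliffordAlgebra.ι_mul_ι_add_swap (Q := cliffordForm n) (stdVec i) v
  have h2 : QuadraticMap.polar (cliffordForm n) (stdVec i) v = -(2 * v i) := by
    simp only [QuadraticMap.polar, cliffordForm_apply, norm_add_sq_real]
    simp [stdVec, EuclideanSpace.inner_single_left]
    ring
  rw [h2, Algebra.algebraMap_eq_smul_one, neg_smul] at h
  rw [eq_sub_of_add_eq h]
  abel

theorem SpinAlg.ι_tau {n : ℕ} (A : SpinAlg n) (v : Euc n) :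
    CliffordAlgebra.ι (cliffordForm n) (A.tau v) =
      A.toCl * CliffordAlgebra.ι (cliffordForm n) v
        - CliffordAlgebra.ι (cliffordForm n) v * A.toCl := by
  simp only [SpinAlg.tau, SpinAlg.toCl, map_sum, Finset.sum_mul, Finset.mul_sum,
    ← Finset.sum_sub_distrib]
  refine Finset.sum_congr rfl fun ij _ ↦ ?_
  rw [map_smul, map_sub, map_smul, map_smul, smul_mul_assoc, mul_smul_comm, ← smul_sub,
    mul_assoc, ι_mul_swap v ij.1.2, mul_sub, mul_neg, ← mul_assoc, ι_mul_swap v ij.1.1]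
  simp only [sub_mul, neg_mul, smul_mul_assoc, one_mul, mul_smul_comm, mul_one, mul_assoc]
  module

/-- `τ` is inverted by `a_ij = ⟨τ(A) e_i, e_j⟩ / 2`. -/
theorem SpinAlg.tau_stdVec {n : ℕ} (A : SpinAlg n) (ij : Pairs n) :
    A ij = (1 / 2) * A.tau (stdVec ij.1.1) ij.1.2 := by
  obtain ⟨⟨i, j⟩, hij⟩ := ij
  have hij' : i < j := hij
  simp only [SpinAlg.tau, stdVec, WithLp.ofLp_sum, Finset.sum_apply]
  rw [Finset.sum_eq_single (⟨(i, j), hij⟩ : Pairs n)]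
  · simp [hij'.ne]
  · rintro ⟨⟨k, l⟩, hkl⟩ - hne
    have hkl' : k < l := hkl
    simp only [ne_eq, Subtype.mk.injEq, Prod.mk.injEq, not_and] at hne
    simp only [PiLp.single_apply, PiLp.smul_apply, PiLp.sub_apply, smul_eq_mul]
    by_cases h1 : k = i
    · subst h1
      have : j ≠ l := fun h ↦ hne rfl h.symm
      simp [this, hij'.ne']
    · by_cases h2 : l = i
      · subst h2
        have : j ≠ k := (hkl'.trans hij').ne'
        simp [h1, this]
      · simp [h1, h2]
  · simp

/-! ### Riemannian manifolds -/

section Riemannian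

variable {n : ℕ} {M : Type*} [TopologicalSpace M] [ChartedSpace (Euc n) M] [IsManifold (𝓡 n) ∞ M]
  [RiemannianBundle (fun x : M ↦ TangentSpace (𝓡 n) x)]
  [IsContMDiffRiemannianBundle (𝓡 n) ∞ (Euc n) (fun x : M ↦ TangentSpace (𝓡 n) x)]

instance isContMDiffRiemannianBundle_one :
    IsContMDiffRiemannianBundle (𝓡 n) 1 (Euc n) (fun x : M ↦ TangentSpace (𝓡 n) x) :=
  .of_le (n := ∞) (by simp)

/-- `∇` is the Levi-Civita connection of the Riemannian manifold `M`: the smooth connection on `TM`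
that is torsion free and compatible with the metric. -/
structure IsLeviCivita (cov : CovariantDerivative (𝓡 n) (Euc n)
    (fun x : M ↦ TangentSpace (𝓡 n) x)) : Prop where
  smooth : CovariantDerivative.ContMDiffCovariantDerivative cov ∞
  torsion : cov.torsion = 0
  metric : cov.IsMetricCompatible

/-- The curvature `R(u, v) w = ∇_u ∇_v w - ∇_v ∇_u w - ∇_[u, v] w` of a connection on `TM`, for
tangent vectors `u`, `v`, `w` at `x`. They are extended to vector fields that are smooth near `x`;
the value does not depend on the extensions. -/
def curvatureTensor (cov : CovariantDerivative (𝓡 n) (Euc n) (fun x : M ↦ TangentSpace (𝓡 n) x))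
    (x : M) (u v w : TangentSpace (𝓡 n) x) : TangentSpace (𝓡 n) x :=
  let U : ∀ y : M, TangentSpace (𝓡 n) y := FiberBundle.extend (Euc n) u
  let V : ∀ y : M, TangentSpace (𝓡 n) y := FiberBundle.extend (Euc n) v
  let W : ∀ y : M, TangentSpace (𝓡 n) y := FiberBundle.extend (Euc n) w
  cov (fun y ↦ cov W y (V y)) x u - cov (fun y ↦ cov W y (U y)) x v
    - cov W x (VectorField.mlieBracket (𝓡 n) U V x)

end Riemannian

/-! ### Differential one-forms on a manifold -/

/-- The exterior derivative of a vector-valued one-form `θ` on a manifold `P`,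
`dθ(X, Y) = X (θ(Y)) - Y (θ(X)) - θ([X, Y])`, computed at `p` in the preferred chart at `p`. -/
def extDerivOneForm {m : ℕ} {P : Type*} [TopologicalSpace P] [ChartedSpace (Euc m) P]
    [IsManifold (𝓡 m) ∞ P] {F : Type*} [NormedAddCommGroup F] [NormedSpace ℝ F]
    (θ : ∀ p : P, TangentSpace (𝓡 m) p →L[ℝ] F) (p : P) (ξ η : TangentSpace (𝓡 m) p) : F :=
  let φ := extChartAt (𝓡 m) p
  let α : Euc m → (Euc m →L[ℝ] F) := fun y ↦
    (θ (φ.symm y)).comp (mfderiv 𝓘(ℝ, Euc m) (𝓡 m) φ.symm y)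
  let dφ : TangentSpace (𝓡 m) p →L[ℝ] Euc m := mfderiv (𝓡 m) 𝓘(ℝ, Euc m) φ p
  fderiv ℝ α (φ p) (dφ ξ) (dφ η) - fderiv ℝ α (φ p) (dφ η) (dφ ξ)

theorem extDerivOneForm_sum {m : ℕ} {P : Type*} [TopologicalSpace P] [ChartedSpace (Euc m) P]
    [IsManifold (𝓡 m) ∞ P] {F : Type*} [NormedAddCommGroup F] [NormedSpace ℝ F]
    (θ : ∀ p : P, TangentSpace (𝓡 m) p →L[ℝ] F) (p : P) {ι κ : Type*} [Fintype ι] [Fintype κ]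
    (a : ι → ℝ) (b : κ → ℝ) (ξ : ι → TangentSpace (𝓡 m) p) (η : κ → TangentSpace (𝓡 m) p) :
    extDerivOneForm θ p (∑ i, a i • ξ i) (∑ k, b k • η k) =
      ∑ i, ∑ k, (a i * b k) • extDerivOneForm θ p (ξ i) (η k) := by
  have key : ∀ (D : Euc m →L[ℝ] Euc m →L[ℝ] F) (L : TangentSpace (𝓡 m) p →L[ℝ] Euc m),
      D (L (∑ i, a i • ξ i)) (L (∑ k, b k • η k)) - D (L (∑ k, b k • η k)) (L (∑ i, a i • ξ i)) =
        ∑ i, ∑ k, (a i * b k) • (D (L (ξ i)) (L (η k)) - D (L (η k)) (L (ξ i))) := by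
    intro D L
    simp only [map_sum, map_smul, _root_.sum_apply, _root_.smul_apply,
      Finset.smul_sum, smul_sub, Finset.sum_sub_distrib, smul_smul]
    congr 1
    rw [Finset.sum_comm]
    simp only [mul_comm]
  exact key _ _

/-! ### Spin structures -/

section Spin

variable {n : ℕ} {M : Type*} [TopologicalSpace M] [ChartedSpace (Euc n) M] [IsManifold (𝓡 n) ∞ M]
  [RiemannianBundle (fun x : M ↦ TangentSpace (𝓡 n) x)]

variable (n M) in
/-- A spin structure on a Riemannian manifold `M` of dimension `n`, with total space `P`: a
principal `Spin(n)`-bundle `P → M` with an equivariant map from `P` to the orthonormal frames of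
`M`. A frame at `x` is a linear isometry from Euclidean space to `T_x M`.

The dimension of `P` is that of the frame bundle and the map to the frames is an immersion, so it is
a local diffeomorphism; since `Spin(n)` acts simply transitively on the fibres, it is an equivariant
double cover of a bundle of frames with group `SO(n)`, that is, of the bundle of
oriented orthonormal frames for an orientation of `M`. -/
structure SpinStructure (P : Type*) [TopologicalSpace P] [ChartedSpace (Euc (n * (n + 1) / 2)) P]
    [IsManifold (𝓡 (n * (n + 1) / 2)) ∞ P] [MulAction (SpinGrp n)ᵐᵒᵖ P]
    [ContinuousSMul (SpinGrp n)ᵐᵒᵖ P] where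
  /-- the projection `π : P → M` -/
  proj : P → M
  contMDiff_proj : ContMDiff (𝓡 (n * (n + 1) / 2)) (𝓡 n) ∞ proj
  surjective_proj : Function.Surjective proj
  /-- the right action of `Spin(n)` is simply transitive on the fibres of `π` -/
  proj_smul : ∀ (g : SpinGrp n) (p : P), proj (MulOpposite.op g • p) = proj p
  free : ∀ (g : SpinGrp n) (p : P), MulOpposite.op g • p = p → g = 1
  transitive : ∀ p q : P, proj p = proj q → ∃ g : SpinGrp n, MulOpposite.op g • p = q
  /-- the orthonormal frame that belongs to a point of `P` -/
  frame : ∀ p : P, Euc n ≃ₗᵢ[ℝ] TangentSpace (𝓡 n) (proj p)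
  contMDiff_frame : ∀ v : Euc n, ContMDiff (𝓡 (n * (n + 1) / 2)) (𝓡 n).tangent ∞
    (fun p ↦ (⟨proj p, frame p v⟩ : TangentBundle (𝓡 n) M))
  immersion : ∀ (p : P) (ξ : TangentSpace (𝓡 (n * (n + 1) / 2)) p),
    (∀ v : Euc n, mfderiv (𝓡 (n * (n + 1) / 2)) (𝓡 n).tangent
      (fun q ↦ (⟨proj q, frame q v⟩ : TangentBundle (𝓡 n) M)) p ξ = 0) → ξ = 0
  /-- the frame of `p g` is the frame of `p` composed with `v ↦ g v g⁻¹`, the image of `g` under the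
  double cover `Spin(n) → SO(n)` -/
  frame_smul : ∀ (g : SpinGrp n) (p : P) (v w : Euc n),
    CliffordAlgebra.ι (cliffordForm n) w =
      (g : Cl n) * CliffordAlgebra.ι (cliffordForm n) v * (g⁻¹ : SpinGrp n) →
    (⟨proj (MulOpposite.op g • p), frame (MulOpposite.op g • p) v⟩ : TangentBundle (𝓡 n) M) =
      ⟨proj p, frame p w⟩

namespace SpinStructure

variable [IsContMDiffRiemannianBundle (𝓡 n) ∞ (Euc n) (fun x : M ↦ TangentSpace (𝓡 n) x)]
  {P : Type*} [TopologicalSpace P] [ChartedSpace (Euc (n * (n + 1) / 2)) P]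
  [IsManifold (𝓡 (n * (n + 1) / 2)) ∞ P] [MulAction (SpinGrp n)ᵐᵒᵖ P]
  [ContinuousSMul (SpinGrp n)ᵐᵒᵖ P]
  (S : SpinStructure n M P)
  (cov : CovariantDerivative (𝓡 n) (Euc n) (fun x : M ↦ TangentSpace (𝓡 n) x))

/-- The differential `π_* : T_p P → T_{π(p)} M`. -/
def dproj (p : P) : TangentSpace (𝓡 (n * (n + 1) / 2)) p →L[ℝ] TangentSpace (𝓡 n) (S.proj p) :=
  mfderiv (𝓡 (n * (n + 1) / 2)) (𝓡 n) S.proj p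

/-- The covariant derivative along `π` of a vector field `V` along `π`,
`∇_ξ V = D_ξ V + Γ(π_* ξ, V)`. In the trivialization of `TM` at `x = π(p)` the first term
differentiates the components of `V`; the second is the covariant derivative at `x` in the direction
`π_* ξ` of the vector field with the constant components of `V(p)`. -/
def covAlong (V : ∀ p : P, TangentSpace (𝓡 n) (S.proj p)) (p : P) :
    TangentSpace (𝓡 (n * (n + 1) / 2)) p →L[ℝ] TangentSpace (𝓡 n) (S.proj p) :=
  let t := trivializationAt (Euc n) (fun x : M ↦ TangentSpace (𝓡 n) x) (S.proj p)
  let comp : P → Euc n := fun q ↦ (t ⟨S.proj q, V q⟩).2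
  (t.symmL ℝ (S.proj p)).comp (mfderiv (𝓡 (n * (n + 1) / 2)) 𝓘(ℝ, Euc n) comp p)
    + (cov (FiberBundle.extend (Euc n) (V p)) (S.proj p)).comp (S.dproj p)

/-- The spinorial connection form `ω`, a one-form on `P` with values in `𝔰𝔭𝔦𝔫(n)`. For the
Levi-Civita connection it is `τ⁻¹` of the pull-back to `P` of the connection form on the
orthonormal frame bundle: `τ(ω(ξ)) e_i = f⁻¹ (∇_ξ (f e_i))` for the frame `f`. -/
def connForm (p : P) : TangentSpace (𝓡 (n * (n + 1) / 2)) p →L[ℝ] SpinAlg n :=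
  ((EuclideanSpace.equiv (Pairs n) ℝ).symm : (Pairs n → ℝ) →L[ℝ] SpinAlg n).comp
    (ContinuousLinearMap.pi fun ij : Pairs n ↦
      (1 / 2 : ℝ) • (innerSL ℝ (S.frame p (stdVec ij.1.2))).comp
        (S.covAlong cov (fun q ↦ S.frame q (stdVec ij.1.1)) p))

/-- The horizontal space `H_p = ker ω_p`. -/
def horizontal (p : P) : Submodule ℝ (TangentSpace (𝓡 (n * (n + 1) / 2)) p) :=
  (S.connForm cov p).ker

/-- The curvature `Ω` of the distribution `H`, for horizontal vectors: there
`Ω = dω + [ω, ω] / 2` is equal to `dω`. -/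
def spinCurvature (p : P) (ξ η : S.horizontal cov p) : SpinAlg n :=
  extDerivOneForm (S.connForm cov) p ξ η

/-- The horizontal lift `T_{π(p)} M → H_p`, inverse of the isomorphism `π_* : H_p → T_{π(p)} M`. -/
def horizontalLift (p : P) : TangentSpace (𝓡 n) (S.proj p) →L[ℝ] S.horizontal cov p :=
  ((S.dproj p).comp (S.horizontal cov p).subtypeL).inverse

/-- The operator `τ(A · Ω_p)`, defined by `⟨τ(A · Ω_p) v, w⟩ = 2 ⟨A, Ω_p(v, w)⟩` for horizontal `v`,
`w` (`inner_curvatureOp`). It is transported from `H_p` to `T_{π(p)} M` by the isometry `π_*`, and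
written with its matrix in the orthonormal frame of `p`. -/
def curvatureOp (p : P) (A : SpinAlg n) :
    TangentSpace (𝓡 n) (S.proj p) →L[ℝ] TangentSpace (𝓡 n) (S.proj p) :=
  ∑ k : Fin n, ∑ l : Fin n,
    (2 * inner ℝ A (S.spinCurvature cov p (S.horizontalLift cov p (S.frame p (stdVec l)))
      (S.horizontalLift cov p (S.frame p (stdVec k))))) •
    (innerSL ℝ (S.frame p (stdVec l))).smulRight (S.frame p (stdVec k))

set_option linter.unusedSectionVars false in
theorem sum_inner_frame (p : P) (u : TangentSpace (𝓡 n) (S.proj p)) :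
    ∑ i : Fin n, inner ℝ (S.frame p (stdVec i)) u • S.frame p (stdVec i) = u := by
  have h := ((EuclideanSpace.basisFun (Fin n) ℝ).map (S.frame p)).sum_repr' u
  simpa [stdVec] using h

theorem inner_curvatureOp (p : P) (A : SpinAlg n) (u w : TangentSpace (𝓡 n) (S.proj p)) :
    inner ℝ (S.curvatureOp cov p A u) w =
      2 * inner ℝ A (S.spinCurvature cov p (S.horizontalLift cov p u)
        (S.horizontalLift cov p w)) := by
  conv_rhs => rw [← S.sum_inner_frame p u, ← S.sum_inner_frame p w]
  simp only [spinCurvature, map_sum, map_smul, AddSubmonoidClass.coe_finsetSum,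
    Submodule.coe_smul, extDerivOneForm_sum, inner_sum, inner_smul_right]
  simp only [curvatureOp, _root_.sum_apply, sum_inner, _root_.smul_apply,
    ContinuousLinearMap.smulRight_apply, inner_smul_left, innerSL_apply_apply, spinCurvature,
    Finset.mul_sum, RCLike.conj_to_real]
  rw [Finset.sum_comm]
  refine Finset.sum_congr rfl fun l _ ↦ Finset.sum_congr rfl fun k _ ↦ ?_
  ring

end SpinStructure

/-! ### The analytic functions of the curvature operator -/

/-- `(I - exp(-T)) / T = ∑ (-1) ^ k T ^ k / (k + 1)!`. -/
def oneSubExpNegDiv {V : Type*} [NormedAddCommGroup V] [NormedSpace ℝ V] (T : V →L[ℝ] V) :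
    V →L[ℝ] V :=
  ∑' k : ℕ, ((-1 : ℝ) ^ k / (k + 1).factorial) • T ^ k

namespace SpinStructure

variable [IsContMDiffRiemannianBundle (𝓡 n) ∞ (Euc n) (fun x : M ↦ TangentSpace (𝓡 n) x)]
  {P : Type*} [TopologicalSpace P] [ChartedSpace (Euc (n * (n + 1) / 2)) P]
  [IsManifold (𝓡 (n * (n + 1) / 2)) ∞ P] [MulAction (SpinGrp n)ᵐᵒᵖ P]
  [ContinuousSMul (SpinGrp n)ᵐᵒᵖ P]
  (S : SpinStructure n M P)
  (cov : CovariantDerivative (𝓡 n) (Euc n) (fun x : M ↦ TangentSpace (𝓡 n) x))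

/-- The operator `(I - exp(-τ(A · Ω_p) / 2)) / (τ(A · Ω_p) / 2)`. -/
def jacobiOp (p : P) (A : SpinAlg n) :
    TangentSpace (𝓡 n) (S.proj p) →L[ℝ] TangentSpace (𝓡 n) (S.proj p) :=
  oneSubExpNegDiv ((1 / 2 : ℝ) • S.curvatureOp cov p A)

/-- `Ψ(A) = ⟨v, ((I - exp(-τ(A · Ω_p) / 2)) / (τ(A · Ω_p) / 2))⁻¹ v⟩` for `v` in `H_p`. -/
def psi (p : P) (v : S.horizontal cov p) (A : SpinAlg n) : ℝ :=
  inner ℝ (S.dproj p v) (Ring.inverse (S.jacobiOp cov p A) (S.dproj p v))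

end SpinStructure
end Spin

/-! ### The Grassmann calculus -/

/-- The multi-index `α` as a list of pairs, in which `(i, j)` occurs `α i j` times. -/
def indexList {n : ℕ} (α : Pairs n → ℕ) : List (Pairs n) :=
  (Finset.univ : Finset (Pairs n)).toList.flatMap fun ij ↦ List.replicate (α ij) ij

/-- The partial derivative `∂^α Ψ (A)` in the coordinates of `𝔰𝔭𝔦𝔫(n)`. -/
def multiDeriv {n : ℕ} (Ψ : SpinAlg n → ℝ) (A : SpinAlg n) (α : Pairs n → ℕ) : ℝ :=
  iteratedFDeriv ℝ (indexList α).length Ψ A fun m ↦ SpinAlg.basisVec ((indexList α).get m)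

/-- The coordinate form `e^i` on Euclidean space, as an element of the exterior algebra of the
dual space. -/
def dualVec {n : ℕ} (i : Fin n) : ExteriorAlgebra ℝ (Module.Dual ℝ (Euc n)) :=
  ExteriorAlgebra.ι ℝ ((EuclideanSpace.proj i : Euc n →L[ℝ] ℝ) : Euc n →ₗ[ℝ] ℝ)

/-- The evaluation `Ψ(A + c e ∧ e^*) = ∑_α (1 / α!) ∂^α Ψ (A) ∏_{i < j} (c e^i ∧ e^j) ^ α_ij`: the
Taylor expansion of `Ψ` at `A`, evaluated at the commuting elements `c e^i ∧ e^j`. Only the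
finitely many multi-indices with entries `0` and `1` contribute. -/
def grassmannEval {n : ℕ} (Ψ : SpinAlg n → ℝ) (A : SpinAlg n) (c : ℝ) :
    ExteriorAlgebra ℝ (Module.Dual ℝ (Euc n)) :=
  ∑ᶠ α : Pairs n → ℕ, ((∏ ij, ((α ij).factorial : ℝ))⁻¹ * multiDeriv Ψ A α) •
    ((indexList α).map fun ij ↦ c • (dualVec ij.1.1 * dualVec ij.1.2)).prod

/-- The power series of `z coth z = cosh z / (sinh z / z)`. -/
def zCothSeries : PowerSeries ℝ :=
  PowerSeries.mk (fun k ↦ if Even k then ((k.factorial : ℝ))⁻¹ else 0) *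
    (PowerSeries.mk fun k ↦ if Even k then (((k + 1).factorial : ℝ))⁻¹ else 0)⁻¹

/-- `X coth X` for a nilpotent element `X` of an algebra. -/
def nilCoth {B : Type*} [Ring B] [Algebra ℝ B] (X : B) : B :=
  ∑ᶠ k : ℕ, PowerSeries.coeff k zCothSeries • X ^ k

section Curvature

variable {n : ℕ} {M : Type*} [TopologicalSpace M] [ChartedSpace (Euc n) M] [IsManifold (𝓡 n) ∞ M]
  [RiemannianBundle (fun x : M ↦ TangentSpace (𝓡 n) x)]

/-- For an orthonormal basis `b` of `T_x M`, the form `⟨b_i, ·⟩` in the exterior algebra of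
`T_x^* M`. -/
def coframe {x : M} (b : OrthonormalBasis (Fin n) ℝ (TangentSpace (𝓡 n) x)) (i : Fin n) :
    ExteriorAlgebra ℝ (Module.Dual ℝ (TangentSpace (𝓡 n) x)) :=
  ExteriorAlgebra.ι ℝ (b.toBasis.coord i)

/-- The Riemannian curvature `R_x = ∑_{i < j} R(b_i, b_j) b^i ∧ b^j`, a two-form at `x` with values
in the endomorphisms of `T_x M`, as a matrix of two-forms with respect to the orthonormal
basis `b`. -/
def curvatureMatrix (cov : CovariantDerivative (𝓡 n) (Euc n) (fun x : M ↦ TangentSpace (𝓡 n) x))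
    (x : M) (b : OrthonormalBasis (Fin n) ℝ (TangentSpace (𝓡 n) x)) :
    Matrix (Fin n) (Fin n) (ExteriorAlgebra ℝ (Module.Dual ℝ (TangentSpace (𝓡 n) x))) :=
  fun k l ↦ ∑ ij : Pairs n,
    (inner ℝ (b k) (curvatureTensor cov x (b ij.1.1) (b ij.1.2) (b l)) : ℝ) •
      (coframe b ij.1.1 * coframe b ij.1.2)

/-- `⟨u, (R_x / 2) coth(R_x / 2) u⟩`, an element of the exterior algebra of `T_x^* M`. It does
not depend on the orthonormal basis `b`. -/
def curvatureCoth (cov : CovariantDerivative (𝓡 n) (Euc n) (fun x : M ↦ TangentSpace (𝓡 n) x))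
    (x : M) (b : OrthonormalBasis (Fin n) ℝ (TangentSpace (𝓡 n) x)) (u : TangentSpace (𝓡 n) x) :
    ExteriorAlgebra ℝ (Module.Dual ℝ (TangentSpace (𝓡 n) x)) :=
  ∑ k : Fin n, ∑ l : Fin n, ((inner ℝ (b k) u : ℝ) * inner ℝ (b l) u) •
    nilCoth ((1 / 2 : ℝ) • curvatureMatrix cov x b) k l

/-- The identification of the exterior algebra of the dual of Euclidean space with that of
`T_x^* M` which belongs to a frame `f`. -/
def exteriorIdent {x : M} (f : Euc n ≃ₗᵢ[ℝ] TangentSpace (𝓡 n) x) :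
    ExteriorAlgebra ℝ (Module.Dual ℝ (Euc n)) →ₐ[ℝ]
      ExteriorAlgebra ℝ (Module.Dual ℝ (TangentSpace (𝓡 n) x)) :=
  ExteriorAlgebra.map (f.symm.toLinearEquiv : TangentSpace (𝓡 n) x →ₗ[ℝ] Euc n).dualMap

end Curvature
end

noncomputable section

set_option linter.unusedSectionVars false

/-! ### Evaluation of Taylor expansions at commuting elements of square zero -/

section GrassmannCalculus

variable {E : Type*} [NormedAddCommGroup E] [NormedSpace ℝ E] {ι : Type*}
  {B : Type*} [Ring B] [Algebra ℝ B]

/-! Write `F(A) = τ(A · Ω_p) / 2`, an operator linear in `A`. The proof joins a geometric fact about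
`F` to an algebraic fact about the evaluation `A ↦ 2 e ∧ e^*`.

Geometry. The components of the connection form are `ω_ij = ⟨f_j, ∇ f_i⟩ / 2` for the moving frame
`f`. A vector is horizontal exactly when all `f_i` are parallel along it, and for such vectors the
structure equation gives `Ω_ij(v, w) = ⟨R(v, w) f_i, f_j⟩ / 2`
(`SpinStructure.spinCurvature_apply`). The pair symmetry of `R` exchanges the form slots with the
endomorphism slots, so `τ(A · Ω_p) = ∑ a_ij R(f_i, f_j)` (`SpinStructure.inner_curvatureOp_frame`).
Replacing `a_ij` by `2 e^i ∧ e^j` therefore turns the matrix of `F` into the matrix `X` of `R_x`.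

Algebra. The elements `2 e^i ∧ e^j` commute and have square zero, so only derivatives of order at
most one in each coordinate survive. By the Leibniz rule the evaluation is then a ring homomorphism
on germs of analytic functions (`taylorEval_mul`), and it extends to operator-valued germs entry by
entry (`taylorEvalMatrix_mul`). Since `X` has entries of degree two it is nilpotent. Writing `(1 -
exp(-F)) / F` as a polynomial in `F` plus `F ^ N` times an analytic remainder shows that its
evaluation is the same power series at `X`; no limit has to be interchanged with the evaluation. The
evaluation of the inverse operator is then the inverse matrix.

Conclusion. As power series, `z / (1 - exp(-z)) = (z / 2) coth(z / 2) + z / 2`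
(`oneSubExpNegSeries_mul`). The odd summand contributes `⟨v, X v⟩ / 2`, which vanishes because `X`
is skew, and the even summand is the asserted form. -/

/-- The Taylor expansion at `a` of `Ψ` in the directions `e i`, `i ∈ L`, evaluated at the
elements `x i`, when these commute and have square zero. -/
def taylorEval (e : ι → E) (x : ι → B) (a : E) : List ι → (E → ℝ) → B
  | [], Ψ => algebraMap ℝ B (Ψ a)
  | i :: L, Ψ => taylorEval e x a L Ψ + x i * taylorEval e x a L (fun y ↦ fderiv ℝ Ψ y (e i))

variable {e : ι → E} {x : ι → B} {a : E}

/-- Regularity `ω` is preserved by differentiation, so inductions over the list of directions need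
no count of the remaining derivatives. -/
theorem ContDiffAt.fderiv_apply_const_omega {F : Type*} [NormedAddCommGroup F] [NormedSpace ℝ F]
    {Ψ : E → F} (h : ContDiffAt ℝ ω Ψ a) (v : E) :
    ContDiffAt ℝ ω (fun y ↦ fderiv ℝ Ψ y v) a :=
  (h.fderiv_right (m := ω) le_rfl).clm_apply contDiffAt_const

theorem ContDiffAt.eventually_differentiableAt_omega {Ψ : E → ℝ} (h : ContDiffAt ℝ ω Ψ a) :
    ∀ᶠ y in 𝓝 a, DifferentiableAt ℝ Ψ y :=
  (h.eventually (by simp)).mono fun _ hy ↦ hy.differentiableAt (by simp)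

/-- Only the germ at `a` enters. This is needed because the product rule and the identity between an
operator and its inverse are available only near `a`. -/
theorem taylorEval_congr (L : List ι) : ∀ {Ψ Φ : E → ℝ}, Ψ =ᶠ[𝓝 a] Φ →
    taylorEval e x a L Ψ = taylorEval e x a L Φ := by
  induction L with
  | nil => intro Ψ Φ h; simp [taylorEval, h.self_of_nhds]
  | cons i L ih =>
    intro Ψ Φ h
    rw [taylorEval, taylorEval, ih h]
    congr 2
    refine ih ?_
    filter_upwards [h.fderiv (𝕜 := ℝ)] with y hy
    rw [hy]

theorem taylorEval_const (L : List ι) : ∀ c : ℝ,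
    taylorEval e x a L (fun _ ↦ c) = algebraMap ℝ B c := by
  induction L with
  | nil => intro c; simp [taylorEval]
  | cons i L ih => intro c; simp [taylorEval, ih]

theorem taylorEval_add (L : List ι) : ∀ {Ψ Φ : E → ℝ}, ContDiffAt ℝ ω Ψ a → ContDiffAt ℝ ω Φ a →
    taylorEval e x a L (fun y ↦ Ψ y + Φ y) = taylorEval e x a L Ψ + taylorEval e x a L Φ := by
  induction L with
  | nil => intro Ψ Φ _ _; simp [taylorEval]
  | cons i L ih =>
    intro Ψ Φ h h'
    have key : (fun y ↦ fderiv ℝ (fun y ↦ Ψ y + Φ y) y (e i)) =ᶠ[𝓝 a]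
        fun y ↦ fderiv ℝ Ψ y (e i) + fderiv ℝ Φ y (e i) := by
      filter_upwards [h.eventually_differentiableAt_omega,
        h'.eventually_differentiableAt_omega] with y hy hy'
      rw [fderiv_fun_add hy hy']; rfl
    simp only [taylorEval]
    rw [taylorEval_congr L key, ih h h', ih (h.fderiv_apply_const_omega _)
      (h'.fderiv_apply_const_omega _), mul_add]
    abel

theorem taylorEval_sum (L : List ι) {κ : Type*} (s : Finset κ) {Ψ : κ → E → ℝ}
    (h : ∀ k ∈ s, ContDiffAt ℝ ω (Ψ k) a) :
    taylorEval e x a L (fun y ↦ ∑ k ∈ s, Ψ k y) = ∑ k ∈ s, taylorEval e x a L (Ψ k) := by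
  classical
  induction s using Finset.induction_on with
  | empty => simpa using taylorEval_const (e := e) (x := x) (a := a) L (0 : ℝ)
  | insert k s hk ih =>
    simp only [Finset.sum_insert hk]
    rw [taylorEval_add L (h k (by simp)), ih fun j hj ↦ h j (by simp [hj])]
    exact ContDiffAt.sum fun j hj ↦ h j (by simp [hj])

theorem commute_taylorEval (hx : ∀ i j, Commute (x i) (x j)) (i : ι) (L : List ι) :
    ∀ Ψ : E → ℝ, Commute (x i) (taylorEval e x a L Ψ) := by
  induction L with
  | nil => intro Ψ; exact (Algebra.commutes _ _).symm
  | cons j L ih => intro Ψ; exact (ih _).add_right ((hx i j).mul_right (ih _))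

/-- The Leibniz rule in each direction: modulo `x i ^ 2 = 0`, a first-order expansion of a product
is the product of the first-order expansions. -/
theorem taylorEval_mul (hx : ∀ i j, Commute (x i) (x j)) (hx2 : ∀ i, x i * x i = 0)
    (L : List ι) : ∀ {Ψ Φ : E → ℝ}, ContDiffAt ℝ ω Ψ a → ContDiffAt ℝ ω Φ a →
    taylorEval e x a L (fun y ↦ Ψ y * Φ y) = taylorEval e x a L Ψ * taylorEval e x a L Φ := by
  induction L with
  | nil => intro Ψ Φ _ _; simp [taylorEval]
  | cons i L ih =>
    intro Ψ Φ h h'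
    have key : (fun y ↦ fderiv ℝ (fun y ↦ Ψ y * Φ y) y (e i)) =ᶠ[𝓝 a]
        fun y ↦ Ψ y * fderiv ℝ Φ y (e i) + fderiv ℝ Ψ y (e i) * Φ y := by
      filter_upwards [h.eventually_differentiableAt_omega,
        h'.eventually_differentiableAt_omega] with y hy hy'
      rw [fderiv_fun_mul hy hy']
      simp [mul_comm]
    have hd := h.fderiv_apply_const_omega (e i)
    have hd' := h'.fderiv_apply_const_omega (e i)
    simp only [taylorEval]
    rw [taylorEval_congr L key, ih h h', taylorEval_add L (h.mul hd') (hd.mul h'), ih h hd',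
      ih hd h']
    have c1 := commute_taylorEval (e := e) (a := a) hx i L Ψ
    have c2 := commute_taylorEval (e := e) (a := a) hx i L (fun y ↦ fderiv ℝ Ψ y (e i))
    generalize taylorEval e x a L Ψ = p at *
    generalize taylorEval e x a L Φ = q at *
    generalize taylorEval e x a L (fun y ↦ fderiv ℝ Ψ y (e i)) = r at *
    generalize taylorEval e x a L (fun y ↦ fderiv ℝ Φ y (e i)) = s at *
    -- The two expansions are `p + x i * r` and `q + x i * s`. Commutation brings every `x i` to the
    -- left, and the cross term `x i * r * (x i * s)` contains the square of `x i`.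
    have e1 : p * (x i * s) = x i * (p * s) := by rw [← mul_assoc, ← c1.eq, mul_assoc]
    have e2 : x i * r * (x i * s) = 0 := by
      rw [c2.eq, mul_assoc, ← mul_assoc (x i) (x i), hx2, zero_mul, mul_zero]
    rw [add_mul, mul_add p, mul_add (x i * r), e1, e2]
    simp only [mul_add, mul_assoc, add_zero]
    abel

theorem taylorEval_const_smul (L : List ι) {Ψ : E → ℝ} (c : ℝ) : ContDiffAt ℝ ω Ψ a →
    taylorEval e x a L (fun y ↦ c * Ψ y) = c • taylorEval e x a L Ψ := by
  induction L generalizing Ψ with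
  | nil => intro _; simp [taylorEval, Algebra.smul_def]
  | cons i L ih =>
    intro h
    have key : (fun y ↦ fderiv ℝ (fun y ↦ c * Ψ y) y (e i)) =ᶠ[𝓝 a]
        fun y ↦ c * fderiv ℝ Ψ y (e i) := by
      filter_upwards [h.eventually_differentiableAt_omega] with y hy
      rw [fderiv_const_mul hy]; rfl
    simp only [taylorEval]
    rw [taylorEval_congr L key, ih h, ih (h.fderiv_apply_const_omega _), smul_add, mul_smul_comm]

/-- The derivatives of `φ` are constant, so no second-order terms appear; the base point `0` removes
the term of order zero. -/
theorem taylorEval_linear (L : List ι) (φ : E →L[ℝ] ℝ) :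
    taylorEval e x 0 L φ = (L.map fun i ↦ φ (e i) • x i).sum := by
  induction L with
  | nil => simp [taylorEval]
  | cons i L ih =>
    simp only [taylorEval, ih, ContinuousLinearMap.fderiv, taylorEval_const, List.map_cons,
      List.sum_cons]
    rw [add_comm, Algebra.smul_def, Algebra.commutes]

/-- The first direction of an iterated derivative can be moved to the function. -/
theorem iteratedFDeriv_list_cons {Ψ : E → ℝ} (h : ContDiffAt ℝ ω Ψ a) (i : ι) (l : List ι) :
    iteratedFDeriv ℝ (i :: l).length Ψ a (fun m ↦ e ((i :: l).get m)) =
      iteratedFDeriv ℝ l.length (fun y ↦ fderiv ℝ Ψ y (e i)) a (fun m ↦ e (l.get m)) := by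
  have h1 := ContinuousLinearMap.iteratedFDeriv_comp_left
    (ContinuousLinearMap.apply ℝ ℝ (e i)) (h.fderiv_right (m := ω) le_rfl)
    (i := l.length) (by exact_mod_cast le_top)
  have h2 : (ContinuousLinearMap.apply ℝ ℝ (e i)) ∘ fderiv ℝ Ψ = fun y ↦ fderiv ℝ Ψ y (e i) := rfl
  rw [h2] at h1
  rw [h1]
  -- `iteratedFDeriv_succ_apply_right` splits off the last argument, while the list carries the
  -- direction in front. Symmetry of the iterated derivative under a cyclic rotation moves it from
  -- one end to the other.
  have h3 := h.iteratedFDeriv_comp_perm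
    (Fin.cons (α := fun _ ↦ E) (e i) fun m : Fin l.length ↦ e (l.get m)) (finRotate _)
  have h4 : (Fin.cons (α := fun _ ↦ E) (e i) fun m : Fin l.length ↦ e (l.get m)) =
      fun m ↦ e ((i :: l).get m) := by
    ext m
    refine Fin.cases ?_ (fun m ↦ ?_) m <;> simp
  have h5 : (Fin.cons (α := fun _ ↦ E) (e i) fun m : Fin l.length ↦ e (l.get m)) ∘ finRotate _ =
      Fin.snoc (α := fun _ ↦ E) (fun m : Fin l.length ↦ e (l.get m)) (e i) := by
    rw [Fin.snoc_eq_cons_rotate]; rfl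
  rw [h5, iteratedFDeriv_succ_apply_right, Fin.init_snoc, Fin.snoc_last, h4] at h3
  exact h3.symm

/-- Unrolling the recursion, each direction of `L` is either skipped or differentiated once, which
is a choice of a subset. Filtering `L` keeps the order of the factors, so no commutation is needed.
-/
theorem taylorEval_eq_sum_powerset [DecidableEq ι] (L : List ι) (hL : L.Nodup) :
    ∀ {Ψ : E → ℝ}, ContDiffAt ℝ ω Ψ a → taylorEval e x a L Ψ =
      ∑ S ∈ L.toFinset.powerset,
        iteratedFDeriv ℝ (L.filter (· ∈ S)).length Ψ a (fun m ↦ e ((L.filter (· ∈ S)).get m)) •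
          ((L.filter (· ∈ S)).map x).prod := by
  induction L with
  | nil => 
    intro Ψ h
    simp only [taylorEval, Algebra.algebraMap_eq_smul_one, List.toFinset_nil,
      Finset.powerset_empty, Finset.sum_singleton, List.filter_nil, List.map_nil, List.prod_nil]
    exact congrArg (· • (1 : B)) (iteratedFDeriv_zero_apply _).symm
  | cons i L ih =>
    intro Ψ h
    rw [List.nodup_cons] at hL
    have hi : i ∉ L.toFinset := by simpa using hL.1
    rw [List.toFinset_cons, Finset.sum_powerset_insert hi, taylorEval, ih hL.2 h,
      ih hL.2 (h.fderiv_apply_const_omega (e i)), Finset.mul_sum]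
    congr 1
    · refine Finset.sum_congr rfl fun S hS ↦ ?_
      have : i ∉ S := fun hiS ↦ hi (Finset.mem_powerset.1 hS hiS)
      rw [List.filter_cons_of_neg (by simpa using this)]
    · refine Finset.sum_congr rfl fun S hS ↦ ?_
      have h1 : (i :: L).filter (· ∈ insert i S) = i :: L.filter (· ∈ S) := by
        rw [List.filter_cons_of_pos (by simp)]
        congr 1
        refine List.filter_congr fun j hj ↦ ?_
        have : j ≠ i := fun hji ↦ hL.1 (hji ▸ hj)
        simp [this]
      rw [h1, iteratedFDeriv_list_cons h, mul_smul_comm]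
      simp

end GrassmannCalculus

/-! ### The Grassmann evaluation as a first-order Taylor expansion. -/

section GrassmannEval

variable {n : ℕ}

theorem dualVec_mul_self (i : Fin n) : dualVec i * dualVec i = 0 :=
  ExteriorAlgebra.ι_sq_zero _

theorem dualVec_mul_swap (i j : Fin n) : dualVec i * dualVec j = -(dualVec j * dualVec i) :=
  eq_neg_of_add_eq_zero_left (ExteriorAlgebra.ι_add_mul_swap _ _)

theorem commute_dualVec_mul (i j k : Fin n) : Commute (dualVec i * dualVec j) (dualVec k) := by
  rw [commute_iff_eq, mul_assoc, dualVec_mul_swap j k, mul_neg, ← mul_assoc, dualVec_mul_swap i k,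
    neg_mul, neg_neg, mul_assoc]

/-- The element `c e^i ∧ e^j`. -/
def scaledTwoForm (c : ℝ) (ij : Pairs n) : ExteriorAlgebra ℝ (Module.Dual ℝ (Euc n)) :=
  c • (dualVec ij.1.1 * dualVec ij.1.2)

theorem commute_scaledTwoForm (c : ℝ) (i j : Pairs n) :
    Commute (scaledTwoForm c i) (scaledTwoForm c j) :=
  (((commute_dualVec_mul _ _ _).mul_right (commute_dualVec_mul _ _ _)).smul_left c).smul_right c

theorem scaledTwoForm_mul_self (c : ℝ) (i : Pairs n) :
    scaledTwoForm c i * scaledTwoForm c i = 0 := by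
  rw [scaledTwoForm, smul_mul_smul_comm, mul_assoc, ← mul_assoc (dualVec i.1.2),
    dualVec_mul_swap i.1.2, neg_mul, mul_neg, mul_assoc, dualVec_mul_self]
  simp

theorem map_indexList_prod {B : Type*} [Monoid B] (x : Pairs n → B) (α : Pairs n → ℕ) :
    ((indexList α).map x).prod =
      ((Finset.univ : Finset (Pairs n)).toList.map fun ij ↦ x ij ^ α ij).prod := by
  unfold indexList
  induction (Finset.univ : Finset (Pairs n)).toList with
  | nil => simp
  | cons i L ih => simp [ih]

theorem indexList_indicator (S : Finset (Pairs n)) :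
    indexList (fun i ↦ if i ∈ S then 1 else 0) =
      (Finset.univ : Finset (Pairs n)).toList.filter (· ∈ S) := by
  unfold indexList
  induction (Finset.univ : Finset (Pairs n)).toList with
  | nil => simp
  | cons i L ih =>
    rw [List.flatMap_cons, ih]
    by_cases hi : i ∈ S <;> simp [hi]

/-- A multi-index with an entry at least `2` gives a product containing a square of some `c e^i ∧
e^j`, hence zero. The remaining ones are indicator functions of sets of pairs, and for these `α! =
1`. -/
theorem grassmannEval_eq_taylorEval {Ψ : SpinAlg n → ℝ} {A : SpinAlg n} (h : ContDiffAt ℝ ω Ψ A)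
    (c : ℝ) : grassmannEval Ψ A c =
      taylorEval SpinAlg.basisVec (scaledTwoForm c) A (Finset.univ : Finset (Pairs n)).toList Ψ := by
  let ind : Finset (Pairs n) → Pairs n → ℕ := fun S i ↦ if i ∈ S then 1 else 0
  have hind : Function.Injective ind := by
    intro S S' hS
    ext i
    have := congrFun hS i
    by_cases h1 : i ∈ S <;> by_cases h2 : i ∈ S' <;> simp_all [ind]
  rw [taylorEval_eq_sum_powerset _ (Finset.nodup_toList _) h, grassmannEval,
    finsum_eq_sum_of_support_subset (s := Finset.univ.image ind), Finset.sum_image hind.injOn]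
  · rw [Finset.toList_toFinset, Finset.powerset_univ]
    refine Finset.sum_congr rfl fun S _ ↦ ?_
    have h1 : (∏ ij, ((ind S ij).factorial : ℝ)) = 1 := by
      refine Finset.prod_eq_one fun i _ ↦ ?_
      by_cases hi : i ∈ S <;> simp [ind, hi]
    rw [h1, inv_one, one_mul, multiDeriv, indexList_indicator]
    rfl
  · intro α hα
    by_contra hα'
    have : ∃ i, 2 ≤ α i := by
      by_contra! hlt
      refine hα' ?_
      simp only [Finset.coe_image, Finset.coe_univ, Set.image_univ, Set.mem_range]
      refine ⟨Finset.univ.filter fun i ↦ α i = 1, ?_⟩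
      ext i
      have := hlt i
      by_cases h1 : α i = 1
      · simp [ind, h1]
      · simp only [ind, Finset.mem_filter, Finset.mem_univ, true_and, h1, if_false]
        omega
    obtain ⟨i, hi⟩ := this
    refine hα ?_
    change _ • ((indexList α).map (scaledTwoForm c)).prod = 0
    rw [map_indexList_prod, List.prod_eq_zero, smul_zero]
    rw [List.mem_map]
    refine ⟨i, by simp, ?_⟩
    obtain ⟨k, hk⟩ := Nat.exists_eq_add_of_le hi
    rw [hk, pow_add, pow_two, scaledTwoForm_mul_self, zero_mul]

end GrassmannEval

/-! ### Power series at nilpotent elements -/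

section NilpotentEval

variable {B : Type*} [Ring B] [Algebra ℝ B]

/-- The value of a power series at a nilpotent element. -/
def nilEval (p : PowerSeries ℝ) (X : B) : B := ∑ᶠ k : ℕ, PowerSeries.coeff k p • X ^ k

variable {X : B} {N : ℕ}

theorem nilEval_eq_sum (hX : X ^ N = 0) (p : PowerSeries ℝ) :
    nilEval p X = ∑ k ∈ Finset.range N, PowerSeries.coeff k p • X ^ k := by
  refine finsum_eq_sum_of_support_subset _ fun k hk ↦ ?_
  by_contra hkN
  refine hk ?_
  have : N ≤ k := by simpa using hkN
  change _ • X ^ k = 0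
  rw [pow_eq_zero_of_le this hX, smul_zero]

/-- Passing to a truncated polynomial makes the algebra-homomorphism laws of `Polynomial.aeval`
available. -/
theorem nilEval_eq_aeval (hX : X ^ N = 0) (p : PowerSeries ℝ) :
    nilEval p X = Polynomial.aeval X (PowerSeries.trunc N p) := by
  rw [nilEval_eq_sum hX]
  cases N with
  | zero =>
    -- For `N = 0` the hypothesis says that `B` is the zero ring.
    have : (1 : B) = 0 := by rwa [pow_zero] at hX
    exact eq_of_zero_eq_one this.symm _ _
  | succ N =>
    rw [Polynomial.aeval_eq_sum_range' (PowerSeries.natDegree_trunc_lt p N)]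
    refine Finset.sum_congr rfl fun k hk ↦ ?_
    rw [PowerSeries.coeff_trunc, if_pos (Finset.mem_range.1 hk)]

/-- The truncation of a product and the product of the truncations differ by a multiple of `X ^ N`,
which is zero at a nilpotent element of that order. -/
theorem nilEval_mul (hX : X ^ N = 0) (p q : PowerSeries ℝ) :
    nilEval (p * q) X = nilEval p X * nilEval q X := by
  simp only [nilEval_eq_aeval hX, ← map_mul]
  rw [← sub_eq_zero, ← map_sub]
  have : (Polynomial.X : Polynomial ℝ) ^ N ∣
      PowerSeries.trunc N (p * q) - PowerSeries.trunc N p * PowerSeries.trunc N q := by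
    rw [Polynomial.X_pow_dvd_iff]
    intro d hd
    rw [Polynomial.coeff_sub, PowerSeries.coeff_trunc, if_pos hd, ← Polynomial.coeff_coe,
      Polynomial.coe_mul, PowerSeries.coeff_mul_eq_coeff_trunc_mul_trunc p q hd, sub_self]
  obtain ⟨r, hr⟩ := this
  rw [hr, map_mul, map_pow, Polynomial.aeval_X, hX, zero_mul]

theorem nilEval_add (hX : X ^ N = 0) (p q : PowerSeries ℝ) :
    nilEval (p + q) X = nilEval p X + nilEval q X := by
  simp only [nilEval_eq_aeval hX, map_add]

theorem nilEval_one (hX : X ^ N = 0) : nilEval 1 X = 1 := by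
  -- The exponent is raised so that the truncation keeps the constant term even when `N = 0`.
  rw [nilEval_eq_aeval (N := N + 1) (by rw [pow_succ, hX, zero_mul])]
  simp [PowerSeries.trunc_one]

theorem nilEval_smul_X (hX : X ^ N = 0) (c : ℝ) :
    nilEval (c • (PowerSeries.X : PowerSeries ℝ)) X = c • X := by
  rw [nilEval_eq_sum (N := N + 2) (by rw [pow_add, hX, zero_mul]),
    Finset.sum_eq_single 1]
  · simp
  · intro k _ hk; simp [PowerSeries.coeff_X, hk]
  · simp

theorem nilEval_rescale (c : ℝ) (p : PowerSeries ℝ) (X : B) :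
    nilEval (PowerSeries.rescale c p) X = nilEval p (c • X) := by
  simp only [nilEval, PowerSeries.coeff_rescale, smul_pow, smul_smul, mul_comm]

theorem map_nilEval {C : Type*} [Ring C] [Algebra ℝ C] (f : B →ₐ[ℝ] C) (hX : X ^ N = 0)
    (p : PowerSeries ℝ) : f (nilEval p X) = nilEval p (f X) := by
  rw [nilEval_eq_aeval hX, nilEval_eq_aeval (N := N) (by rw [← map_pow, hX, map_zero]),
    Polynomial.aeval_algHom_apply]

theorem constantCoeff_rescale_real (c : ℝ) (p : PowerSeries ℝ) :
    PowerSeries.constantCoeff (PowerSeries.rescale c p) = PowerSeries.constantCoeff p := by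
  simp only [← PowerSeries.coeff_zero_eq_constantCoeff_apply, PowerSeries.coeff_rescale, pow_zero,
    one_mul]

/-- The power series of `(1 - exp (-z)) / z`. -/
def oneSubExpNegSeries : PowerSeries ℝ :=
  PowerSeries.mk fun k ↦ (-1 : ℝ) ^ k / (k + 1).factorial

/-- `(1 - exp (-z)) / z` has the inverse `(z / 2) coth (z / 2) + z / 2`. -/
theorem oneSubExpNegSeries_mul :
    (PowerSeries.rescale (1 / 2 : ℝ) zCothSeries + (1 / 2 : ℝ) • PowerSeries.X) *
      oneSubExpNegSeries = 1 := by
  -- Here `s` is `sinh z / z` and `c` is `cosh z`. The identity is multiplied by `z * s(z / 2) = 2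
  -- sinh(z / 2)`, a nonzero element of a domain. By `h1` and `h3` the first factor becomes `cosh(z
  -- / 2) + sinh(z / 2) = exp(z / 2)`, and what remains is `exp(z / 2) (1 - exp(-z)) = exp(z / 2) -
  -- exp(-z / 2)`.
  set s : PowerSeries ℝ := PowerSeries.mk fun k ↦ if Even k then (((k + 1).factorial : ℝ))⁻¹ else 0
    with hs
  set c : PowerSeries ℝ := PowerSeries.mk fun k ↦ if Even k then ((k.factorial : ℝ))⁻¹ else 0
    with hc
  have hs0 : PowerSeries.constantCoeff s ≠ 0 := by
    rw [← PowerSeries.coeff_zero_eq_constantCoeff_apply, hs, PowerSeries.coeff_mk]; simp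
  have h1 : PowerSeries.rescale (1 / 2 : ℝ) s * PowerSeries.rescale (1 / 2 : ℝ) zCothSeries =
      PowerSeries.rescale (1 / 2 : ℝ) c := by
    rw [← map_mul, zCothSeries, mul_left_comm, PowerSeries.mul_inv_cancel _ hs0, mul_one]
  have h2 : PowerSeries.X * oneSubExpNegSeries =
      1 - PowerSeries.rescale (-1 : ℝ) (PowerSeries.exp ℝ) := by
    ext k
    cases k with
    | zero => simp [constantCoeff_rescale_real]
    | succ k =>
      rw [PowerSeries.coeff_succ_X_mul]
      simp [oneSubExpNegSeries, PowerSeries.coeff_rescale, PowerSeries.coeff_exp,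
        PowerSeries.coeff_one, pow_succ]
      ring
  have h3 : PowerSeries.rescale (1 / 2 : ℝ) c +
      ((1 / 2 : ℝ) • PowerSeries.X) * PowerSeries.rescale (1 / 2 : ℝ) s =
        PowerSeries.rescale (1 / 2 : ℝ) (PowerSeries.exp ℝ) := by
    ext k
    rw [smul_mul_assoc]
    cases k with
    | zero =>
      have : PowerSeries.constantCoeff c = 1 := by
        rw [← PowerSeries.coeff_zero_eq_constantCoeff_apply, hc, PowerSeries.coeff_mk]; simp
      simp [constantCoeff_rescale_real, this]
    | succ k =>
      rw [map_add, PowerSeries.coeff_smul, PowerSeries.coeff_succ_X_mul]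
      by_cases hk : Even k
      · have hk' : ¬ Even (k + 1) := by simp [Nat.even_add_one, hk]
        simp [hc, hs, PowerSeries.coeff_rescale, PowerSeries.coeff_exp, hk, hk', pow_succ]
        ring
      · have hk' : Even (k + 1) := by simp [Nat.even_add_one, hk]
        simp [hc, hs, PowerSeries.coeff_rescale, PowerSeries.coeff_exp, hk, hk']
  have h4 : PowerSeries.X * PowerSeries.rescale (1 / 2 : ℝ) s =
      PowerSeries.rescale (1 / 2 : ℝ) (PowerSeries.exp ℝ) -
        PowerSeries.rescale (-1 / 2 : ℝ) (PowerSeries.exp ℝ) := by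
    ext k
    cases k with
    | zero => simp [constantCoeff_rescale_real]
    | succ k =>
      rw [PowerSeries.coeff_succ_X_mul]
      by_cases hk : Even k
      · have hk' : ¬ Even (k + 1) := by simp [Nat.even_add_one, hk]
        have h5 : (-1 / 2 : ℝ) ^ (k + 1) = -(1 / 2) ^ (k + 1) := by
          rw [neg_div, Odd.neg_pow (Nat.not_even_iff_odd.1 hk')]
        simp only [hs, map_sub, PowerSeries.coeff_rescale, PowerSeries.coeff_exp, h5,
          PowerSeries.coeff_mk, hk, if_true, pow_succ]
        simp
        ring
      · have hk' : Even (k + 1) := by simp [Nat.even_add_one, hk]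
        have h5 : (-1 / 2 : ℝ) ^ (k + 1) = (1 / 2) ^ (k + 1) := by
          rw [neg_div, Even.neg_pow hk']
        simp only [hs, map_sub, PowerSeries.coeff_rescale, PowerSeries.coeff_exp, h5,
          PowerSeries.coeff_mk, hk, if_false, mul_zero, sub_self]
  have h6 := PowerSeries.exp_mul_exp_eq_exp_add (A := ℝ) (-1) (1 / 2)
  have h7 : (-1 + 1 / 2 : ℝ) = -1 / 2 := by norm_num
  rw [h7] at h6
  have hs' : PowerSeries.X * PowerSeries.rescale (1 / 2 : ℝ) s ≠ 0 := by
    refine mul_ne_zero PowerSeries.X_ne_zero fun h ↦ ?_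
    have := congrArg (PowerSeries.coeff 0) h
    simp [PowerSeries.coeff_rescale, hs] at this
  refine mul_left_cancel₀ hs' ?_
  calc PowerSeries.X * PowerSeries.rescale (1 / 2 : ℝ) s *
        ((PowerSeries.rescale (1 / 2 : ℝ) zCothSeries + (1 / 2 : ℝ) • PowerSeries.X) *
          oneSubExpNegSeries)
      = (PowerSeries.rescale (1 / 2 : ℝ) s * PowerSeries.rescale (1 / 2 : ℝ) zCothSeries +
          ((1 / 2 : ℝ) • PowerSeries.X) * PowerSeries.rescale (1 / 2 : ℝ) s) *
          (PowerSeries.X * oneSubExpNegSeries) := by ring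
    _ = PowerSeries.X * PowerSeries.rescale (1 / 2 : ℝ) s * 1 := by
        rw [h1, h3, h2, h4, mul_sub, mul_comm _ (PowerSeries.rescale (-1) _), h6]
        ring

end NilpotentEval

/-! ### The function `(I - exp (-T)) / T` of an operator -/

section OperatorFunction

variable {V : Type*} [NormedAddCommGroup V] [NormedSpace ℝ V]

/-- The `m`-th remainder `∑ (-1) ^ (k + m) T ^ k / (k + m + 1)!` of the series of
`(I - exp (-T)) / T`. -/
def oneSubExpNegDivTail (m : ℕ) (T : V →L[ℝ] V) : V →L[ℝ] V :=
  ∑' k : ℕ, ((-1 : ℝ) ^ (k + m) / (k + m + 1).factorial) • T ^ k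

theorem oneSubExpNegDivTail_zero (T : V →L[ℝ] V) :
    oneSubExpNegDivTail 0 T = oneSubExpNegDiv T := rfl

/-- Ratio test: consecutive coefficients have quotient `1 / (k + m + 2)` in absolute value. -/
theorem radius_ofScalars_tail (m : ℕ) : (FormalMultilinearSeries.ofScalars (V →L[ℝ] V)
    fun k : ℕ ↦ ((-1 : ℝ) ^ (k + m) / (k + m + 1).factorial)).radius = ⊤ := by
  refine FormalMultilinearSeries.ofScalars_radius_eq_top_of_tendsto _ _
    (Eventually.of_forall fun k ↦ div_ne_zero (by simp) (by positivity)) ?_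
  have h : ∀ k : ℕ, ‖(-1 : ℝ) ^ (k.succ + m) / (k.succ + m + 1).factorial‖ /
      ‖(-1 : ℝ) ^ (k + m) / (k + m + 1).factorial‖ = 1 / ((k + (m + 1) : ℕ) + 1 : ℝ) := by
    intro k
    have : k.succ + m + 1 = (k + m + 1) + 1 := by omega
    rw [this, Nat.factorial_succ]
    simp only [norm_div, norm_pow, norm_neg, norm_one, one_pow, Nat.cast_mul, norm_mul,
      RCLike.norm_natCast]
    have : ((k + m + 1).factorial : ℝ) ≠ 0 := by positivity
    field_simp
    push_cast
    ring
  simp only [h]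
  exact (tendsto_one_div_add_atTop_nhds_zero_nat (𝕜 := ℝ)).comp (tendsto_add_atTop_nat (m + 1))

variable [CompleteSpace V]

theorem hasFPowerSeriesOnBall_oneSubExpNegDivTail (m : ℕ) :
    HasFPowerSeriesOnBall (oneSubExpNegDivTail m : (V →L[ℝ] V) → V →L[ℝ] V)
      (FormalMultilinearSeries.ofScalars (V →L[ℝ] V)
        fun k : ℕ ↦ ((-1 : ℝ) ^ (k + m) / (k + m + 1).factorial)) 0 ⊤ := by
  have h := (FormalMultilinearSeries.ofScalars (V →L[ℝ] V)
    fun k : ℕ ↦ ((-1 : ℝ) ^ (k + m) / (k + m + 1).factorial)).hasFPowerSeriesOnBall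
      (by rw [radius_ofScalars_tail]; simp)
  rw [radius_ofScalars_tail] at h
  refine h.congr fun T _ ↦ ?_
  rw [FormalMultilinearSeries.sum]
  simp [oneSubExpNegDivTail, FormalMultilinearSeries.ofScalars_apply_eq]

theorem contDiff_oneSubExpNegDivTail (m : ℕ) :
    ContDiff ℝ ω (oneSubExpNegDivTail m : (V →L[ℝ] V) → V →L[ℝ] V) := by
  rw [contDiff_omega_iff_analyticOnNhd]
  have := (hasFPowerSeriesOnBall_oneSubExpNegDivTail (V := V) m).analyticOnNhd
  simpa using this

theorem summable_oneSubExpNegDivTail (m : ℕ) (T : V →L[ℝ] V) :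
    Summable fun k : ℕ ↦ ((-1 : ℝ) ^ (k + m) / (k + m + 1).factorial) • T ^ k := by
  have := (hasFPowerSeriesOnBall_oneSubExpNegDivTail (V := V) m).hasSum (y := T) (by simp)
  simpa [FormalMultilinearSeries.ofScalars_apply_eq] using this.summable

/-- The remainder carries the explicit factor `T ^ m` and an analytic cofactor, so a multiplicative
evaluation that kills the `m`-th power kills the whole remainder. -/
theorem oneSubExpNegDiv_eq_sum_add (m : ℕ) (T : V →L[ℝ] V) :
    oneSubExpNegDiv T = ∑ k ∈ Finset.range m, ((-1 : ℝ) ^ k / (k + 1).factorial) • T ^ k +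
      T ^ m * oneSubExpNegDivTail m T := by
  have h := (summable_oneSubExpNegDivTail 0 T).sum_add_tsum_nat_add m
  rw [← oneSubExpNegDivTail_zero, oneSubExpNegDivTail, oneSubExpNegDivTail, ← h]
  congr 1
  rw [← (summable_oneSubExpNegDivTail m T).tsum_mul_left]
  refine tsum_congr fun k ↦ ?_
  rw [mul_smul_comm, ← pow_add, add_comm m k]
  simp only [add_zero]

theorem oneSubExpNegDiv_zero : oneSubExpNegDiv (0 : V →L[ℝ] V) = 1 := by
  rw [oneSubExpNegDiv_eq_sum_add 1]
  simp

end OperatorFunction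

/-! ### Evaluation of operator-valued functions -/

section OperatorEval

variable {E : Type*} [NormedAddCommGroup E] [NormedSpace ℝ E] {ι : Type*}
  {B : Type*} [Ring B] [Algebra ℝ B] {e : ι → E} {x : ι → B} {a : E} {L : List ι}
  {V : Type*} [NormedAddCommGroup V] [InnerProductSpace ℝ V] {κ : Type*} [Fintype κ]
  {b : OrthonormalBasis κ ℝ V}

/-- The matrix of the evaluations of the matrix entries of an operator-valued function. -/
def taylorEvalMatrix (e : ι → E) (x : ι → B) (a : E) (L : List ι) (b : OrthonormalBasis κ ℝ V)
    (F : E → V →L[ℝ] V) : Matrix κ κ B :=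
  fun k l ↦ taylorEval e x a L fun A ↦ inner ℝ (b k) (F A (b l))

theorem ContDiffAt.inner_apply_omega {F : E → V →L[ℝ] V} (h : ContDiffAt ℝ ω F a) (u w : V) :
    ContDiffAt ℝ ω (fun A ↦ Inner.inner ℝ u (F A w)) a :=
  contDiffAt_const.inner ℝ (h.clm_apply contDiffAt_const)

theorem taylorEvalMatrix_congr {F G : E → V →L[ℝ] V} (h : F =ᶠ[𝓝 a] G) :
    taylorEvalMatrix e x a L b F = taylorEvalMatrix e x a L b G := by
  ext k l
  exact taylorEval_congr L (h.mono fun A hA ↦ by simp only [hA])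

/-- Inserting the orthonormal basis between `F` and `G` writes each entry of the product as a sum of
products of scalar functions, to which `taylorEval_mul` applies. -/
theorem taylorEvalMatrix_mul (hx : ∀ i j, Commute (x i) (x j)) (hx2 : ∀ i, x i * x i = 0)
    {F G : E → V →L[ℝ] V} (hF : ContDiffAt ℝ ω F a) (hG : ContDiffAt ℝ ω G a) :
    taylorEvalMatrix e x a L b (fun A ↦ F A * G A) =
      taylorEvalMatrix e x a L b F * taylorEvalMatrix e x a L b G := by
  ext k l
  rw [Matrix.mul_apply]
  simp only [taylorEvalMatrix]
  simp only [← taylorEval_mul hx hx2 L (hF.inner_apply_omega _ _) (hG.inner_apply_omega _ _)]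
  rw [← taylorEval_sum L _ fun m _ ↦ (hF.inner_apply_omega _ _).mul (hG.inner_apply_omega _ _)]
  congr 1
  ext A
  rw [mul_apply_eq_comp]
  conv_lhs => rw [← b.sum_repr' (G A (b l))]
  simp only [map_sum, map_smul, inner_sum, inner_smul_right]
  exact Finset.sum_congr rfl fun m _ ↦ mul_comm _ _

theorem taylorEvalMatrix_add {F G : E → V →L[ℝ] V} (hF : ContDiffAt ℝ ω F a)
    (hG : ContDiffAt ℝ ω G a) :
    taylorEvalMatrix e x a L b (fun A ↦ F A + G A) =
      taylorEvalMatrix e x a L b F + taylorEvalMatrix e x a L b G := by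
  ext k l
  rw [Matrix.add_apply]
  simp only [taylorEvalMatrix]
  rw [← taylorEval_add L (hF.inner_apply_omega _ _) (hG.inner_apply_omega _ _)]
  simp only [_root_.add_apply, inner_add_right]

theorem taylorEvalMatrix_smul {F : E → V →L[ℝ] V} (c : ℝ) (hF : ContDiffAt ℝ ω F a) :
    taylorEvalMatrix e x a L b (fun A ↦ c • F A) = c • taylorEvalMatrix e x a L b F := by
  ext k l
  rw [Matrix.smul_apply]
  simp only [taylorEvalMatrix]
  rw [← taylorEval_const_smul L c (hF.inner_apply_omega _ _)]
  simp only [_root_.smul_apply, inner_smul_right]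

theorem taylorEvalMatrix_one [DecidableEq κ] :
    taylorEvalMatrix e x a L b (fun _ ↦ 1) = 1 := by
  ext k l
  simp only [taylorEvalMatrix, taylorEval_const, one_apply_eq_self]
  rw [orthonormal_iff_ite.1 b.orthonormal, Matrix.one_apply]
  split_ifs <;> simp

theorem taylorEvalMatrix_pow [DecidableEq κ] (hx : ∀ i j, Commute (x i) (x j))
    (hx2 : ∀ i, x i * x i = 0) {F : E → V →L[ℝ] V} (hF : ContDiffAt ℝ ω F a) (k : ℕ) :
    taylorEvalMatrix e x a L b (fun A ↦ F A ^ k) = taylorEvalMatrix e x a L b F ^ k := by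
  induction k with
  | zero => simpa using taylorEvalMatrix_one
  | succ k ih => simp only [pow_succ, taylorEvalMatrix_mul hx hx2 (hF.pow k) hF, ih]

theorem taylorEvalMatrix_sum {ν : Type*} (s : Finset ν) {F : ν → E → V →L[ℝ] V}
    (hF : ∀ i ∈ s, ContDiffAt ℝ ω (F i) a) :
    taylorEvalMatrix e x a L b (fun A ↦ ∑ i ∈ s, F i A) =
      ∑ i ∈ s, taylorEvalMatrix e x a L b (F i) := by
  ext k l
  rw [Matrix.sum_apply]
  simp only [taylorEvalMatrix]
  rw [← taylorEval_sum L s fun i hi ↦ (hF i hi).inner_apply_omega _ _]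
  simp only [_root_.sum_apply, inner_sum]

variable [CompleteSpace V]

theorem contDiffAt_oneSubExpNegDiv {F : E → V →L[ℝ] V} (hF : ContDiffAt ℝ ω F a) :
    ContDiffAt ℝ ω (fun A ↦ oneSubExpNegDiv (F A)) a :=
  (contDiff_oneSubExpNegDivTail 0).contDiffAt.comp a hF

/-- At `a` the operator is the identity, and the units of a complete normed ring form an open set.
-/
theorem isUnit_oneSubExpNegDiv {F : E → V →L[ℝ] V} (hF : ContDiffAt ℝ ω F a) (hF0 : F a = 0) :
    ∀ᶠ A in 𝓝 a, IsUnit (oneSubExpNegDiv (F A)) := by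
  have h1 : IsUnit (oneSubExpNegDiv (F a)) := by
    rw [hF0, oneSubExpNegDiv_zero]; exact isUnit_one
  exact (contDiffAt_oneSubExpNegDiv hF).continuousAt.eventually (Units.isOpen.mem_nhds h1)

theorem contDiffAt_inverse_oneSubExpNegDiv {F : E → V →L[ℝ] V} (hF : ContDiffAt ℝ ω F a)
    (hF0 : F a = 0) : ContDiffAt ℝ ω (fun A ↦ Ring.inverse (oneSubExpNegDiv (F A))) a := by
  refine ContDiffAt.comp a (g := Ring.inverse) ?_ (contDiffAt_oneSubExpNegDiv hF)
  rw [hF0, oneSubExpNegDiv_zero]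
  exact contDiffAt_ringInverse ℝ (1 : (V →L[ℝ] V)ˣ)

/-- With `N` the nilpotency order, `oneSubExpNegDiv_eq_sum_add` leaves a polynomial in `F` after
evaluation, and polynomials commute with the evaluation. -/
theorem taylorEvalMatrix_oneSubExpNegDiv [DecidableEq κ] (hx : ∀ i j, Commute (x i) (x j))
    (hx2 : ∀ i, x i * x i = 0) {F : E → V →L[ℝ] V} (hF : ContDiffAt ℝ ω F a) {N : ℕ}
    (hN : taylorEvalMatrix e x a L b F ^ N = 0) :
    taylorEvalMatrix e x a L b (fun A ↦ oneSubExpNegDiv (F A)) =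
      nilEval oneSubExpNegSeries (taylorEvalMatrix e x a L b F) := by
  have hS : ContDiffAt ℝ ω (fun A ↦ oneSubExpNegDivTail N (F A)) a :=
    (contDiff_oneSubExpNegDivTail N).contDiffAt.comp a hF
  have hk : ∀ k ∈ Finset.range N, ContDiffAt ℝ ω
      (fun A ↦ ((-1 : ℝ) ^ k / (k + 1).factorial) • F A ^ k) a :=
    fun k _ ↦ (hF.pow k).const_smul _
  simp only [oneSubExpNegDiv_eq_sum_add N]
  rw [taylorEvalMatrix_add (ContDiffAt.sum hk) ((hF.pow N).mul hS),
    taylorEvalMatrix_mul hx hx2 (hF.pow N) hS, taylorEvalMatrix_pow hx hx2 hF, hN, zero_mul,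
    add_zero, taylorEvalMatrix_sum _ hk, nilEval_eq_sum hN]
  refine Finset.sum_congr rfl fun k _ ↦ ?_
  rw [taylorEvalMatrix_smul _ (hF.pow k), taylorEvalMatrix_pow hx hx2 hF, oneSubExpNegSeries,
    PowerSeries.coeff_mk]

/-- The evaluated inverse is a right inverse of the evaluated operator by multiplicativity, and
`oneSubExpNegSeries_mul` at the nilpotent matrix supplies a left inverse; the two agree. -/
theorem taylorEvalMatrix_inverse_oneSubExpNegDiv [DecidableEq κ]
    (hx : ∀ i j, Commute (x i) (x j)) (hx2 : ∀ i, x i * x i = 0) {F : E → V →L[ℝ] V}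
    (hF : ContDiffAt ℝ ω F a) (hF0 : F a = 0) {N : ℕ}
    (hN : taylorEvalMatrix e x a L b F ^ N = 0) :
    taylorEvalMatrix e x a L b (fun A ↦ Ring.inverse (oneSubExpNegDiv (F A))) =
      nilCoth ((1 / 2 : ℝ) • taylorEvalMatrix e x a L b F) +
        (1 / 2 : ℝ) • taylorEvalMatrix e x a L b F := by
  have h1 : taylorEvalMatrix e x a L b (fun A ↦ oneSubExpNegDiv (F A)) *
      taylorEvalMatrix e x a L b (fun A ↦ Ring.inverse (oneSubExpNegDiv (F A))) = 1 := by
    rw [← taylorEvalMatrix_mul hx hx2 (contDiffAt_oneSubExpNegDiv hF)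
      (contDiffAt_inverse_oneSubExpNegDiv hF hF0), ← taylorEvalMatrix_one (e := e) (x := x)
      (a := a) (L := L) (b := b)]
    refine taylorEvalMatrix_congr ?_
    filter_upwards [isUnit_oneSubExpNegDiv hF hF0] with A hA
    exact Ring.mul_inverse_cancel _ hA
  have h2 := nilEval_mul hN (PowerSeries.rescale (1 / 2 : ℝ) zCothSeries +
    (1 / 2 : ℝ) • PowerSeries.X) oneSubExpNegSeries
  rw [oneSubExpNegSeries_mul, nilEval_one hN, ← taylorEvalMatrix_oneSubExpNegDiv hx hx2 hF hN,
    nilEval_add hN, nilEval_rescale, nilEval_smul_X hN] at h2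
  exact (left_inv_eq_right_inv h2.symm h1).symm

end OperatorEval

/-! ### Nilpotency of matrices of two-forms. -/

section Nilpotent

variable {n : ℕ}

theorem dualVec_mul_mem (i j : Fin n) : dualVec i * dualVec j ∈
    LinearMap.range (ExteriorAlgebra.ι ℝ : Module.Dual ℝ (Euc n) →ₗ[ℝ] _) ^ 2 := by
  rw [pow_two]
  exact Submodule.mul_mem_mul ⟨_, rfl⟩ ⟨_, rfl⟩

/-- The `k`-th power of this range is the `k`-th exterior power, of dimension `n.choose k`. -/
theorem range_ι_pow_eq_bot {k : ℕ} (hk : n < k) :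
    LinearMap.range (ExteriorAlgebra.ι ℝ : Module.Dual ℝ (Euc n) →ₗ[ℝ] _) ^ k = ⊥ := by
  have h := exteriorPower.finrank_eq (M := Module.Dual ℝ (Euc n)) ℝ k
  rw [Subspace.dual_finrank_eq, finrank_euclideanSpace_fin, Nat.choose_eq_zero_of_lt hk] at h
  exact Submodule.finrank_eq_zero.1 h

/-- Entries of `X ^ m` have degree `2 * m`. The exponent `n + 1` is not optimal but is sufficient,
as `2 * (n + 1) > n`. -/
theorem Matrix.pow_eq_zero_of_mem_twoForms {κ : Type*} [Fintype κ] [DecidableEq κ]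
    {X : Matrix κ κ (ExteriorAlgebra ℝ (Module.Dual ℝ (Euc n)))}
    (hX : ∀ k l, X k l ∈
      LinearMap.range (ExteriorAlgebra.ι ℝ : Module.Dual ℝ (Euc n) →ₗ[ℝ] _) ^ 2) :
    X ^ (n + 1) = 0 := by
  have h : ∀ (m : ℕ) k l, (X ^ m) k l ∈
      (LinearMap.range (ExteriorAlgebra.ι ℝ : Module.Dual ℝ (Euc n) →ₗ[ℝ] _) ^ 2) ^ m := by
    intro m
    induction m with
    | zero =>
      intro k l
      rw [pow_zero, pow_zero, Matrix.one_apply]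
      split_ifs
      · exact Submodule.one_le.1 le_rfl
      · exact zero_mem _
    | succ m ih =>
      intro k l
      rw [pow_succ X m, Matrix.mul_apply, pow_succ _ m]
      exact sum_mem fun j _ ↦ Submodule.mul_mem_mul (ih k j) (hX j l)
  ext k l
  have := h (n + 1) k l
  rw [← pow_mul, range_ι_pow_eq_bot (by omega)] at this
  simpa using this

end Nilpotent

/-! ### Sections of the tangent bundle that are constant in a trivialization -/

section ConstSection

variable {n : ℕ} {M : Type*} [TopologicalSpace M] [ChartedSpace (Euc n) M] [IsManifold (𝓡 n) ∞ M]

variable (n) in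
/-- The trivialization of the tangent bundle which belongs to the preferred chart at `x`. -/
abbrev tangentTriv (x : M) :
    Trivialization (Euc n) (TotalSpace.proj : TangentBundle (𝓡 n) M → M) :=
  trivializationAt (Euc n) (fun y : M ↦ TangentSpace (𝓡 n) y) x

/-- The vector field with constant components `e` in the trivialization at `x`. -/
def constSection (x : M) (e : Euc n) (y : M) : TangentSpace (𝓡 n) y := (tangentTriv n x).symm y e

/-- The extensions used in `curvatureTensor` are thus constant in the trivialization, so their
brackets vanish and computations take place in a coordinate frame. -/
theorem extend_eq_constSection {x : M} (u : TangentSpace (𝓡 n) x) :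
    FiberBundle.extend (Euc n) u = constSection x ((tangentTriv n x) ⟨x, u⟩).2 := rfl

variable {x y : M}

theorem mem_baseSet_tangentTriv (x : M) : x ∈ (tangentTriv n x).baseSet :=
  FiberBundle.mem_baseSet_trivializationAt' x

theorem tangentTriv_constSection (hy : y ∈ (tangentTriv n x).baseSet) (e : Euc n) :
    ((tangentTriv n x) ⟨y, constSection x e y⟩).2 = e := by
  rw [constSection, (tangentTriv n x).apply_mk_symm hy]

theorem constSection_tangentTriv (hy : y ∈ (tangentTriv n x).baseSet) (u : TangentSpace (𝓡 n) y) :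
    constSection x ((tangentTriv n x) ⟨y, u⟩).2 y = u :=
  (tangentTriv n x).symm_apply_apply_mk hy u

theorem constSection_eq_symmL (hy : y ∈ (tangentTriv n x).baseSet) (e : Euc n) :
    constSection x e y = (tangentTriv n x).symmL ℝ y e := ((tangentTriv n x).symmL_apply hy e).symm

theorem tangentTriv_eq_continuousLinearMapAt (hy : y ∈ (tangentTriv n x).baseSet)
    (u : TangentSpace (𝓡 n) y) :
    ((tangentTriv n x) ⟨y, u⟩).2 = (tangentTriv n x).continuousLinearMapAt ℝ y u := by
  rw [Trivialization.continuousLinearMapAt_apply, Trivialization.coe_linearMapAt_of_mem _ hy]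

theorem contMDiffAt_constSection (hy : y ∈ (tangentTriv n x).baseSet) (e : Euc n) :
    ContMDiffAt (𝓡 n) ((𝓡 n).prod 𝓘(ℝ, Euc n)) ∞
      (fun z ↦ (⟨z, constSection x e z⟩ : TangentBundle (𝓡 n) M)) y := by
  refine ((tangentTriv n x).contMDiffAt_section_iff hy).2 ?_
  refine (contMDiffAt_const (c := e)).congr_of_eventuallyEq ?_
  filter_upwards [(tangentTriv n x).open_baseSet.mem_nhds hy] with z hz
  exact tangentTriv_constSection hz e

/-- Differentiability of a vector field at a point. -/
abbrev MDiffSectionAt (σ : ∀ z : M, TangentSpace (𝓡 n) z) (y : M) : Prop :=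
  MDifferentiableAt (𝓡 n) ((𝓡 n).prod 𝓘(ℝ, Euc n))
    (fun z ↦ (⟨z, σ z⟩ : TangentBundle (𝓡 n) M)) y

theorem mdifferentiableAt_constSection (hy : y ∈ (tangentTriv n x).baseSet) (e : Euc n) :
    MDiffSectionAt (constSection x e) y :=
  (contMDiffAt_constSection hy e).mdifferentiableAt (by simp)

/-- The constant vector field on Euclidean space. -/
def constField (e : Euc n) (z : Euc n) : TangentSpace 𝓘(ℝ, Euc n) z :=
  (NormedSpace.fromTangentSpace z).symm e

theorem contMDiff_constField (e : Euc n) : ContMDiff 𝓘(ℝ, Euc n) (𝓘(ℝ, Euc n).prod 𝓘(ℝ, Euc n)) ∞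
    (fun z ↦ (⟨z, constField e z⟩ : TangentBundle 𝓘(ℝ, Euc n) (Euc n))) := by
  rw [contMDiff_vectorSpace_iff_contDiff]
  exact contDiff_const

theorem mlieBracket_constField (a b : Euc n) (z : Euc n) :
    VectorField.mlieBracket 𝓘(ℝ, Euc n) (constField a) (constField b) z = 0 := by
  rw [← VectorField.mlieBracketWithin_univ, VectorField.mlieBracketWithin_eq_lieBracketWithin]
  have h : VectorField.lieBracketWithin ℝ (fun _ : Euc n ↦ a) (fun _ : Euc n ↦ b) Set.univ z = 0 := by
    rw [VectorField.lieBracketWithin_univ, VectorField.lieBracket_eq]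
    simp
  exact h

theorem constSection_eq_mpullback (hy : y ∈ (tangentTriv n x).baseSet) (e : Euc n) :
    constSection x e y =
      VectorField.mpullback (𝓡 n) 𝓘(ℝ, Euc n) (extChartAt (𝓡 n) x) (constField e) y := by
  have hy' : y ∈ (chartAt (Euc n) x).source := hy
  have key : ∀ (f : TangentSpace (𝓡 n) y →L[ℝ] Euc n) (g : TangentSpace (𝓡 n) y ≃L[ℝ] Euc n),
      f = g → f.inverse e = g.symm e := by
    rintro _ g rfl
    rw [ContinuousLinearMap.inverse_equiv]; rfl
  have h := key (mfderiv (𝓡 n) 𝓘(ℝ, Euc n) (extChartAt (𝓡 n) x) y)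
    ((tangentTriv n x).continuousLinearEquivAt ℝ y hy)
    ((TangentBundle.continuousLinearMapAt_trivializationAt hy').symm.trans
      ((tangentTriv n x).coe_continuousLinearEquivAt_eq' (R := ℝ) hy).symm)
  exact h.symm

/-- Near `y` both fields are pull-backs under the chart of constant fields on Euclidean space, and
the bracket is natural under pull-back. -/
theorem mlieBracket_constSection (hy : y ∈ (tangentTriv n x).baseSet) (a b : Euc n) :
    VectorField.mlieBracket (𝓡 n) (constSection x a) (constSection x b) y = 0 := by
  have h : ∀ e : Euc n, constSection x e =ᶠ[𝓝 y]
      VectorField.mpullback (𝓡 n) 𝓘(ℝ, Euc n) (extChartAt (𝓡 n) x) (constField e) := by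
    intro e
    filter_upwards [(tangentTriv n x).open_baseSet.mem_nhds hy] with z hz
    exact constSection_eq_mpullback hz e
  have : IsManifold (𝓡 n) (minSmoothness ℝ 2) M := by
    rw [minSmoothness_of_isRCLikeNormedField]; infer_instance
  have hc : ∀ e, MDifferentiableAt 𝓘(ℝ, Euc n) (𝓘(ℝ, Euc n).prod 𝓘(ℝ, Euc n))
      (fun z ↦ (⟨z, constField e z⟩ : TangentBundle 𝓘(ℝ, Euc n) (Euc n)))
        (extChartAt (𝓡 n) x y) :=
    fun e ↦ (contMDiff_constField e).contMDiffAt.mdifferentiableAt (by simp)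
  rw [(h a).mlieBracket_vectorField_eq (h b), ← VectorField.mpullback_mlieBracket (n := 2)
    (hc a) (hc b) ((contMDiffAt_extChartAt' (n := ∞) hy).of_le ?_) ?_, VectorField.mpullback_apply,
    mlieBracket_constField, map_zero]
  · exact WithTop.coe_le_coe.2 le_top
  · rw [minSmoothness_of_isRCLikeNormedField]

end ConstSection

/-! ### Derivatives in charts; locality and smoothness of the connection. -/

section Connection

variable {n : ℕ} {M : Type*} [TopologicalSpace M] [ChartedSpace (Euc n) M] [IsManifold (𝓡 n) ∞ M]
  {x y : M}

/-- The derivative of a function in the preferred chart at `x`. -/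
theorem fderiv_comp_extChartAt_symm {F : Type*} [NormedAddCommGroup F] [NormedSpace ℝ F]
    {g : M → F} (hy : y ∈ (tangentTriv n x).baseSet) (hg : MDifferentiableAt (𝓡 n) 𝓘(ℝ, F) g y)
    (a : Euc n) :
    fderiv ℝ (g ∘ (extChartAt (𝓡 n) x).symm) (extChartAt (𝓡 n) x y) a =
      mvfderiv (𝓡 n) g y (constSection x a y) := by
  have hy' : y ∈ (chartAt (Euc n) x).source := hy
  have hy'' : y ∈ (extChartAt (𝓡 n) x).source := by rwa [extChartAt_source]
  have h1 := TangentBundle.symmL_trivializationAt (I := 𝓡 n) hy'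
  rw [modelWithCornersSelf_coe, Set.range_id, mfderivWithin_univ] at h1
  have hs : MDifferentiableAt 𝓘(ℝ, Euc n) (𝓡 n) (extChartAt (𝓡 n) x).symm
      (extChartAt (𝓡 n) x y) := by
    have := mdifferentiableWithinAt_extChartAt_symm (I := 𝓡 n)
      ((extChartAt (𝓡 n) x).map_source hy'')
    rwa [modelWithCornersSelf_coe, Set.range_id, mdifferentiableWithinAt_univ] at this
  have hl : (extChartAt (𝓡 n) x).symm (extChartAt (𝓡 n) x y) = y :=
    (extChartAt (𝓡 n) x).left_inv hy''
  have hg' : MDifferentiableAt (𝓡 n) 𝓘(ℝ, F) g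
      ((extChartAt (𝓡 n) x).symm (extChartAt (𝓡 n) x y)) := by rwa [hl]
  have h2 : HasMFDerivAt 𝓘(ℝ, Euc n) (𝓡 n) (extChartAt (𝓡 n) x).symm (extChartAt (𝓡 n) x y)
      ((tangentTriv n x).symmL ℝ y) := by
    rw [h1]; exact hs.hasMFDerivAt
  have h3 : HasMFDerivAt (𝓡 n) 𝓘(ℝ, F) g ((extChartAt (𝓡 n) x).symm (extChartAt (𝓡 n) x y))
      (mfderiv (𝓡 n) 𝓘(ℝ, F) g y) := by
    rw [hl]; exact hg.hasMFDerivAt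
  have h4 := (HasMFDerivAt.comp _ h3 h2).mfderiv
  rw [mfderiv_eq_fderiv] at h4
  rw [constSection_eq_symmL hy]
  exact congrArg (fun L : Euc n →L[ℝ] F ↦ L a) h4

theorem contDiffAt_comp_extChartAt_symm {F : Type*} [NormedAddCommGroup F] [NormedSpace ℝ F]
    {g : M → F} (hy : y ∈ (extChartAt (𝓡 n) x).source) (hg : ContMDiffAt (𝓡 n) 𝓘(ℝ, F) ∞ g y) :
    ContDiffAt ℝ ∞ (g ∘ (extChartAt (𝓡 n) x).symm) (extChartAt (𝓡 n) x y) := by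
  rw [← contMDiffAt_iff_contDiffAt]
  have h := (contMDiffOn_extChartAt_symm (I := 𝓡 n) (n := ∞) x).contMDiffAt
    (extChartAt_target_mem_nhds' ((extChartAt (𝓡 n) x).map_source hy))
  refine ContMDiffAt.comp _ ?_ h
  rwa [(extChartAt (𝓡 n) x).left_inv hy]

theorem eventually_extChartAt_symm_mem_source (hy : y ∈ (extChartAt (𝓡 n) x).source) :
    ∀ᶠ z in 𝓝 (extChartAt (𝓡 n) x y), (extChartAt (𝓡 n) x).symm z ∈ (extChartAt (𝓡 n) x).source ∧
      extChartAt (𝓡 n) x ((extChartAt (𝓡 n) x).symm z) = z := by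
  filter_upwards [extChartAt_target_mem_nhds' ((extChartAt (𝓡 n) x).map_source hy)] with z hz
  exact ⟨(extChartAt (𝓡 n) x).map_target hz, (extChartAt (𝓡 n) x).right_inv hz⟩

variable {cov : CovariantDerivative (𝓡 n) (Euc n) (fun x : M ↦ TangentSpace (𝓡 n) x)}

theorem cov_congr {σ τ : ∀ z : M, TangentSpace (𝓡 n) z} (hσ : MDiffSectionAt σ y)
    (h : ∀ᶠ z in 𝓝 y, σ z = τ z) : cov σ y = cov τ y := by
  refine cov.isCovariantDerivativeOnUniv.congr_of_eventuallyEq hσ ?_ univ_mem h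
  refine hσ.congr_of_eventuallyEq ?_
  filter_upwards [h] with z hz
  rw [hz]

/-- The smoothness assumption on `cov` is applied to globally smooth sections. A section smooth only
on `u` is multiplied by a bump function equal to one near `y`, and locality of `cov` shows that
nothing changes there. -/
theorem contMDiffAt_cov [T2Space M]
    (hcov : CovariantDerivative.ContMDiffCovariantDerivative cov ∞)
    {σ : ∀ z : M, TangentSpace (𝓡 n) z} {u : Set M} (hu : IsOpen u) (hy : y ∈ u)
    (hσ : ContMDiffOn (𝓡 n) ((𝓡 n).prod 𝓘(ℝ, Euc n)) ∞
      (fun z ↦ (⟨z, σ z⟩ : TangentBundle (𝓡 n) M)) u) :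
    ContMDiffAt (𝓡 n) ((𝓡 n).prod 𝓘(ℝ, Euc n →L[ℝ] Euc n)) ∞
      (fun z ↦ TotalSpace.mk' (Euc n →L[ℝ] Euc n)
        (E := fun z : M ↦ TangentSpace (𝓡 n) z →L[ℝ] TangentSpace (𝓡 n) z) z (cov σ z)) y := by
  obtain ⟨f, -, hf⟩ := (SmoothBumpFunction.nhds_basis_tsupport (I := 𝓡 n) y).mem_iff.1
    (hu.mem_nhds hy)
  have hfσ : ContMDiff (𝓡 n) ((𝓡 n).prod 𝓘(ℝ, Euc n)) ∞
      (fun z ↦ (⟨z, f z • σ z⟩ : TangentBundle (𝓡 n) M)) :=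
    ContMDiffOn.smul_section_of_tsupport f.contMDiff.contMDiffOn hu hf hσ
  have h1 := (hcov.contMDiff.contMDiff (σ := fun z ↦ f z • σ z)
    (by simpa using hfσ.contMDiffOn)).contMDiffAt (x := y) univ_mem
  refine h1.congr_of_eventuallyEq ?_
  filter_upwards [f.eventuallyEq_one.eventually_nhds, hu.mem_nhds hy] with z hz hzu
  rw [cov_congr (((hσ z hzu).contMDiffAt (hu.mem_nhds hzu)).mdifferentiableAt (by simp))]
  filter_upwards [hz] with w hw
  simp [hw]

theorem contMDiffAt_cov_constSection [T2Space M]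
    (hcov : CovariantDerivative.ContMDiffCovariantDerivative cov ∞)
    (hy : y ∈ (tangentTriv n x).baseSet) (e : Euc n) :
    ContMDiffAt (𝓡 n) ((𝓡 n).prod 𝓘(ℝ, Euc n →L[ℝ] Euc n)) ∞
      (fun z ↦ TotalSpace.mk' (Euc n →L[ℝ] Euc n)
        (E := fun z : M ↦ TangentSpace (𝓡 n) z →L[ℝ] TangentSpace (𝓡 n) z) z
        (cov (constSection x e) z)) y :=
  contMDiffAt_cov hcov (tangentTriv n x).open_baseSet hy
    fun _ hz ↦ (contMDiffAt_constSection hz e).contMDiffWithinAt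

/-- The covariant derivative `∇_{∂_a} ∂_e` of constant sections. -/
def covConst (cov : CovariantDerivative (𝓡 n) (Euc n) (fun x : M ↦ TangentSpace (𝓡 n) x))
    (x : M) (a e : Euc n) (y : M) : TangentSpace (𝓡 n) y :=
  cov (constSection x e) y (constSection x a y)

theorem mdifferentiableAt_covConst [T2Space M]
    (hcov : CovariantDerivative.ContMDiffCovariantDerivative cov ∞)
    (hy : y ∈ (tangentTriv n x).baseSet) (a e : Euc n) : MDiffSectionAt (covConst cov x a e) y :=
  ((contMDiffAt_cov_constSection hcov hy e).clm_bundle_apply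
    (contMDiffAt_constSection hy a)).mdifferentiableAt (by simp)

end Connection

/-! ### The symmetries of the curvature tensor -/

section CurvatureSymmetries

variable {n : ℕ} {M : Type*} [TopologicalSpace M] [T2Space M] [ChartedSpace (Euc n) M]
  [IsManifold (𝓡 n) ∞ M]
  [RiemannianBundle (fun x : M ↦ TangentSpace (𝓡 n) x)]
  [IsContMDiffRiemannianBundle (𝓡 n) ∞ (Euc n) (fun x : M ↦ TangentSpace (𝓡 n) x)]
  {cov : CovariantDerivative (𝓡 n) (Euc n) (fun x : M ↦ TangentSpace (𝓡 n) x)} {x : M}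

theorem curvatureTensor_constSection (cov : CovariantDerivative (𝓡 n) (Euc n)
    (fun x : M ↦ TangentSpace (𝓡 n) x)) (x : M) (a b e : Euc n) :
    curvatureTensor cov x (constSection x a x) (constSection x b x) (constSection x e x) =
      cov (covConst cov x b e) x (constSection x a x) -
        cov (covConst cov x a e) x (constSection x b x) := by
  have h : ∀ e : Euc n, FiberBundle.extend (Euc n) (constSection x e x) = constSection x e := by
    intro e
    rw [extend_eq_constSection, tangentTriv_constSection (mem_baseSet_tangentTriv x)]
  unfold curvatureTensor
  simp only [h, mlieBracket_constSection (mem_baseSet_tangentTriv x), map_zero, sub_zero]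
  rfl

theorem constSection_surjective (u : TangentSpace (𝓡 n) x) : ∃ a : Euc n, constSection x a x = u :=
  ⟨_, constSection_tangentTriv (mem_baseSet_tangentTriv x) u⟩

theorem curvatureTensor_swap (u v w : TangentSpace (𝓡 n) x) :
    curvatureTensor cov x u v w = -curvatureTensor cov x v u w := by
  obtain ⟨a, rfl⟩ := constSection_surjective u
  obtain ⟨b, rfl⟩ := constSection_surjective v
  obtain ⟨e, rfl⟩ := constSection_surjective w
  rw [curvatureTensor_constSection, curvatureTensor_constSection, neg_sub]

/-- Zero torsion for commuting fields: the Christoffel symbols are symmetric. -/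
theorem cov_constSection_comm (hcov : IsLeviCivita cov) {y : M}
    (hy : y ∈ (tangentTriv n x).baseSet) (a b : Euc n) :
    covConst cov x a b y = covConst cov x b a y := by
  have h := cov.torsion_eq_zero_iff.1 hcov.torsion (mdifferentiableAt_constSection hy a)
    (mdifferentiableAt_constSection hy b)
  rw [mlieBracket_constSection hy] at h
  exact sub_eq_zero.1 h

/-- For coordinate fields the cyclic sum consists of six second covariant derivatives, which cancel
in pairs by the symmetry of the Christoffel symbols. -/
theorem curvatureTensor_bianchi (hcov : IsLeviCivita cov) (u v w : TangentSpace (𝓡 n) x) :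
    curvatureTensor cov x u v w + curvatureTensor cov x v w u + curvatureTensor cov x w u v = 0 := by
  obtain ⟨a, rfl⟩ := constSection_surjective u
  obtain ⟨b, rfl⟩ := constSection_surjective v
  obtain ⟨e, rfl⟩ := constSection_surjective w
  have h : ∀ a b : Euc n, cov (covConst cov x a b) x = cov (covConst cov x b a) x := by
    intro a b
    refine cov_congr (mdifferentiableAt_covConst hcov.smooth (mem_baseSet_tangentTriv x) _ _) ?_
    filter_upwards [(tangentTriv n x).open_baseSet.mem_nhds (mem_baseSet_tangentTriv x)] with y hy
    exact cov_constSection_comm hcov hy a b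
  simp only [curvatureTensor_constSection]
  rw [h b e, h a e, h a b]
  abel

/-- The derivative of the inner product of two constant sections along a constant section. -/
theorem mvfderiv_inner (hcov : IsLeviCivita cov) {y : M} {σ τ : ∀ z : M, TangentSpace (𝓡 n) z}
    (hσ : MDiffSectionAt σ y) (hτ : MDiffSectionAt τ y) (u : TangentSpace (𝓡 n) y) :
    mvfderiv (𝓡 n) (fun z ↦ (inner ℝ (σ z) (τ z) : ℝ)) y u =
      inner ℝ (cov σ y u) (τ y) + inner ℝ (σ y) (cov τ y u) := by
  have h := hcov.metric.mvfderiv_inner_eq (FiberBundle.extend (Euc n) u) hσ hτ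
  simpa using h

/-- Second derivatives of the function `g = ⟨∂_e, ∂_e'⟩` commute. Expanding both orders by metric
compatibility, the products of first covariant derivatives cancel, and the rest says that `R(u, v)`
is skew. -/
theorem inner_curvatureTensor_swap (hcov : IsLeviCivita cov) (u v w w' : TangentSpace (𝓡 n) x) :
    (inner ℝ (curvatureTensor cov x u v w) w' : ℝ) =
      -inner ℝ w (curvatureTensor cov x u v w') := by
  obtain ⟨a, rfl⟩ := constSection_surjective u
  obtain ⟨b, rfl⟩ := constSection_surjective v
  obtain ⟨e, rfl⟩ := constSection_surjective w
  obtain ⟨e', rfl⟩ := constSection_surjective w'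
  have hx := mem_baseSet_tangentTriv (n := n) x
  let φ := extChartAt (𝓡 n) x
  let g : M → ℝ := fun y ↦ inner ℝ (constSection x e y) (constSection x e' y)
  -- `h a` is the derivative of `g` along the coordinate field of `a`, as given by metric
  -- compatibility; it is kept in this form so that it can be differentiated once more.
  let h : Euc n → M → ℝ := fun a y ↦ inner ℝ (covConst cov x a e y) (constSection x e' y) +
    inner ℝ (constSection x e y) (covConst cov x a e' y)
  have hg : ∀ y ∈ (tangentTriv n x).baseSet, ContMDiffAt (𝓡 n) 𝓘(ℝ, ℝ) ∞ g y := fun y hy ↦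
    (contMDiffAt_constSection hy e).inner_bundle (contMDiffAt_constSection hy e')
  have hgφ : ContDiffAt ℝ ∞ (g ∘ φ.symm) (φ x) :=
    contDiffAt_comp_extChartAt_symm (mem_extChartAt_source x) (hg x hx)
  have hD : ∀ a, (fun z ↦ fderiv ℝ (g ∘ φ.symm) z a) =ᶠ[𝓝 (φ x)] h a ∘ φ.symm := by
    intro a
    filter_upwards [eventually_extChartAt_symm_mem_source (mem_extChartAt_source (I := 𝓡 n) x)]
      with z hz
    have hy := hz.1
    rw [extChartAt_source] at hy
    have h1 := fderiv_comp_extChartAt_symm hy ((hg _ hy).mdifferentiableAt (by simp)) a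
    rw [hz.2] at h1
    rw [h1]
    exact mvfderiv_inner hcov (mdifferentiableAt_constSection hy e)
      (mdifferentiableAt_constSection hy e') _
  have hc : ∀ a e, MDiffSectionAt (covConst cov x a e) x :=
    mdifferentiableAt_covConst hcov.smooth hx
  have hs : ∀ e, MDiffSectionAt (constSection x e) x := mdifferentiableAt_constSection hx
  have hh : ∀ a, MDifferentiableAt (𝓡 n) 𝓘(ℝ, ℝ) (h a) x := fun a ↦
    ((hc a e).inner_bundle (hs e')).add ((hs e).inner_bundle (hc a e'))
  have hdd : DifferentiableAt ℝ (fderiv ℝ (g ∘ φ.symm)) (φ x) :=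
    (hgφ.fderiv_right (m := 1) (by exact WithTop.coe_le_coe.2 le_top)).differentiableAt (by simp)
  have hD2 : ∀ a b, fderiv ℝ (fderiv ℝ (g ∘ φ.symm)) (φ x) b a =
      mvfderiv (𝓡 n) (h a) x (constSection x b x) := by
    intro a b
    rw [← fderiv_comp_extChartAt_symm hx (hh a), ← (hD a).fderiv_eq,
      fderiv_clm_apply hdd (differentiableAt_const a)]
    simp
  have hsymm : fderiv ℝ (fderiv ℝ (g ∘ φ.symm)) (φ x) b a =
      fderiv ℝ (fderiv ℝ (g ∘ φ.symm)) (φ x) a b :=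
    hgφ.isSymmSndFDerivAt (by
      rw [minSmoothness_of_isRCLikeNormedField]; exact WithTop.coe_le_coe.2 le_top) b a
  have hh2 : ∀ a b, mvfderiv (𝓡 n) (h a) x (constSection x b x) =
      inner ℝ (cov (covConst cov x a e) x (constSection x b x)) (constSection x e' x) +
      inner ℝ (covConst cov x a e x) (covConst cov x b e' x) +
      (inner ℝ (covConst cov x b e x) (covConst cov x a e' x) +
        inner ℝ (constSection x e x) (cov (covConst cov x a e') x (constSection x b x))) := by
    intro a b
    have h1 := mvfderiv_inner hcov (hc a e) (hs e') (constSection x b x)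
    have h2 := mvfderiv_inner hcov (hs e) (hc a e') (constSection x b x)
    have h3 := mvfderiv_fun_add ((hc a e).inner_bundle (hs e')) ((hs e).inner_bundle (hc a e'))
    have h4 := congrArg (fun L ↦ L (constSection x b x)) h3
    simp only [_root_.add_apply] at h4
    rw [h1, h2] at h4
    exact h4
  rw [hD2, hD2, hh2, hh2] at hsymm
  simp only [curvatureTensor_constSection, inner_sub_left, inner_sub_right]
  linarith

theorem inner_curvatureTensor_pair_symm (hcov : IsLeviCivita cov)
    (u v w w' : TangentSpace (𝓡 n) x) :
    (inner ℝ (curvatureTensor cov x u v w) w' : ℝ) = inner ℝ (curvatureTensor cov x w w' u) v := by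
  have h1 : ∀ a b c d : TangentSpace (𝓡 n) x, (inner ℝ (curvatureTensor cov x a b c) d : ℝ) =
      -inner ℝ (curvatureTensor cov x b a c) d := fun a b c d ↦ by
    rw [curvatureTensor_swap, inner_neg_left]
  have h2 : ∀ a b c d : TangentSpace (𝓡 n) x, (inner ℝ (curvatureTensor cov x a b c) d : ℝ) =
      -inner ℝ (curvatureTensor cov x a b d) c := fun a b c d ↦ by
    rw [inner_curvatureTensor_swap hcov, real_inner_comm]
  have h3 : ∀ a b c d : TangentSpace (𝓡 n) x, (inner ℝ (curvatureTensor cov x a b c) d : ℝ) +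
      inner ℝ (curvatureTensor cov x b c a) d + inner ℝ (curvatureTensor cov x c a b) d = 0 :=
    fun a b c d ↦ by
    rw [← inner_add_left, ← inner_add_left, curvatureTensor_bianchi hcov, inner_zero_left]
  -- The four cyclic rotations of the Bianchi identity are combined; skewness in the first and in
  -- the last pair makes all terms cancel except the two asserted ones.
  linarith [h3 u v w w', h3 v w w' u, h3 w w' u v, h3 w' u v w, h1 u v w w', h2 u v w w',
    h1 v w u w', h2 v w u w', h1 w u v w', h2 w u v w', h1 w w' v u, h2 w w' v u, h2 w' v w u,
    h1 w' v w u, h1 w' u w v, h2 w' u w v, h1 u w w' v, h2 u w w' v, h1 u v w' w, h2 u v w' w,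
    h1 w' w u v, h2 w' w u v, h1 v w' u w, h2 v w' u w, h1 v w w' u, h2 v w w' u]

end CurvatureSymmetries

/-! ### The structure equation in a vector space. -/

section StructureEquation

variable {X E B G ι : Type*} [NormedAddCommGroup X] [NormedSpace ℝ X] [NormedAddCommGroup E]
  [NormedSpace ℝ E] [NormedAddCommGroup B] [NormedSpace ℝ B] [NormedAddCommGroup G]
  [NormedSpace ℝ G] [Fintype ι]

/-- The covariant derivative of a section `F` along a map `ϖ`, for the connection with Christoffel
symbols `K i` in terms of the coordinates `c i` of the fibre. -/
def covAlongMap (c : ι → E →L[ℝ] ℝ) (K : ι → B → B →L[ℝ] E) (ϖ : X → B) (F : X → E) (y : X) :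
    X →L[ℝ] E :=
  fderiv ℝ F y + ∑ i, c i (F y) • (K i (ϖ y)).comp (fderiv ℝ ϖ y)

variable {c : ι → E →L[ℝ] ℝ} {K : ι → B → B →L[ℝ] E} {ϖ : X → B} {F : X → E} {p : X}
  {ℓ : X → E →L[ℝ] G}

set_option synthInstance.maxHeartbeats 200000 in
-- Product and chain rule. In `D ξ η` the direction of differentiation is `ξ` and the argument of
-- the one-form is `η`. The terms are grouped so that the part with `fderiv ℝ ℓ` has the factor `∇_η
-- F`.
theorem hasFDerivAt_comp_covAlongMap (hF : ContDiffAt ℝ 2 F p) (hϖ : ContDiffAt ℝ 2 ϖ p)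
    (hK : ∀ i, DifferentiableAt ℝ (K i) (ϖ p)) (hℓ : DifferentiableAt ℝ ℓ p) :
    ∃ D : X →L[ℝ] X →L[ℝ] G, HasFDerivAt (fun y ↦ (ℓ y).comp (covAlongMap c K ϖ F y)) D p ∧
      ∀ ξ η, D ξ η = fderiv ℝ ℓ p ξ (covAlongMap c K ϖ F p η) +
        ℓ p (fderiv ℝ (fderiv ℝ F) p ξ η +
          ∑ i, (c i (F p) • (fderiv ℝ (K i) (ϖ p) (fderiv ℝ ϖ p ξ) (fderiv ℝ ϖ p η) +
            K i (ϖ p) (fderiv ℝ (fderiv ℝ ϖ) p ξ η)) +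
            c i (fderiv ℝ F p ξ) • K i (ϖ p) (fderiv ℝ ϖ p η))) := by
  have hF1 : HasFDerivAt F (fderiv ℝ F p) p := (hF.differentiableAt (by simp)).hasFDerivAt
  have hϖ1 : HasFDerivAt ϖ (fderiv ℝ ϖ p) p := (hϖ.differentiableAt (by simp)).hasFDerivAt
  have hF2 : HasFDerivAt (fderiv ℝ F) (fderiv ℝ (fderiv ℝ F) p) p :=
    ((hF.fderiv_right (m := 1) (by norm_num)).differentiableAt (by simp)).hasFDerivAt
  have hϖ2 : HasFDerivAt (fderiv ℝ ϖ) (fderiv ℝ (fderiv ℝ ϖ) p) p :=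
    ((hϖ.fderiv_right (m := 1) (by norm_num)).differentiableAt (by simp)).hasFDerivAt
  have h := fun i ↦ (((c i).hasFDerivAt.comp p hF1).smul
    (((hK i).hasFDerivAt.comp p hϖ1).clm_comp hϖ2))
  have hs := HasFDerivAt.fun_sum (u := Finset.univ) fun i _ ↦ h i
  refine ⟨_, hℓ.hasFDerivAt.clm_comp (hF2.add hs), fun ξ η ↦ ?_⟩
  simp [covAlongMap, Finset.sum_add_distrib]
  abel

/-- The structure equation: on vectors along which `F` is parallel, the exterior derivative of
`ℓ ∘ ∇F` is the curvature. -/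
theorem fderiv_comp_covAlongMap_sub (hF : ContDiffAt ℝ 2 F p) (hϖ : ContDiffAt ℝ 2 ϖ p)
    (hK : ∀ i, DifferentiableAt ℝ (K i) (ϖ p)) (hℓ : DifferentiableAt ℝ ℓ p) {ξ η : X}
    (hξ : covAlongMap c K ϖ F p ξ = 0) (hη : covAlongMap c K ϖ F p η = 0) :
    fderiv ℝ (fun y ↦ (ℓ y).comp (covAlongMap c K ϖ F y)) p ξ η -
        fderiv ℝ (fun y ↦ (ℓ y).comp (covAlongMap c K ϖ F y)) p η ξ =
      ℓ p (∑ i, (c i (F p) • fderiv ℝ (K i) (ϖ p) (fderiv ℝ ϖ p ξ) (fderiv ℝ ϖ p η) +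
          c i (∑ j, c j (F p) • K j (ϖ p) (fderiv ℝ ϖ p η)) • K i (ϖ p) (fderiv ℝ ϖ p ξ)) -
        ∑ i, (c i (F p) • fderiv ℝ (K i) (ϖ p) (fderiv ℝ ϖ p η) (fderiv ℝ ϖ p ξ) +
          c i (∑ j, c j (F p) • K j (ϖ p) (fderiv ℝ ϖ p ξ)) • K i (ϖ p) (fderiv ℝ ϖ p η))) := by
  obtain ⟨D, hD, hD'⟩ := hasFDerivAt_comp_covAlongMap (c := c) hF hϖ hK hℓ
  have h2 : minSmoothness ℝ 2 ≤ 2 := by rw [minSmoothness_of_isRCLikeNormedField]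
  have hsF := hF.isSymmSndFDerivAt h2 ξ η
  have hsϖ := hϖ.isSymmSndFDerivAt h2 ξ η
  have key : ∀ ξ, covAlongMap c K ϖ F p ξ = 0 →
      fderiv ℝ F p ξ = -∑ j, c j (F p) • K j (ϖ p) (fderiv ℝ ϖ p ξ) := fun ξ h ↦ by
    refine eq_neg_of_add_eq_zero_left ?_
    simpa [covAlongMap] using h
  -- The terms with a derivative of `ℓ` vanish since `F` is parallel, the second derivatives of `F`
  -- and `ϖ` cancel by symmetry, and substituting `dF = -∑ c_j(F) K_j dϖ` makes the remaining
  -- first-order terms quadratic in the Christoffel symbols.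
  rw [hD.fderiv, hD', hD', hξ, hη, map_zero, map_zero, zero_add, zero_add, ← map_sub, hsF, hsϖ,
    key ξ hξ, key η hη]
  congr 1
  simp only [map_neg, smul_add, neg_smul, Finset.sum_add_distrib, Finset.sum_neg_distrib]
  abel

end StructureEquation

/-! ### Components of vector fields and of the connection in a chart. -/

section AlongMap

variable {n : ℕ} {M : Type*} [TopologicalSpace M] [ChartedSpace (Euc n) M] [IsManifold (𝓡 n) ∞ M]
  {x y : M} {cov : CovariantDerivative (𝓡 n) (Euc n) (fun x : M ↦ TangentSpace (𝓡 n) x)}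

/-- The coordinate vector fields of the preferred chart at `x`. -/
def coordField (x : M) (i : Fin n) (y : M) : TangentSpace (𝓡 n) y := constSection x (stdVec i) y

variable (n) in
/-- The components of a tangent vector in the preferred chart at `x`. -/
def tangentComp (x : M) (u : TangentBundle (𝓡 n) M) : Euc n := (tangentTriv n x u).2

theorem constSection_eq_sum (hy : y ∈ (tangentTriv n x).baseSet) (e : Euc n) :
    constSection x e y = ∑ i, e i • coordField x i y := by
  have h : e = ∑ i, e i • stdVec i := by
    ext j
    simp [stdVec, Finset.sum_apply, Pi.single_apply]
  conv_lhs => rw [constSection_eq_symmL hy, h]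
  simp only [map_sum, map_smul, coordField, constSection_eq_symmL hy]

theorem sum_tangentComp (hy : y ∈ (tangentTriv n x).baseSet) (u : TangentSpace (𝓡 n) y) :
    ∑ i, tangentComp n x ⟨y, u⟩ i • coordField x i y = u := by
  rw [← constSection_eq_sum hy, tangentComp, constSection_tangentTriv hy]

theorem tangentComp_sum (hy : y ∈ (tangentTriv n x).baseSet) {ι : Type*} [Fintype ι] (a : ι → ℝ)
    (u : ι → TangentSpace (𝓡 n) y) :
    tangentComp n x ⟨y, ∑ i, a i • u i⟩ = ∑ i, a i • tangentComp n x ⟨y, u i⟩ := by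
  simp only [tangentComp, tangentTriv_eq_continuousLinearMapAt hy, map_sum, map_smul]

theorem mdifferentiableAt_coordField (hy : y ∈ (tangentTriv n x).baseSet) (i : Fin n) :
    MDiffSectionAt (coordField x i) y := mdifferentiableAt_constSection hy _

theorem cov_sum_smul (cov : CovariantDerivative (𝓡 n) (Euc n) (fun x : M ↦ TangentSpace (𝓡 n) x))
    {ι : Type*} (s : Finset ι) {f : ι → M → ℝ}
    {σ : ι → ∀ z : M, TangentSpace (𝓡 n) z} (hf : ∀ i, MDifferentiableAt (𝓡 n) 𝓘(ℝ, ℝ) (f i) y)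
    (hσ : ∀ i, MDiffSectionAt (σ i) y) :
    cov (fun z ↦ ∑ i ∈ s, f i z • σ i z) y =
      ∑ i ∈ s, (f i y • cov (σ i) y + (mvfderiv (𝓡 n) (f i) y).smulRight (σ i y)) := by
  classical
  induction s using Finset.induction_on with
  | empty =>
    simp only [Finset.sum_empty]
    exact congrFun cov.zero y
  | insert i s hi ih =>
    rw [Finset.sum_insert hi, ← ih, ← cov.isCovariantDerivativeOnUniv.leibniz (hσ i) (hf i),
      ← cov.isCovariantDerivativeOnUniv.add ((hf i).smul_section (hσ i))]
    · congr 1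
      funext z
      exact Finset.sum_insert hi
    · exact MDifferentiableAt.sum_section fun i _ ↦ (hf i).smul_section (hσ i)

theorem mdifferentiableAt_tangentComp {σ : ∀ z : M, TangentSpace (𝓡 n) z}
    (hy : y ∈ (tangentTriv n x).baseSet) (hσ : MDiffSectionAt σ y) :
    MDifferentiableAt (𝓡 n) 𝓘(ℝ, Euc n) (fun z ↦ tangentComp n x ⟨z, σ z⟩) y :=
  ((tangentTriv n x).mdifferentiableAt_section_iff (𝓡 n) σ hy).1 hσ

theorem MDifferentiableAt.euclidean_apply {m : ℕ} {N : Type*} [TopologicalSpace N]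
    [ChartedSpace (Euc m) N] {g : N → Euc n} {q : N} (hg : MDifferentiableAt (𝓡 m) 𝓘(ℝ, Euc n) g q)
    (i : Fin n) : MDifferentiableAt (𝓡 m) 𝓘(ℝ, ℝ) (fun z ↦ g z i) q :=
  (EuclideanSpace.proj (𝕜 := ℝ) i : Euc n →L[ℝ] ℝ).mdifferentiableAt.comp q hg

theorem mvfderiv_euclidean_apply {m : ℕ} {N : Type*} [TopologicalSpace N]
    [ChartedSpace (Euc m) N] {g : N → Euc n} {q : N} (hg : MDifferentiableAt (𝓡 m) 𝓘(ℝ, Euc n) g q)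
    (i : Fin n) (ξ : TangentSpace (𝓡 m) q) :
    mvfderiv (𝓡 m) (fun z ↦ g z i) q ξ = mvfderiv (𝓡 m) g q ξ i := by
  have h := (HasMFDerivAt.comp q
    (EuclideanSpace.proj (𝕜 := ℝ) i : Euc n →L[ℝ] ℝ).hasMFDerivAt hg.hasMFDerivAt).mfderiv
  exact congrArg (fun L : TangentSpace (𝓡 m) q →L[ℝ] ℝ ↦ L ξ) h

/-- The covariant derivative in terms of the components. -/
theorem cov_eq_sum (cov : CovariantDerivative (𝓡 n) (Euc n) (fun x : M ↦ TangentSpace (𝓡 n) x))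
    {σ : ∀ z : M, TangentSpace (𝓡 n) z} (hy : y ∈ (tangentTriv n x).baseSet)
    (hσ : MDiffSectionAt σ y) :
    cov σ y = ∑ i, (tangentComp n x ⟨y, σ y⟩ i • cov (coordField x i) y +
      (mvfderiv (𝓡 n) (fun z ↦ tangentComp n x ⟨z, σ z⟩ i) y).smulRight (coordField x i y)) := by
  rw [← cov_sum_smul cov Finset.univ
    (fun i ↦ (mdifferentiableAt_tangentComp hy hσ).euclidean_apply i)
    (fun i ↦ mdifferentiableAt_coordField hy i)]
  refine cov_congr hσ ?_
  filter_upwards [(tangentTriv n x).open_baseSet.mem_nhds hy] with z hz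
  exact (sum_tangentComp hz _).symm

theorem cov_constSection_eq_sum
    (cov : CovariantDerivative (𝓡 n) (Euc n) (fun x : M ↦ TangentSpace (𝓡 n) x))
    (hy : y ∈ (tangentTriv n x).baseSet) (e : Euc n) :
    cov (constSection x e) y = ∑ i, e i • cov (coordField x i) y := by
  have h := cov_sum_smul cov Finset.univ (fun i ↦ mdifferentiableAt_const (c := e i))
    (fun i ↦ mdifferentiableAt_coordField hy i)
  rw [cov_congr (mdifferentiableAt_constSection hy e)
    (τ := fun z ↦ ∑ i, e i • coordField x i z), h]
  · refine Finset.sum_congr rfl fun i _ ↦ ?_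
    rw [mvfderiv_const]
    simp
  · filter_upwards [(tangentTriv n x).open_baseSet.mem_nhds hy] with z hz
    exact constSection_eq_sum hz e

end AlongMap

/-! ### Covariant derivatives along a map: independence of the chart. -/

section AlongMap

variable {n m : ℕ} {M : Type*} [TopologicalSpace M] [ChartedSpace (Euc n) M]
  [IsManifold (𝓡 n) ∞ M] {N : Type*} [TopologicalSpace N] [ChartedSpace (Euc m) N]
  {x : M} {cov : CovariantDerivative (𝓡 n) (Euc n) (fun x : M ↦ TangentSpace (𝓡 n) x)}
  {ϖ : N → M} {V : ∀ q : N, TangentSpace (𝓡 n) (ϖ q)} {q : N}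

variable (m) in
/-- Differentiability at a point of a vector field along a map. -/
abbrev MDiffAlongAt (ϖ : N → M) (V : ∀ q : N, TangentSpace (𝓡 n) (ϖ q)) (q : N) : Prop :=
  MDifferentiableAt (𝓡 m) ((𝓡 n).prod 𝓘(ℝ, Euc n))
    (fun z ↦ (⟨ϖ z, V z⟩ : TangentBundle (𝓡 n) M)) q

theorem MDiffAlongAt.proj (hV : MDiffAlongAt m ϖ V q) : MDifferentiableAt (𝓡 m) (𝓡 n) ϖ q :=
  ((mdifferentiableAt_totalSpace _ _).1 hV).1

theorem MDiffAlongAt.comp (hV : MDiffAlongAt m ϖ V q) (hq : ϖ q ∈ (tangentTriv n x).baseSet) :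
    MDifferentiableAt (𝓡 m) 𝓘(ℝ, Euc n) (fun z ↦ tangentComp n x ⟨ϖ z, V z⟩) q :=
  (((tangentTriv n x).mdifferentiableAt_totalSpace_iff (𝓡 n) _
    ((tangentTriv n x).mem_source.2 hq)).1 hV).2

omit [IsManifold (𝓡 n) ∞ M] in
theorem mvfderiv_comp_map {g : M → ℝ} (hg : MDifferentiableAt (𝓡 n) 𝓘(ℝ, ℝ) g (ϖ q))
    (hϖ : MDifferentiableAt (𝓡 m) (𝓡 n) ϖ q) (ξ : TangentSpace (𝓡 m) q) :
    mvfderiv (𝓡 m) (fun z ↦ g (ϖ z)) q ξ = mvfderiv (𝓡 n) g (ϖ q) (mfderiv (𝓡 m) (𝓡 n) ϖ q ξ) :=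
  mvfderiv_comp_apply_of_eq (g := g) q hg hϖ rfl ξ

/-- The covariant derivative of a vector field along a map, in the preferred chart at `x`. -/
def covAlongIn (cov : CovariantDerivative (𝓡 n) (Euc n) (fun x : M ↦ TangentSpace (𝓡 n) x))
    (x : M) (ϖ : N → M) (V : ∀ q : N, TangentSpace (𝓡 n) (ϖ q)) (q : N)
    (ξ : TangentSpace (𝓡 m) q) : TangentSpace (𝓡 n) (ϖ q) :=
  ∑ i, (tangentComp n x ⟨ϖ q, V q⟩ i • cov (coordField x i) (ϖ q) (mfderiv (𝓡 m) (𝓡 n) ϖ q ξ) +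
    mvfderiv (𝓡 m) (fun z ↦ tangentComp n x ⟨ϖ z, V z⟩ i) q ξ • coordField x i (ϖ q))

theorem mvfderiv_sum_mul {ι : Type} (s : Finset ι) {f g : ι → N → ℝ}
    (hf : ∀ i, MDifferentiableAt (𝓡 m) 𝓘(ℝ, ℝ) (f i) q)
    (hg : ∀ i, MDifferentiableAt (𝓡 m) 𝓘(ℝ, ℝ) (g i) q) (ξ : TangentSpace (𝓡 m) q) :
    mvfderiv (𝓡 m) (fun z ↦ ∑ i ∈ s, f i z * g i z) q ξ =
      ∑ i ∈ s, (f i q * mvfderiv (𝓡 m) (g i) q ξ + mvfderiv (𝓡 m) (f i) q ξ * g i q) := by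
  classical
  have hfg : ∀ i, MDifferentiableAt (𝓡 m) 𝓘(ℝ, ℝ) (fun z ↦ f i z * g i z) q :=
    fun i ↦ (hf i).mul (hg i)
  induction s using Finset.induction_on with
  | empty =>
    simp only [Finset.sum_empty, mvfderiv_const]
    rfl
  | insert i s hi ih =>
    have hs : MDifferentiableAt (𝓡 m) 𝓘(ℝ, ℝ) (fun z ↦ ∑ i ∈ s, f i z * g i z) q := by
      have h0 : ∀ i ∈ s, MDifferentiableAt (𝓡 m) 𝓘(ℝ, ℝ) ((fun i z ↦ f i z * g i z) i) q :=
        fun i _ ↦ hfg i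
      convert MDifferentiableAt.sum h0 using 1
      ext z
      simp
    have h1 := mvfderiv_fun_add (hfg i) hs
    have h2 := mvfderiv_mul (hf i) (hg i)
    simp only [Finset.sum_insert hi]
    rw [← ih]
    have h3 := congrArg (fun L : TangentSpace (𝓡 m) q →L[ℝ] ℝ ↦ L ξ) h1
    have h4 := congrArg (fun L : TangentSpace (𝓡 m) q →L[ℝ] ℝ ↦ L ξ) h2
    simp only [_root_.add_apply] at h3 h4
    refine h3.trans ?_
    congr 1
    refine h4.trans ?_
    simp [mul_comm]

/-- The covariant derivative along a map does not depend on the chart. -/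
theorem covAlongIn_eq {y : M} (hV : MDiffAlongAt m ϖ V q) (hx : ϖ q ∈ (tangentTriv n x).baseSet)
    (hy : ϖ q ∈ (tangentTriv n y).baseSet) (ξ : TangentSpace (𝓡 m) q) :
    covAlongIn cov x ϖ V q ξ = covAlongIn cov y ϖ V q ξ := by
  have hϖ := hV.proj
  -- `C` is the transition matrix between the two coordinate frames. Its derivative enters on one
  -- side through `∇` of the fields of the chart at `x`, on the other through the Leibniz rule for
  -- the components at `y`; these contributions agree.
  let C : Fin n → Fin n → M → ℝ := fun i j z ↦ tangentComp n y ⟨z, coordField x i z⟩ j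
  have hC : ∀ i j, MDifferentiableAt (𝓡 n) 𝓘(ℝ, ℝ) (C i j) (ϖ q) := fun i j ↦
    (mdifferentiableAt_tangentComp hy (mdifferentiableAt_coordField hx i)).euclidean_apply j
  have hF : ∀ i, MDifferentiableAt (𝓡 m) 𝓘(ℝ, ℝ) (fun z ↦ tangentComp n x ⟨ϖ z, V z⟩ i) q :=
    fun i ↦ (hV.comp hx).euclidean_apply i
  have hG : ∀ j, mvfderiv (𝓡 m) (fun z ↦ tangentComp n y ⟨ϖ z, V z⟩ j) q ξ =
      ∑ i, (tangentComp n x ⟨ϖ q, V q⟩ i *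
        mvfderiv (𝓡 n) (C i j) (ϖ q) (mfderiv (𝓡 m) (𝓡 n) ϖ q ξ) +
        mvfderiv (𝓡 m) (fun z ↦ tangentComp n x ⟨ϖ z, V z⟩ i) q ξ * C i j (ϖ q)) := by
    intro j
    have h1 : (fun z ↦ tangentComp n y ⟨ϖ z, V z⟩ j) =ᶠ[𝓝 q]
        fun z ↦ ∑ i, tangentComp n x ⟨ϖ z, V z⟩ i * C i j (ϖ z) := by
      filter_upwards [hϖ.continuousAt ((tangentTriv n x).open_baseSet.mem_nhds hx),
        hϖ.continuousAt ((tangentTriv n y).open_baseSet.mem_nhds hy)] with z hzx hzy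
      conv_lhs => rw [← sum_tangentComp hzx (V z)]
      rw [tangentComp_sum hzy]
      simp [C]
    have h2 : mvfderiv (𝓡 m) (fun z ↦ tangentComp n y ⟨ϖ z, V z⟩ j) q =
        mvfderiv (𝓡 m) (fun z ↦ ∑ i, tangentComp n x ⟨ϖ z, V z⟩ i * C i j (ϖ z)) q :=
      h1.mfderiv_eq
    rw [h2, mvfderiv_sum_mul Finset.univ hF (g := fun i z ↦ C i j (ϖ z))
      fun i ↦ (hC i j).comp q hϖ]
    refine Finset.sum_congr rfl fun i _ ↦ ?_
    congr 2
    exact mvfderiv_comp_map (hC i j) hϖ ξ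
  have hGq : ∀ j, tangentComp n y ⟨ϖ q, V q⟩ j =
      ∑ i, tangentComp n x ⟨ϖ q, V q⟩ i * C i j (ϖ q) := by
    intro j
    conv_lhs => rw [← sum_tangentComp hx (V q)]
    rw [tangentComp_sum hy]
    simp [C]
  have hcov : ∀ i, cov (coordField x i) (ϖ q) (mfderiv (𝓡 m) (𝓡 n) ϖ q ξ) =
      ∑ j, (C i j (ϖ q) • cov (coordField y j) (ϖ q) (mfderiv (𝓡 m) (𝓡 n) ϖ q ξ) +
        mvfderiv (𝓡 n) (C i j) (ϖ q) (mfderiv (𝓡 m) (𝓡 n) ϖ q ξ) • coordField y j (ϖ q)) := by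
    intro i
    rw [cov_eq_sum cov hy (mdifferentiableAt_coordField hx i)]
    simp [C]
  have hs : ∀ i, coordField x i (ϖ q) = ∑ j, C i j (ϖ q) • coordField y j (ϖ q) := fun i ↦
    (sum_tangentComp hy _).symm
  unfold covAlongIn
  simp only [hG, hGq, hcov]
  conv_lhs => enter [2, i]; rw [hs i]
  simp only [Finset.smul_sum, Finset.sum_smul, add_smul, smul_add, smul_smul,
    Finset.sum_add_distrib]
  rw [add_assoc]
  congr 1
  · rw [Finset.sum_comm]
  · congr 1 <;> rw [Finset.sum_comm]

end AlongMap

/-! ### Metric compatibility along a map; Christoffel symbols. -/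

section AlongMap

variable {n m : ℕ} {M : Type*} [TopologicalSpace M] [ChartedSpace (Euc n) M]
  [IsManifold (𝓡 n) ∞ M] {N : Type*} [TopologicalSpace N] [ChartedSpace (Euc m) N]
  {x : M} {cov : CovariantDerivative (𝓡 n) (Euc n) (fun x : M ↦ TangentSpace (𝓡 n) x)}
  {ϖ : N → M} {V W : ∀ q : N, TangentSpace (𝓡 n) (ϖ q)} {q : N}

/-- Metric compatibility along a map. -/
theorem mvfderiv_inner_along [T2Space M] [RiemannianBundle (fun x : M ↦ TangentSpace (𝓡 n) x)]
    [IsContMDiffRiemannianBundle (𝓡 n) ∞ (Euc n) (fun x : M ↦ TangentSpace (𝓡 n) x)]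
    (hcov : IsLeviCivita cov) (hV : MDiffAlongAt m ϖ V q) (hW : MDiffAlongAt m ϖ W q)
    (hx : ϖ q ∈ (tangentTriv n x).baseSet) (ξ : TangentSpace (𝓡 m) q) :
    mvfderiv (𝓡 m) (fun z ↦ (inner ℝ (V z) (W z) : ℝ)) q ξ =
      inner ℝ (covAlongIn cov x ϖ V q ξ) (W q) + inner ℝ (V q) (covAlongIn cov x ϖ W q ξ) := by
  have hϖ := hV.proj
  -- The Gram matrix of the coordinate fields. Expanding `V` and `W` in these fields reduces the
  -- claim to metric compatibility on `M` and the chain rule.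
  let g : Fin n → Fin n → M → ℝ := fun k l z ↦ inner ℝ (coordField x k z) (coordField x l z)
  have hs : ∀ k, MDiffSectionAt (coordField x k) (ϖ q) := mdifferentiableAt_coordField hx
  have hg : ∀ k l, MDifferentiableAt (𝓡 n) 𝓘(ℝ, ℝ) (g k l) (ϖ q) := fun k l ↦
    (hs k).inner_bundle (hs l)
  have hgϖ : ∀ k l, MDifferentiableAt (𝓡 m) 𝓘(ℝ, ℝ) (fun z ↦ g k l (ϖ z)) q := fun k l ↦
    (hg k l).comp q hϖ
  have hF : ∀ i, MDifferentiableAt (𝓡 m) 𝓘(ℝ, ℝ) (fun z ↦ tangentComp n x ⟨ϖ z, V z⟩ i) q :=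
    fun i ↦ (hV.comp hx).euclidean_apply i
  have hG : ∀ i, MDifferentiableAt (𝓡 m) 𝓘(ℝ, ℝ) (fun z ↦ tangentComp n x ⟨ϖ z, W z⟩ i) q :=
    fun i ↦ (hW.comp hx).euclidean_apply i
  have hGg : ∀ k, MDifferentiableAt (𝓡 m) 𝓘(ℝ, ℝ)
      (fun z ↦ ∑ l, tangentComp n x ⟨ϖ z, W z⟩ l * g k l (ϖ z)) q := by
    intro k
    have h0 : ∀ l ∈ (Finset.univ : Finset (Fin n)), MDifferentiableAt (𝓡 m) 𝓘(ℝ, ℝ)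
        ((fun l z ↦ tangentComp n x ⟨ϖ z, W z⟩ l * g k l (ϖ z)) l) q :=
      fun l _ ↦ (hG l).mul (hgϖ k l)
    convert MDifferentiableAt.sum h0 using 1
    ext z
    simp
  have h1 : (fun z ↦ (inner ℝ (V z) (W z) : ℝ)) =ᶠ[𝓝 q]
      fun z ↦ ∑ k, tangentComp n x ⟨ϖ z, V z⟩ k *
        ∑ l, tangentComp n x ⟨ϖ z, W z⟩ l * g k l (ϖ z) := by
    filter_upwards [hϖ.continuousAt ((tangentTriv n x).open_baseSet.mem_nhds hx)] with z hz
    conv_lhs => rw [← sum_tangentComp hz (V z), ← sum_tangentComp hz (W z)]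
    simp only [sum_inner, inner_sum, real_inner_smul_left, real_inner_smul_right, g,
      Finset.mul_sum]
    rw [Finset.sum_comm]
    refine Finset.sum_congr rfl fun k _ ↦ Finset.sum_congr rfl fun l _ ↦ ?_
    ring
  have h2 : mvfderiv (𝓡 m) (fun z ↦ (inner ℝ (V z) (W z) : ℝ)) q =
      mvfderiv (𝓡 m) (fun z ↦ ∑ k, tangentComp n x ⟨ϖ z, V z⟩ k *
        ∑ l, tangentComp n x ⟨ϖ z, W z⟩ l * g k l (ϖ z)) q := h1.mfderiv_eq
  have hdg : ∀ k l, mvfderiv (𝓡 m) (fun z ↦ g k l (ϖ z)) q ξ =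
      inner ℝ (cov (coordField x k) (ϖ q) (mfderiv (𝓡 m) (𝓡 n) ϖ q ξ)) (coordField x l (ϖ q)) +
      inner ℝ (coordField x k (ϖ q)) (cov (coordField x l) (ϖ q) (mfderiv (𝓡 m) (𝓡 n) ϖ q ξ)) :=
    fun k l ↦ (mvfderiv_comp_map (hg k l) hϖ ξ).trans (mvfderiv_inner hcov (hs k) (hs l) _)
  rw [h2, mvfderiv_sum_mul Finset.univ hF
    (g := fun k z ↦ ∑ l, tangentComp n x ⟨ϖ z, W z⟩ l * g k l (ϖ z)) hGg]
  simp only [fun k ↦ mvfderiv_sum_mul Finset.univ hG (g := fun l z ↦ g k l (ϖ z)) (hgϖ k) ξ, hdg]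
  have hsum : ∀ a b : Fin n → TangentSpace (𝓡 n) (ϖ q),
      (inner ℝ (∑ k, a k) (∑ l, b l) : ℝ) = ∑ k, ∑ l, inner ℝ (a k) (b l) := fun a b ↦ by
    rw [sum_inner]
    exact Finset.sum_congr rfl fun _ _ ↦ inner_sum _ _ _
  have e1 := hsum (fun i ↦ tangentComp n x ⟨ϖ q, V q⟩ i •
      cov (coordField x i) (ϖ q) (mfderiv (𝓡 m) (𝓡 n) ϖ q ξ) +
    mvfderiv (𝓡 m) (fun z ↦ tangentComp n x ⟨ϖ z, V z⟩ i) q ξ • coordField x i (ϖ q))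
    (fun i ↦ tangentComp n x ⟨ϖ q, W q⟩ i • coordField x i (ϖ q))
  have e2 := hsum (fun i ↦ tangentComp n x ⟨ϖ q, V q⟩ i • coordField x i (ϖ q))
    (fun i ↦ tangentComp n x ⟨ϖ q, W q⟩ i •
      cov (coordField x i) (ϖ q) (mfderiv (𝓡 m) (𝓡 n) ϖ q ξ) +
    mvfderiv (𝓡 m) (fun z ↦ tangentComp n x ⟨ϖ z, W z⟩ i) q ξ • coordField x i (ϖ q))
  rw [sum_tangentComp hx (W q)] at e1
  rw [sum_tangentComp hx (V q)] at e2
  rw [covAlongIn, covAlongIn, e1, e2, ← Finset.sum_add_distrib]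
  refine Finset.sum_congr rfl fun k _ ↦ ?_
  rw [← Finset.sum_add_distrib, Finset.mul_sum, Finset.mul_sum, ← Finset.sum_add_distrib]
  refine Finset.sum_congr rfl fun l _ ↦ ?_
  simp only [inner_add_left, inner_add_right, real_inner_smul_left, real_inner_smul_right, g]
  ring

/-- The Christoffel symbols in the preferred chart at `x`. -/
def christoffel (cov : CovariantDerivative (𝓡 n) (Euc n) (fun x : M ↦ TangentSpace (𝓡 n) x))
    (x : M) (k : Fin n) (y : M) : Euc n →L[ℝ] Euc n :=
  ((tangentTriv n x).continuousLinearMapAt ℝ y).comp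
    ((cov (coordField x k) y).comp ((tangentTriv n x).symmL ℝ y))

theorem contMDiffAt_christoffel [T2Space M]
    (hcov : CovariantDerivative.ContMDiffCovariantDerivative cov ∞) (k : Fin n) :
    ContMDiffAt (𝓡 n) 𝓘(ℝ, Euc n →L[ℝ] Euc n) ∞ (christoffel cov x k) x :=
  ((contMDiffAt_hom_bundle _).1
    (contMDiffAt_cov_constSection hcov (mem_baseSet_tangentTriv x) (stdVec k))).2

theorem constSection_christoffel {y : M} (hy : y ∈ (tangentTriv n x).baseSet) (k : Fin n)
    (u : TangentSpace (𝓡 n) y) :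
    constSection x (christoffel cov x k y (tangentComp n x ⟨y, u⟩)) y =
      cov (coordField x k) y u := by
  have h1 : (tangentTriv n x).symmL ℝ y (tangentComp n x ⟨y, u⟩) = u := by
    rw [← constSection_eq_symmL hy, tangentComp, constSection_tangentTriv hy]
  rw [christoffel, ContinuousLinearMap.comp_apply, ContinuousLinearMap.comp_apply, h1,
    ← tangentTriv_eq_continuousLinearMapAt hy, constSection_tangentTriv hy]

variable [IsManifold (𝓡 m) ∞ N] {p : N}

theorem mfderiv_extChartAt_symm_eq_constSection (hq : q ∈ (tangentTriv m p).baseSet) (a : Euc m) :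
    (mfderiv 𝓘(ℝ, Euc m) (𝓡 m) (extChartAt (𝓡 m) p).symm (extChartAt (𝓡 m) p q) :
      Euc m → Euc m) a = (constSection p a q : TangentSpace (𝓡 m) q) := by
  have hq' : q ∈ (chartAt (Euc m) p).source := hq
  have h1 := TangentBundle.symmL_trivializationAt (I := 𝓡 m) hq'
  rw [modelWithCornersSelf_coe, Set.range_id, mfderivWithin_univ] at h1
  rw [constSection_eq_symmL hq]
  exact congrArg (fun L : Euc m →L[ℝ] TangentSpace (𝓡 m) q ↦ L a) h1.symm

theorem fderiv_extChartAt_comp (hq : q ∈ (tangentTriv m p).baseSet)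
    (hx : ϖ q ∈ (tangentTriv n x).baseSet) (hϖ : MDifferentiableAt (𝓡 m) (𝓡 n) ϖ q) (a : Euc m) :
    fderiv ℝ ((fun z ↦ extChartAt (𝓡 n) x (ϖ z)) ∘ (extChartAt (𝓡 m) p).symm)
      (extChartAt (𝓡 m) p q) a =
      tangentComp n x ⟨ϖ q, mfderiv (𝓡 m) (𝓡 n) ϖ q (constSection p a q)⟩ := by
  have hx' : ϖ q ∈ (chartAt (Euc n) x).source := hx
  have h1 : HasMFDerivAt (𝓡 n) 𝓘(ℝ, Euc n) (extChartAt (𝓡 n) x) (ϖ q)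
      ((tangentTriv n x).continuousLinearMapAt ℝ (ϖ q)) := by
    rw [TangentBundle.continuousLinearMapAt_trivializationAt hx']
    exact (mdifferentiableAt_extChartAt hx').hasMFDerivAt
  have h2 : HasMFDerivAt (𝓡 m) 𝓘(ℝ, Euc n) (fun z ↦ extChartAt (𝓡 n) x (ϖ z)) q
      (((tangentTriv n x).continuousLinearMapAt ℝ (ϖ q)).comp (mfderiv (𝓡 m) (𝓡 n) ϖ q)) :=
    HasMFDerivAt.comp q h1 hϖ.hasMFDerivAt
  rw [fderiv_comp_extChartAt_symm hq h2.mdifferentiableAt, tangentComp,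
    tangentTriv_eq_continuousLinearMapAt hx]
  exact congrArg (fun L : TangentSpace (𝓡 m) q →L[ℝ] Euc n ↦ L (constSection p a q)) h2.mfderiv

/-- The covariant derivative along a map, in charts of both manifolds. -/
theorem covAlongIn_constSection (hV : MDiffAlongAt m ϖ V q) (hq : q ∈ (tangentTriv m p).baseSet)
    (hx : ϖ q ∈ (tangentTriv n x).baseSet) (a : Euc m) :
    covAlongIn cov x ϖ V q (constSection p a q) =
      constSection x (covAlongMap (fun k ↦ (EuclideanSpace.proj k : Euc n →L[ℝ] ℝ))
        (fun k ↦ christoffel cov x k ∘ (extChartAt (𝓡 n) x).symm)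
        ((fun z ↦ extChartAt (𝓡 n) x (ϖ z)) ∘ (extChartAt (𝓡 m) p).symm)
        ((fun z ↦ tangentComp n x ⟨ϖ z, V z⟩) ∘ (extChartAt (𝓡 m) p).symm)
        (extChartAt (𝓡 m) p q) a) (ϖ q) := by
  have hq' : q ∈ (extChartAt (𝓡 m) p).source := by rw [extChartAt_source]; exact hq
  have hx' : ϖ q ∈ (extChartAt (𝓡 n) x).source := by rw [extChartAt_source]; exact hx
  have hV' : ((fun z ↦ tangentComp n x ⟨ϖ z, V z⟩) ∘ (extChartAt (𝓡 m) p).symm)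
      (extChartAt (𝓡 m) p q) = tangentComp n x ⟨ϖ q, V q⟩ :=
    congrArg (fun z ↦ tangentComp n x ⟨ϖ z, V z⟩) ((extChartAt (𝓡 m) p).left_inv hq')
  simp only [covAlongMap, _root_.add_apply, _root_.sum_apply, _root_.smul_apply,
    ContinuousLinearMap.comp_apply, hV']
  simp only [Function.comp_apply, (extChartAt (𝓡 m) p).left_inv hq',
    (extChartAt (𝓡 n) x).left_inv hx']
  rw [fderiv_extChartAt_comp hq hx hV.proj, fderiv_comp_extChartAt_symm hq (hV.comp hx)]
  rw [constSection_eq_symmL hx, map_add, map_sum]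
  simp only [map_smul]
  simp only [← constSection_eq_symmL hx, constSection_christoffel hx]
  rw [constSection_eq_sum hx, covAlongIn, Finset.sum_add_distrib, add_comm]
  simp only [fun i ↦ mvfderiv_euclidean_apply (hV.comp hx) i (constSection p a q)]
  rfl

end AlongMap

/-! ### The structure equation for vector fields along a map. -/

section Structure

variable {n m : ℕ} {M : Type*} [TopologicalSpace M] [T2Space M] [ChartedSpace (Euc n) M]
  [IsManifold (𝓡 n) ∞ M] {N : Type*} [TopologicalSpace N] [ChartedSpace (Euc m) N]
  {x : M} {cov : CovariantDerivative (𝓡 n) (Euc n) (fun x : M ↦ TangentSpace (𝓡 n) x)}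

theorem differentiableAt_christoffel
    (hcov : CovariantDerivative.ContMDiffCovariantDerivative cov ∞) (k : Fin n) :
    DifferentiableAt ℝ (christoffel cov x k ∘ (extChartAt (𝓡 n) x).symm) (extChartAt (𝓡 n) x x) :=
  (contDiffAt_comp_extChartAt_symm (mem_extChartAt_source x)
    (contMDiffAt_christoffel hcov k)).differentiableAt (by simp)

/-- The second covariant derivative of constant sections in terms of the Christoffel symbols. -/
theorem cov_covConst (hcov : CovariantDerivative.ContMDiffCovariantDerivative cov ∞)
    (a b e : Euc n) :
    cov (covConst cov x b e) x (constSection x a x) =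
      constSection x (∑ i, (e i •
        fderiv ℝ (christoffel cov x i ∘ (extChartAt (𝓡 n) x).symm) (extChartAt (𝓡 n) x x) a b +
        (∑ j, e j • christoffel cov x j x b) i • christoffel cov x i x a)) x := by
  have hx := mem_baseSet_tangentTriv (n := n) x
  have hσ : MDiffSectionAt (covConst cov x b e) x := mdifferentiableAt_covConst hcov hx b e
  have htc : ∀ z ∈ (tangentTriv n x).baseSet, tangentComp n x ⟨z, covConst cov x b e z⟩ =
      ∑ j, e j • christoffel cov x j z b := by
    intro z hz
    rw [covConst, cov_constSection_eq_sum cov hz]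
    simp only [_root_.sum_apply, _root_.smul_apply]
    rw [tangentComp_sum hz]
    refine Finset.sum_congr rfl fun j _ ↦ ?_
    rw [tangentComp, tangentTriv_eq_continuousLinearMapAt hz, constSection_eq_symmL hz]
    rfl
  have hd : mvfderiv (𝓡 n) (fun z ↦ tangentComp n x ⟨z, covConst cov x b e z⟩) x
      (constSection x a x) = ∑ i, e i •
        fderiv ℝ (christoffel cov x i ∘ (extChartAt (𝓡 n) x).symm) (extChartAt (𝓡 n) x x) a b := by
    rw [← fderiv_comp_extChartAt_symm hx (mdifferentiableAt_tangentComp hx hσ)]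
    have h1 : (fun z ↦ tangentComp n x ⟨z, covConst cov x b e z⟩) ∘ (extChartAt (𝓡 n) x).symm
        =ᶠ[𝓝 (extChartAt (𝓡 n) x x)]
        fun z ↦ ∑ j, e j • (christoffel cov x j ∘ (extChartAt (𝓡 n) x).symm) z b := by
      filter_upwards [eventually_extChartAt_symm_mem_source (mem_extChartAt_source (I := 𝓡 n) x)]
        with z hz
      have hz1 := hz.1
      rw [extChartAt_source] at hz1
      exact htc _ hz1
    have h2 : HasFDerivAt (fun z ↦ ∑ j, e j •
        (christoffel cov x j ∘ (extChartAt (𝓡 n) x).symm) z b) _ (extChartAt (𝓡 n) x x) :=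
      HasFDerivAt.fun_sum fun j _ ↦
      ((differentiableAt_christoffel (x := x) hcov j).hasFDerivAt.clm_apply
        (hasFDerivAt_const b (extChartAt (𝓡 n) x x))).const_smul (e j)
    rw [h1.fderiv_eq, h2.fderiv]
    simp
  rw [cov_eq_sum cov hx hσ]
  simp only [_root_.add_apply, _root_.sum_apply, _root_.smul_apply,
    ContinuousLinearMap.smulRight_apply]
  have hca : tangentComp n x ⟨x, constSection x a x⟩ = a := tangentTriv_constSection hx a
  have e1 : ∑ i, mvfderiv (𝓡 n) (fun z ↦ tangentComp n x ⟨z, covConst cov x b e z⟩ i) x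
      (constSection x a x) • coordField x i x = constSection x (mvfderiv (𝓡 n)
        (fun z ↦ tangentComp n x ⟨z, covConst cov x b e z⟩) x (constSection x a x)) x := by
    refine Eq.trans ?_ (constSection_eq_sum hx _).symm
    refine Finset.sum_congr rfl fun i _ ↦ ?_
    rw [mvfderiv_euclidean_apply (mdifferentiableAt_tangentComp hx hσ)]
  have e2 : ∑ i, tangentComp n x ⟨x, covConst cov x b e x⟩ i •
      cov (coordField x i) x (constSection x a x) = constSection x (∑ i,
        tangentComp n x ⟨x, covConst cov x b e x⟩ i • christoffel cov x i x a) x := by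
    refine Eq.trans ?_ (constSection_eq_symmL hx _).symm
    rw [map_sum]
    refine Finset.sum_congr rfl fun i _ ↦ ?_
    rw [map_smul, ← constSection_eq_symmL hx]
    have h := constSection_christoffel (cov := cov) hx i (constSection x a x)
    rw [hca] at h
    rw [h]
  rw [Finset.sum_add_distrib, Finset.sum_add_distrib, e1, e2, ← hd, ← htc x hx]
  simp only [constSection_eq_symmL hx (_ + _), constSection_eq_symmL hx (mvfderiv _ _ _ _),
    constSection_eq_symmL hx (∑ i, _)]
  rw [map_add, add_comm]

variable [IsManifold (𝓡 m) ∞ N] {ϖ : N → M} {V W : ∀ q : N, TangentSpace (𝓡 n) (ϖ q)} {p : N}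
  [RiemannianBundle (fun x : M ↦ TangentSpace (𝓡 n) x)]
  [IsContMDiffRiemannianBundle (𝓡 n) ∞ (Euc n) (fun x : M ↦ TangentSpace (𝓡 n) x)]

variable (m) in
/-- Smoothness of a vector field along a map. -/
abbrev SmoothAlong (ϖ : N → M) (V : ∀ q : N, TangentSpace (𝓡 n) (ϖ q)) : Prop :=
  ContMDiff (𝓡 m) ((𝓡 n).prod 𝓘(ℝ, Euc n)) ∞
    (fun z ↦ (⟨ϖ z, V z⟩ : TangentBundle (𝓡 n) M))

omit [T2Space M] [IsManifold (𝓡 m) ∞ N] [RiemannianBundle fun x : M ↦ TangentSpace (𝓡 n) x]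
  [IsContMDiffRiemannianBundle (𝓡 n) ∞ (Euc n) fun x : M ↦ TangentSpace (𝓡 n) x] in
theorem SmoothAlong.mdiff (hV : SmoothAlong m ϖ V) (q : N) : MDiffAlongAt m ϖ V q :=
  hV.mdifferentiable (by simp) q

omit [T2Space M] [IsManifold (𝓡 m) ∞ N] [RiemannianBundle fun x : M ↦ TangentSpace (𝓡 n) x]
  [IsContMDiffRiemannianBundle (𝓡 n) ∞ (Euc n) fun x : M ↦ TangentSpace (𝓡 n) x] in
theorem SmoothAlong.proj (hV : SmoothAlong m ϖ V) : ContMDiff (𝓡 m) (𝓡 n) ∞ ϖ := fun q ↦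
  (contMDiffAt_totalSpace.1 (hV q)).1

/-- The structure equation for a pair of vector fields along a map: the exterior derivative of
the one-form `⟨W, ∇V⟩` on vectors along which `V` is parallel. -/
theorem fderiv_inner_covAlong_sub (hcov : IsLeviCivita cov) (hV : SmoothAlong m ϖ V)
    (hW : SmoothAlong m ϖ W) {α : Euc m → (Euc m →L[ℝ] ℝ)}
    (hα : ∀ᶠ q in 𝓝 p, ∀ a, α (extChartAt (𝓡 m) p q) a =
      inner ℝ (W q) (covAlongIn cov (ϖ p) ϖ V q (constSection p a q))) {a b : Euc m}
    (ha : covAlongIn cov (ϖ p) ϖ V p (constSection p a p) = 0)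
    (hb : covAlongIn cov (ϖ p) ϖ V p (constSection p b p) = 0) :
    DifferentiableAt ℝ α (extChartAt (𝓡 m) p p) ∧
    fderiv ℝ α (extChartAt (𝓡 m) p p) a b - fderiv ℝ α (extChartAt (𝓡 m) p p) b a =
      inner ℝ (W p) (curvatureTensor cov (ϖ p) (mfderiv (𝓡 m) (𝓡 n) ϖ p (constSection p a p))
        (mfderiv (𝓡 m) (𝓡 n) ϖ p (constSection p b p)) (V p)) := by
  have hϖ := hV.proj
  have hx := mem_baseSet_tangentTriv (n := n) (ϖ p)
  have hp := mem_baseSet_tangentTriv (n := m) p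
  have hps := mem_extChartAt_source (I := 𝓡 m) p
  let c : Fin n → Euc n →L[ℝ] ℝ := fun k ↦ EuclideanSpace.proj k
  let K : Fin n → Euc n → Euc n →L[ℝ] Euc n := fun k ↦
    christoffel cov (ϖ p) k ∘ (extChartAt (𝓡 n) (ϖ p)).symm
  let ϖ' : Euc m → Euc n := (fun z ↦ extChartAt (𝓡 n) (ϖ p) (ϖ z)) ∘ (extChartAt (𝓡 m) p).symm
  let F : Euc m → Euc n := (fun z ↦ tangentComp n (ϖ p) ⟨ϖ z, V z⟩) ∘ (extChartAt (𝓡 m) p).symm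
  -- Pairing with `W`, read in components. With `ℓ` its expression in the chart, `α` takes the form
  -- `ℓ ∘ ∇F` treated in `fderiv_comp_covAlongMap_sub`.
  let l : N → Euc n →L[ℝ] ℝ := fun q ↦
    ∑ k, (inner ℝ (W q) (coordField (ϖ p) k (ϖ q)) : ℝ) • (EuclideanSpace.proj k : Euc n →L[ℝ] ℝ)
  let ℓ : Euc m → Euc n →L[ℝ] ℝ := l ∘ (extChartAt (𝓡 m) p).symm
  have hl : ∀ q, ϖ q ∈ (tangentTriv n (ϖ p)).baseSet → ∀ e, l q e =
      inner ℝ (W q) (constSection (ϖ p) e (ϖ q)) := by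
    intro q hq e
    rw [constSection_eq_sum hq]
    simp only [l, inner_sum, real_inner_smul_right, _root_.sum_apply, _root_.smul_apply,
      smul_eq_mul]
    exact Finset.sum_congr rfl fun _ _ ↦ mul_comm _ _
  have hα' : α =ᶠ[𝓝 (extChartAt (𝓡 m) p p)] fun y ↦ (ℓ y).comp (covAlongMap c K ϖ' F y) := by
    have h1 : ∀ᶠ q in 𝓝 p, q ∈ (tangentTriv m p).baseSet ∧
        ϖ q ∈ (tangentTriv n (ϖ p)).baseSet ∧ ∀ a, α (extChartAt (𝓡 m) p q) a =
          inner ℝ (W q) (covAlongIn cov (ϖ p) ϖ V q (constSection p a q)) := by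
      filter_upwards [(tangentTriv m p).open_baseSet.mem_nhds hp, hα,
        hϖ.continuous.continuousAt ((tangentTriv n (ϖ p)).open_baseSet.mem_nhds hx)] with q h1 h2 h3
      exact ⟨h1, h3, h2⟩
    have hcont : Tendsto (extChartAt (𝓡 m) p).symm (𝓝 (extChartAt (𝓡 m) p p)) (𝓝 p) := by
      have := continuousAt_extChartAt_symm (I := 𝓡 m) p
      rwa [ContinuousAt, (extChartAt (𝓡 m) p).left_inv hps] at this
    filter_upwards [hcont.eventually h1, eventually_extChartAt_symm_mem_source hps]
      with y ⟨hy1, hy2, hy3⟩ hy4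
    ext a
    have h2 := hy3 a
    rw [covAlongIn_constSection (hV.mdiff _) hy1 hy2, ← hl _ hy2, hy4.2] at h2
    exact h2
  have hF : ContDiffAt ℝ 2 F (extChartAt (𝓡 m) p p) := by
    have h1 : ContMDiffAt (𝓡 m) 𝓘(ℝ, Euc n) ∞ (fun z ↦ tangentComp n (ϖ p) ⟨ϖ z, V z⟩) p :=
      (((tangentTriv n (ϖ p)).contMDiffAt_iff ((tangentTriv n (ϖ p)).mem_source.2 hx)).1 (hV p)).2
    exact (contDiffAt_comp_extChartAt_symm hps h1).of_le (WithTop.coe_le_coe.2 le_top)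
  have hϖ' : ContDiffAt ℝ 2 ϖ' (extChartAt (𝓡 m) p p) := by
    have h1 : ContMDiffAt (𝓡 m) 𝓘(ℝ, Euc n) ∞ (fun z ↦ extChartAt (𝓡 n) (ϖ p) (ϖ z)) p :=
      (contMDiffAt_extChartAt (n := ∞)).comp p (hϖ p)
    exact (contDiffAt_comp_extChartAt_symm hps h1).of_le (WithTop.coe_le_coe.2 le_top)
  have hϖp : ϖ' (extChartAt (𝓡 m) p p) = extChartAt (𝓡 n) (ϖ p) (ϖ p) :=
    congrArg (fun z ↦ extChartAt (𝓡 n) (ϖ p) (ϖ z)) ((extChartAt (𝓡 m) p).left_inv hps)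
  have hFp : F (extChartAt (𝓡 m) p p) = tangentComp n (ϖ p) ⟨ϖ p, V p⟩ :=
    congrArg (fun z ↦ tangentComp n (ϖ p) ⟨ϖ z, V z⟩) ((extChartAt (𝓡 m) p).left_inv hps)
  have hℓp : ℓ (extChartAt (𝓡 m) p p) = l p :=
    congrArg l ((extChartAt (𝓡 m) p).left_inv hps)
  have hK : ∀ i, DifferentiableAt ℝ (K i) (ϖ' (extChartAt (𝓡 m) p p)) := fun i ↦ by
    rw [hϖp]
    exact differentiableAt_christoffel hcov.smooth i
  have hℓ : DifferentiableAt ℝ ℓ (extChartAt (𝓡 m) p p) := by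
    have h1 : ∀ k, ContMDiffAt (𝓡 m) 𝓘(ℝ, ℝ) ∞
        (fun q ↦ (inner ℝ (W q) (coordField (ϖ p) k (ϖ q)) : ℝ)) p := fun k ↦
      (hW p).inner_bundle ((contMDiffAt_constSection hx (stdVec k)).comp p (hϖ p))
    have h2 : ℓ = fun y ↦ ∑ k, ((fun q ↦ (inner ℝ (W q) (coordField (ϖ p) k (ϖ q)) : ℝ)) ∘
        (extChartAt (𝓡 m) p).symm) y • (EuclideanSpace.proj k : Euc n →L[ℝ] ℝ) := rfl
    rw [h2]
    refine DifferentiableAt.fun_sum fun k _ ↦ ?_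
    exact ((contDiffAt_comp_extChartAt_symm hps (h1 k)).differentiableAt (by simp)).smul_const _
  have hzero : ∀ a, covAlongIn cov (ϖ p) ϖ V p (constSection p a p) = 0 →
      covAlongMap c K ϖ' F (extChartAt (𝓡 m) p p) a = 0 := by
    intro a ha
    rw [covAlongIn_constSection (hV.mdiff p) hp hx] at ha
    have h1 := tangentTriv_constSection hx
      (covAlongMap c K ϖ' F (extChartAt (𝓡 m) p p) a)
    rw [← h1]
    refine Eq.trans (congrArg (fun u ↦ ((tangentTriv n (ϖ p)) ⟨ϖ p, u⟩).2) ha) ?_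
    simp only [tangentTriv_eq_continuousLinearMapAt hx, map_zero]
  have hd : ∀ a, fderiv ℝ ϖ' (extChartAt (𝓡 m) p p) a = tangentComp n (ϖ p)
      ⟨ϖ p, mfderiv (𝓡 m) (𝓡 n) ϖ p (constSection p a p)⟩ := fun a ↦
    fderiv_extChartAt_comp hp hx (hV.mdiff p).proj a
  refine ⟨?_, ?_⟩
  · obtain ⟨D, hD, -⟩ := hasFDerivAt_comp_covAlongMap (c := c) hF hϖ' hK hℓ
    exact (hD.congr_of_eventuallyEq hα').differentiableAt
  · rw [hα'.fderiv_eq, fderiv_comp_covAlongMap_sub hF hϖ' hK hℓ (hzero a ha) (hzero b hb), hℓp,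
      hl p hx, hd, hd, hϖp, hFp]
    have hKx : ∀ i, K i (extChartAt (𝓡 n) (ϖ p) (ϖ p)) = christoffel cov (ϖ p) i (ϖ p) := fun i ↦
      congrArg (christoffel cov (ϖ p) i)
        ((extChartAt (𝓡 n) (ϖ p)).left_inv (mem_extChartAt_source (ϖ p)))
    simp only [hKx]
    have hcs : ∀ u : TangentSpace (𝓡 n) (ϖ p),
        constSection (ϖ p) (tangentComp n (ϖ p) ⟨ϖ p, u⟩) (ϖ p) = u := fun u ↦
      constSection_tangentTriv hx u
    have hR := curvatureTensor_constSection cov (ϖ p)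
      (tangentComp n (ϖ p) ⟨ϖ p, mfderiv (𝓡 m) (𝓡 n) ϖ p (constSection p a p)⟩)
      (tangentComp n (ϖ p) ⟨ϖ p, mfderiv (𝓡 m) (𝓡 n) ϖ p (constSection p b p)⟩)
      (tangentComp n (ϖ p) ⟨ϖ p, V p⟩)
    -- The curvature of the coordinate fields is written with the same Christoffel expression as the
    -- left-hand side, so the two match term by term.
    rw [cov_covConst hcov.smooth, cov_covConst hcov.smooth, hcs, hcs, hcs] at hR
    rw [hR, constSection_eq_symmL hx, constSection_eq_symmL hx, constSection_eq_symmL hx, ← map_sub]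
    rfl

end Structure

/-! ### Exterior derivatives of one-forms, by components and along maps. -/

section ExteriorDerivative

/-- `fderiv` has the default value zero at points of non-differentiability, so taking components
requires differentiability of the whole form; in finite dimension this follows from that of the
components. -/
theorem extDerivOneForm_apply_coord {m : ℕ} {P : Type*} [TopologicalSpace P]
    [ChartedSpace (Euc m) P] [IsManifold (𝓡 m) ∞ P] {ι : Type*} [Fintype ι] [DecidableEq ι]
    (θ : ∀ p : P, TangentSpace (𝓡 m) p →L[ℝ] EuclideanSpace ℝ ι) (p : P)
    (ξ η : TangentSpace (𝓡 m) p)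
    (hd : ∀ i, DifferentiableAt ℝ (fun y ↦ (EuclideanSpace.proj i : EuclideanSpace ℝ ι →L[ℝ] ℝ).comp
      ((θ ((extChartAt (𝓡 m) p).symm y)).comp
        (mfderiv 𝓘(ℝ, Euc m) (𝓡 m) (extChartAt (𝓡 m) p).symm y)) : Euc m → Euc m →L[ℝ] ℝ)
      (extChartAt (𝓡 m) p p)) (i : ι) :
    extDerivOneForm θ p ξ η i = extDerivOneForm
      (fun q ↦ (EuclideanSpace.proj i : EuclideanSpace ℝ ι →L[ℝ] ℝ).comp (θ q)) p ξ η := by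
  have key : ∀ (α : Euc m → Euc m →L[ℝ] EuclideanSpace ℝ ι) (y a b : Euc m),
      (∀ i, DifferentiableAt ℝ
        (fun y ↦ (EuclideanSpace.proj i : EuclideanSpace ℝ ι →L[ℝ] ℝ).comp (α y)) y) →
      (fderiv ℝ α y a b - fderiv ℝ α y b a) i =
        fderiv ℝ (fun y ↦ (EuclideanSpace.proj i : EuclideanSpace ℝ ι →L[ℝ] ℝ).comp (α y)) y a b -
        fderiv ℝ (fun y ↦ (EuclideanSpace.proj i : EuclideanSpace ℝ ι →L[ℝ] ℝ).comp (α y)) y b a := by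
    intro α y a b h
    have h1 : α = fun y ↦ ∑ i, (ContinuousLinearMap.toSpanSingleton ℝ
        (EuclideanSpace.single i 1 : EuclideanSpace ℝ ι)).comp
          ((EuclideanSpace.proj i : EuclideanSpace ℝ ι →L[ℝ] ℝ).comp (α y)) := by
      funext y
      ext a j
      simp [Finset.sum_apply, Pi.single_apply]
    have h2 : DifferentiableAt ℝ α y := by
      rw [h1]
      exact DifferentiableAt.fun_sum fun i _ ↦ (differentiableAt_const _).clm_comp (h i)
    have h3 := (hasFDerivAt_const (EuclideanSpace.proj i : EuclideanSpace ℝ ι →L[ℝ] ℝ) y).clm_comp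
      h2.hasFDerivAt
    rw [h3.fderiv]
    simp
  exact key _ _ _ _ hd

variable {n m : ℕ} {M : Type*} [TopologicalSpace M] [T2Space M] [ChartedSpace (Euc n) M]
  [IsManifold (𝓡 n) ∞ M] {N : Type*} [TopologicalSpace N] [ChartedSpace (Euc m) N]
  {cov : CovariantDerivative (𝓡 n) (Euc n) (fun x : M ↦ TangentSpace (𝓡 n) x)}
  [IsManifold (𝓡 m) ∞ N] {ϖ : N → M} {V W : ∀ q : N, TangentSpace (𝓡 n) (ϖ q)} {p : N}

theorem mfderiv_extChartAt_eq_tangentComp (ξ : TangentSpace (𝓡 m) p) :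
    (mfderiv (𝓡 m) 𝓘(ℝ, Euc m) (extChartAt (𝓡 m) p) p : TangentSpace (𝓡 m) p →L[ℝ] Euc m) ξ =
      tangentComp m p ⟨p, ξ⟩ := by
  rw [tangentComp, tangentTriv_eq_continuousLinearMapAt (mem_baseSet_tangentTriv p)]
  exact congrArg (fun L : TangentSpace (𝓡 m) p →L[ℝ] Euc m ↦ L ξ)
    (TangentBundle.continuousLinearMapAt_trivializationAt (mem_chart_source _ p)).symm

theorem oneForm_extChartAt_symm (θ : ∀ q : N, TangentSpace (𝓡 m) q →L[ℝ] ℝ) {q : N}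
    (hq : q ∈ (tangentTriv m p).baseSet) (a : Euc m) :
    (((θ ((extChartAt (𝓡 m) p).symm (extChartAt (𝓡 m) p q))).comp
      (mfderiv 𝓘(ℝ, Euc m) (𝓡 m) (extChartAt (𝓡 m) p).symm (extChartAt (𝓡 m) p q)) :
        Euc m →L[ℝ] ℝ)) a = θ q (constSection p a q) := by
  -- The point `φ.symm (φ q)` equals `q` only propositionally, so the tangent vectors at both points
  -- are compared in the common model space.
  have key : ∀ {q q' : N} (_ : q' = q) (v : TangentSpace (𝓡 m) q') (u : TangentSpace (𝓡 m) q),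
      (v : Euc m) = (u : Euc m) → θ q' v = θ q u := by
    rintro q q' rfl v u h
    exact congrArg (θ q') h
  have hq' : q ∈ (extChartAt (𝓡 m) p).source := by rw [extChartAt_source]; exact hq
  exact key ((extChartAt (𝓡 m) p).left_inv hq') _ _ (mfderiv_extChartAt_symm_eq_constSection hq a)

variable [RiemannianBundle (fun x : M ↦ TangentSpace (𝓡 n) x)]
  [IsContMDiffRiemannianBundle (𝓡 n) ∞ (Euc n) (fun x : M ↦ TangentSpace (𝓡 n) x)]

/-- The exterior derivative of the one-form `⟨W, ∇V⟩` on vectors along which `V` is parallel. -/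
theorem extDerivOneForm_inner_covAlong (hcov : IsLeviCivita cov) (hV : SmoothAlong m ϖ V)
    (hW : SmoothAlong m ϖ W) {θ : ∀ q : N, TangentSpace (𝓡 m) q →L[ℝ] ℝ}
    (hθ : ∀ᶠ q in 𝓝 p, ∀ ξ, θ q ξ = inner ℝ (W q) (covAlongIn cov (ϖ p) ϖ V q ξ))
    {ξ η : TangentSpace (𝓡 m) p} (hξ : covAlongIn cov (ϖ p) ϖ V p ξ = 0)
    (hη : covAlongIn cov (ϖ p) ϖ V p η = 0) :
    DifferentiableAt ℝ (fun y ↦ (θ ((extChartAt (𝓡 m) p).symm y)).comp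
        (mfderiv 𝓘(ℝ, Euc m) (𝓡 m) (extChartAt (𝓡 m) p).symm y) : Euc m → Euc m →L[ℝ] ℝ)
      (extChartAt (𝓡 m) p p) ∧
    extDerivOneForm θ p ξ η = inner ℝ (W p) (curvatureTensor cov (ϖ p)
      (mfderiv (𝓡 m) (𝓡 n) ϖ p ξ) (mfderiv (𝓡 m) (𝓡 n) ϖ p η) (V p)) := by
  have hp := mem_baseSet_tangentTriv (n := m) p
  let α : Euc m → Euc m →L[ℝ] ℝ := fun y ↦ (θ ((extChartAt (𝓡 m) p).symm y)).comp
    (mfderiv 𝓘(ℝ, Euc m) (𝓡 m) (extChartAt (𝓡 m) p).symm y)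
  have ha : ∀ ξ : TangentSpace (𝓡 m) p, constSection p (tangentComp m p ⟨p, ξ⟩) p = ξ :=
    fun ξ ↦ constSection_tangentTriv hp ξ
  have hα : ∀ᶠ q in 𝓝 p, ∀ a, α (extChartAt (𝓡 m) p q) a =
      inner ℝ (W q) (covAlongIn cov (ϖ p) ϖ V q (constSection p a q)) := by
    filter_upwards [(tangentTriv m p).open_baseSet.mem_nhds hp, hθ] with q hq h a
    rw [← h]
    exact oneForm_extChartAt_symm θ hq a
  obtain ⟨h1, h2⟩ := fderiv_inner_covAlong_sub hcov hV hW hα (a := tangentComp m p ⟨p, ξ⟩)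
    (b := tangentComp m p ⟨p, η⟩) (by rw [ha]; exact hξ) (by rw [ha]; exact hη)
  rw [ha, ha] at h2
  refine ⟨h1, ?_⟩
  rw [← h2, ← mfderiv_extChartAt_eq_tangentComp, ← mfderiv_extChartAt_eq_tangentComp]
  rfl

end ExteriorDerivative

/-! ### The spinorial connection form and its curvature. -/

section SpinGeometry

variable {n : ℕ} {M : Type*} [TopologicalSpace M] [T2Space M] [ChartedSpace (Euc n) M]
  [IsManifold (𝓡 n) ∞ M]
  [RiemannianBundle (fun x : M ↦ TangentSpace (𝓡 n) x)]
  [IsContMDiffRiemannianBundle (𝓡 n) ∞ (Euc n) (fun x : M ↦ TangentSpace (𝓡 n) x)]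
  {P : Type*} [TopologicalSpace P] [ChartedSpace (Euc (n * (n + 1) / 2)) P]
  [IsManifold (𝓡 (n * (n + 1) / 2)) ∞ P] [MulAction (SpinGrp n)ᵐᵒᵖ P]
  [ContinuousSMul (SpinGrp n)ᵐᵒᵖ P]
  {S : SpinStructure n M P}
  {cov : CovariantDerivative (𝓡 n) (Euc n) (fun x : M ↦ TangentSpace (𝓡 n) x)} {p : P}

namespace SpinStructure

variable (S) in
/-- The vector fields along the projection that make up the frame. -/
def frameField (v : Euc n) (p : P) : TangentSpace (𝓡 n) (S.proj p) := S.frame p v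

theorem smoothAlong_frameField (v : Euc n) :
    SmoothAlong (n * (n + 1) / 2) S.proj (S.frameField v) := S.contMDiff_frame v

/-- The definition of `covAlong` uses the chart centred at `π(q)`, which moves with `q`. To
differentiate the connection form near a point, all nearby values are expressed in one fixed chart.
-/
theorem covAlong_eq {V : ∀ p : P, TangentSpace (𝓡 n) (S.proj p)} {x : M} {q : P}
    (hV : MDiffAlongAt (n * (n + 1) / 2) S.proj V q) (hx : S.proj q ∈ (tangentTriv n x).baseSet)
    (ξ : TangentSpace (𝓡 (n * (n + 1) / 2)) q) :
    S.covAlong cov V q ξ = covAlongIn cov x S.proj V q ξ := by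
  have hq := mem_baseSet_tangentTriv (n := n) (S.proj q)
  have h1 := cov_constSection_eq_sum cov hq (tangentComp n (S.proj q) ⟨S.proj q, V q⟩)
  have h2 : cov (FiberBundle.extend (Euc n) (V q)) (S.proj q) = _ := h1
  have h3 : S.covAlong cov V q ξ = (tangentTriv n (S.proj q)).symmL ℝ (S.proj q)
      (mvfderiv (𝓡 (n * (n + 1) / 2)) (fun z ↦ tangentComp n (S.proj q) ⟨S.proj z, V z⟩) q ξ) +
      cov (FiberBundle.extend (Euc n) (V q)) (S.proj q) (S.dproj q ξ) := rfl
  rw [covAlongIn_eq hV hx hq, covAlongIn, Finset.sum_add_distrib, h3, h2,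
    ← constSection_eq_symmL hq, constSection_eq_sum hq, _root_.sum_apply]
  refine (add_comm _ _).trans ?_
  congr 1
  refine Finset.sum_congr rfl fun i _ ↦ ?_
  rw [mvfderiv_euclidean_apply (hV.comp hq)]

theorem connForm_apply (q : P) (ξ : TangentSpace (𝓡 (n * (n + 1) / 2)) q) (ij : Pairs n) :
    S.connForm cov q ξ ij = (1 / 2) * inner ℝ (S.frame q (stdVec ij.1.2))
      (S.covAlong cov (S.frameField (stdVec ij.1.1)) q ξ) := rfl

/-- Differentiate the constant function `⟨f v, f w⟩ = ⟨v, w⟩`. -/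
theorem inner_covAlong_frame_swap (hcov : IsLeviCivita cov)
    (ξ : TangentSpace (𝓡 (n * (n + 1) / 2)) p) (v w : Euc n) :
    (inner ℝ (S.frame p w) (S.covAlong cov (S.frameField v) p ξ) : ℝ) =
      -inner ℝ (S.frame p v) (S.covAlong cov (S.frameField w) p ξ) := by
  have hx := mem_baseSet_tangentTriv (n := n) (S.proj p)
  have hv := (S.smoothAlong_frameField v).mdiff p
  have hw := (S.smoothAlong_frameField w).mdiff p
  have h := mvfderiv_inner_along hcov hv hw hx ξ
  have h1 : (fun z ↦ (inner ℝ (S.frameField v z) (S.frameField w z) : ℝ)) =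
      fun _ ↦ inner ℝ v w := funext fun z ↦ (S.frame z).inner_map_map v w
  rw [h1, mvfderiv_const] at h
  rw [covAlong_eq hv hx, covAlong_eq hw hx, eq_neg_iff_add_eq_zero, real_inner_comm]
  exact h.symm

/-- The form `ω` records only the coefficients with `i < j`; skewness supplies the others and the
zero diagonal. Hence horizontal vectors are those along which the frame is parallel. -/
theorem covAlong_frame_eq_zero (hcov : IsLeviCivita cov)
    {ξ : TangentSpace (𝓡 (n * (n + 1) / 2)) p} (hξ : S.connForm cov p ξ = 0) (i : Fin n) :
    S.covAlong cov (S.frameField (stdVec i)) p ξ = 0 := by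
  have h : ∀ i j, i < j → (inner ℝ (S.frame p (stdVec j))
      (S.covAlong cov (S.frameField (stdVec i)) p ξ) : ℝ) = 0 := by
    intro i j hij
    have h1 := S.connForm_apply (cov := cov) p ξ ⟨(i, j), hij⟩
    rw [hξ] at h1
    simpa using h1.symm
  rw [← S.sum_inner_frame p (S.covAlong cov (S.frameField (stdVec i)) p ξ)]
  refine Finset.sum_eq_zero fun j _ ↦ ?_
  rcases lt_trichotomy i j with hij | rfl | hij
  · rw [h i j hij, zero_smul]
  · have h2 := S.inner_covAlong_frame_swap hcov ξ (stdVec i) (stdVec i)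
    rw [self_eq_neg.1 h2, zero_smul]
  · rw [S.inner_covAlong_frame_swap hcov, h j i hij, neg_zero, zero_smul]

/-- The structure equation: on horizontal vectors the curvature of the spinorial connection is the
Riemannian curvature. -/
theorem spinCurvature_apply (hcov : IsLeviCivita cov) (ξ η : S.horizontal cov p) (ij : Pairs n) :
    S.spinCurvature cov p ξ η ij = (1 / 2) * inner ℝ (S.frame p (stdVec ij.1.2))
      (curvatureTensor cov (S.proj p) (S.dproj p ξ) (S.dproj p η) (S.frame p (stdVec ij.1.1))) := by
  have hx := mem_baseSet_tangentTriv (n := n) (S.proj p)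
  have hV := S.smoothAlong_frameField
  -- The factor `1 / 2` of `ω` is absorbed into the second field, so each component is literally of
  -- the form `⟨W, ∇V⟩`.
  have hθ : ∀ ij : Pairs n, ∀ᶠ q in 𝓝 p, ∀ ξ : TangentSpace (𝓡 (n * (n + 1) / 2)) q,
      (EuclideanSpace.proj ij : SpinAlg n →L[ℝ] ℝ).comp (S.connForm cov q) ξ =
        inner ℝ (S.frameField ((1 / 2 : ℝ) • stdVec ij.1.2) q)
          (covAlongIn cov (S.proj p) S.proj (S.frameField (stdVec ij.1.1)) q ξ) := by
    intro ij
    filter_upwards [S.contMDiff_proj.continuous.continuousAt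
      ((tangentTriv n (S.proj p)).open_baseSet.mem_nhds hx)] with q hq ξ
    refine (S.connForm_apply q ξ ij).trans ?_
    rw [← covAlong_eq ((hV _).mdiff q) hq, frameField, map_smul, real_inner_smul_left]
  have hzero : ∀ (ξ : S.horizontal cov p) (i : Fin n),
      covAlongIn cov (S.proj p) S.proj (S.frameField (stdVec i)) p
        (ξ : TangentSpace (𝓡 (n * (n + 1) / 2)) p) = 0 := fun ξ i ↦ by
    rw [← covAlong_eq ((hV _).mdiff p) hx]
    exact covAlong_frame_eq_zero hcov ξ.2 i
  have h := fun ij : Pairs n ↦ extDerivOneForm_inner_covAlong hcov (hV (stdVec ij.1.1))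
    (hV ((1 / 2 : ℝ) • stdVec ij.1.2)) (hθ ij) (hzero ξ ij.1.1) (hzero η ij.1.1)
  have h1 := extDerivOneForm_apply_coord (S.connForm cov) p
    (ξ : TangentSpace (𝓡 (n * (n + 1) / 2)) p) (η : TangentSpace (𝓡 (n * (n + 1) / 2)) p)
    (fun ij ↦ (h ij).1) ij
  refine h1.trans ((h ij).2.trans ?_)
  rw [frameField, map_smul, real_inner_smul_left]
  rfl

end SpinStructure
end SpinGeometry

/-! ### The horizontal space is isomorphic to the tangent space of the base. -/

section SpinHorizontal

variable {n : ℕ} {M : Type*} [TopologicalSpace M] [T2Space M] [ChartedSpace (Euc n) M]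
  [IsManifold (𝓡 n) ∞ M]
  [RiemannianBundle (fun x : M ↦ TangentSpace (𝓡 n) x)]
  [IsContMDiffRiemannianBundle (𝓡 n) ∞ (Euc n) (fun x : M ↦ TangentSpace (𝓡 n) x)]

section AlongMap

variable {m : ℕ} {N : Type*} [TopologicalSpace N] [ChartedSpace (Euc m) N] {ϖ : N → M}
  {V : ∀ q : N, TangentSpace (𝓡 n) (ϖ q)} {p : N}
  {cov : CovariantDerivative (𝓡 n) (Euc n) (fun x : M ↦ TangentSpace (𝓡 n) x)}

/-- A vector field along a map as a map to the tangent bundle is stationary in a direction if its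
components are. -/
theorem mfderiv_along_eq_zero (hV : MDiffAlongAt m ϖ V p) {ξ : TangentSpace (𝓡 m) p}
    (h0 : mfderiv (𝓡 m) (𝓡 n) ϖ p ξ = 0)
    (h1 : mvfderiv (𝓡 m) (fun z ↦ tangentComp n (ϖ p) ⟨ϖ z, V z⟩) p ξ = 0) :
    mfderiv (𝓡 m) (𝓡 n).tangent (fun z ↦ (⟨ϖ z, V z⟩ : TangentBundle (𝓡 n) M)) p ξ = 0 := by
  have hx := mem_baseSet_tangentTriv (n := n) (ϖ p)
  let t := tangentTriv n (ϖ p)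
  let F : N → M × Euc n := fun z ↦ (ϖ z, tangentComp n (ϖ p) ⟨ϖ z, V z⟩)
  let g : M × Euc n → TangentBundle (𝓡 n) M := t.toOpenPartialHomeomorph.symm
  have hF : HasMFDerivAt (𝓡 m) ((𝓡 n).prod 𝓘(ℝ, Euc n)) F p
      ((mfderiv (𝓡 m) (𝓡 n) ϖ p).prod
        (mfderiv (𝓡 m) 𝓘(ℝ, Euc n) (fun z ↦ tangentComp n (ϖ p) ⟨ϖ z, V z⟩) p)) :=
    hV.proj.hasMFDerivAt.prodMk (hV.comp hx).hasMFDerivAt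
  have hFp : F p ∈ t.target := t.mem_target.2 hx
  have hg : MDifferentiableAt ((𝓡 n).prod 𝓘(ℝ, Euc n)) ((𝓡 n).prod 𝓘(ℝ, Euc n)) g (F p) :=
    ((t.contMDiffOn_symm (n := ∞) (IB := 𝓡 n)).contMDiffAt
      (t.open_target.mem_nhds hFp)).mdifferentiableAt (by simp)
  have hcomp := (HasMFDerivAt.comp p hg.hasMFDerivAt hF)
  have heq : (fun z ↦ (⟨ϖ z, V z⟩ : TangentBundle (𝓡 n) M)) =ᶠ[𝓝 p] g ∘ F := by
    filter_upwards [hV.proj.continuousAt (t.open_baseSet.mem_nhds hx)] with z hz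
    have h3 : (⟨ϖ z, V z⟩ : TangentBundle (𝓡 n) M) ∈ t.source := t.mem_source.2 hz
    have h2 := t.toOpenPartialHomeomorph.left_inv h3
    refine h2.symm.trans (congrArg t.toOpenPartialHomeomorph.symm ?_)
    exact Prod.ext (t.coe_fst h3) rfl
  have h4 := (hcomp.congr_of_eventuallyEq heq).mfderiv
  have h5 : ((mfderiv (𝓡 m) (𝓡 n) ϖ p).prod
        (mfderiv (𝓡 m) 𝓘(ℝ, Euc n) (fun z ↦ tangentComp n (ϖ p) ⟨ϖ z, V z⟩) p)) ξ = 0 :=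
    Prod.ext h0 h1
  refine (congrArg (fun L ↦ L ξ) h4).trans ?_
  exact (congrArg (mfderiv ((𝓡 n).prod 𝓘(ℝ, Euc n)) ((𝓡 n).prod 𝓘(ℝ, Euc n)) g (F p)) h5).trans
    (map_zero _)

/-- In a vertical direction the Christoffel term drops out, so the covariant derivative is the plain
derivative of the components. -/
theorem mvfderiv_comp_eq_zero (hV : MDiffAlongAt m ϖ V p) {ξ : TangentSpace (𝓡 m) p}
    (h0 : mfderiv (𝓡 m) (𝓡 n) ϖ p ξ = 0) (h1 : covAlongIn cov (ϖ p) ϖ V p ξ = 0) :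
    mvfderiv (𝓡 m) (fun z ↦ tangentComp n (ϖ p) ⟨ϖ z, V z⟩) p ξ = 0 := by
  have hx := mem_baseSet_tangentTriv (n := n) (ϖ p)
  have h2 : constSection (ϖ p)
      (mvfderiv (𝓡 m) (fun z ↦ tangentComp n (ϖ p) ⟨ϖ z, V z⟩) p ξ) (ϖ p) = 0 := by
    rw [← h1, covAlongIn, h0]
    refine (constSection_eq_sum hx _).trans ?_
    refine Finset.sum_congr rfl fun i _ ↦ ?_
    rw [map_zero, smul_zero, zero_add, mvfderiv_euclidean_apply (hV.comp hx)]
  refine (tangentTriv_constSection hx _).symm.trans ?_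
  rw [h2, tangentTriv_eq_continuousLinearMapAt hx, map_zero]

end AlongMap

variable {P : Type*} [TopologicalSpace P] [ChartedSpace (Euc (n * (n + 1) / 2)) P]
  [IsManifold (𝓡 (n * (n + 1) / 2)) ∞ P] [MulAction (SpinGrp n)ᵐᵒᵖ P]
  [ContinuousSMul (SpinGrp n)ᵐᵒᵖ P]
  {S : SpinStructure n M P}
  {cov : CovariantDerivative (𝓡 n) (Euc n) (fun x : M ↦ TangentSpace (𝓡 n) x)} {p : P}

theorem card_pairs (n : ℕ) : Fintype.card (Pairs n) * 2 = n * (n - 1) := by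
  let e : Pairs n ≃ Σ j : Fin n, Fin j :=
    { toFun := fun ij ↦ ⟨ij.1.2, ⟨ij.1.1, ij.2⟩⟩
      invFun := fun s ↦ ⟨(⟨s.2, s.2.2.trans s.1.2⟩, s.1), s.2.2⟩
      left_inv := fun _ ↦ rfl
      right_inv := fun _ ↦ rfl }
  rw [Fintype.card_congr e, Fintype.card_sigma]
  simp only [Fintype.card_fin]
  rw [Fin.sum_univ_eq_sum_range (fun i ↦ i), Finset.sum_range_id_mul_two]

namespace SpinStructure

/-- In a direction both horizontal and vertical neither the base point nor the components of the
frame vectors move to first order; the immersion property then forces the vector to be zero. -/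
theorem eq_zero_of_connForm_of_dproj (hcov : IsLeviCivita cov)
    {ξ : TangentSpace (𝓡 (n * (n + 1) / 2)) p} (h : S.connForm cov p ξ = 0)
    (h0 : S.dproj p ξ = 0) : ξ = 0 := by
  have hx := mem_baseSet_tangentTriv (n := n) (S.proj p)
  refine S.immersion p ξ fun v ↦ ?_
  have hV := fun v ↦ (S.smoothAlong_frameField v).mdiff p
  have h1 : ∀ i, mvfderiv (𝓡 (n * (n + 1) / 2)) (fun z ↦ tangentComp n (S.proj p)
      ⟨S.proj z, S.frameField (stdVec i) z⟩) p ξ = 0 := fun i ↦ by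
    refine mvfderiv_comp_eq_zero (cov := cov) (hV _) h0 ?_
    rw [← covAlong_eq (hV _) hx]
    exact covAlong_frame_eq_zero hcov h i
  refine mfderiv_along_eq_zero (hV v) h0 ?_
  ext k
  rw [← mvfderiv_euclidean_apply ((hV v).comp hx)]
  have hv : v = ∑ i, v i • stdVec i := by
    ext j
    simp [stdVec, Finset.sum_apply, Pi.single_apply]
  have h2 : (fun z ↦ tangentComp n (S.proj p) ⟨S.proj z, S.frameField v z⟩ k) =ᶠ[𝓝 p]
      fun z ↦ ∑ i, v i * tangentComp n (S.proj p) ⟨S.proj z, S.frameField (stdVec i) z⟩ k := by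
    filter_upwards [(hV v).proj.continuousAt
      ((tangentTriv n (S.proj p)).open_baseSet.mem_nhds hx)] with z hz
    have h3 : S.frameField v z = ∑ i, v i • S.frameField (stdVec i) z := by
      simp only [frameField]
      conv_lhs => rw [hv]
      simp only [map_sum, map_smul]
    rw [h3, tangentComp_sum hz]
    simp
  have h3 : mvfderiv (𝓡 (n * (n + 1) / 2))
      (fun z ↦ tangentComp n (S.proj p) ⟨S.proj z, S.frameField v z⟩ k) p =
      mvfderiv (𝓡 (n * (n + 1) / 2)) (fun z ↦ ∑ i, v i *
        tangentComp n (S.proj p) ⟨S.proj z, S.frameField (stdVec i) z⟩ k) p := h2.mfderiv_eq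
  rw [h3, mvfderiv_sum_mul Finset.univ (f := fun i _ ↦ v i) (fun _ ↦ mdifferentiableAt_const)
    fun i ↦ ((hV (stdVec i)).comp hx).euclidean_apply k]
  refine Finset.sum_eq_zero fun i _ ↦ ?_
  rw [mvfderiv_euclidean_apply ((hV _).comp hx), h1 i, mvfderiv_const]
  simp

/-- Because `ContinuousLinearMap.inverse` is zero on non-invertible maps, the isomorphism must be
proved. Injectivity bounds the dimension of the horizontal space by `n`; rank-nullity for `ω` bounds
it below by `n (n + 1) / 2 - n (n - 1) / 2 = n`. -/
theorem dproj_horizontalLift (hcov : IsLeviCivita cov) (u : TangentSpace (𝓡 n) (S.proj p)) :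
    S.dproj p (S.horizontalLift cov p u) = u := by
  have hinj : Function.Injective ((S.dproj p).comp (S.horizontal cov p).subtypeL) := by
    refine (injective_iff_map_eq_zero _).2 fun ξ hξ ↦ Subtype.ext ?_
    exact eq_zero_of_connForm_of_dproj hcov ξ.2 hξ
  have hfd : FiniteDimensional ℝ (TangentSpace (𝓡 (n * (n + 1) / 2)) p) :=
    inferInstanceAs (FiniteDimensional ℝ (Euc (n * (n + 1) / 2)))
  have hfd' : FiniteDimensional ℝ (TangentSpace (𝓡 n) (S.proj p)) :=
    inferInstanceAs (FiniteDimensional ℝ (Euc n))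
  have ht2 : T2Space (TangentSpace (𝓡 (n * (n + 1) / 2)) p) :=
    inferInstanceAs (T2Space (Euc (n * (n + 1) / 2)))
  have hP : Module.finrank ℝ (TangentSpace (𝓡 (n * (n + 1) / 2)) p) = n * (n + 1) / 2 :=
    finrank_euclideanSpace_fin
  have hM : Module.finrank ℝ (TangentSpace (𝓡 n) (S.proj p)) = n := finrank_euclideanSpace_fin
  have hA : Module.finrank ℝ (SpinAlg n) = Fintype.card (Pairs n) := finrank_euclideanSpace
  have h1 := LinearMap.finrank_range_add_finrank_ker
    (S.connForm cov p : TangentSpace (𝓡 (n * (n + 1) / 2)) p →ₗ[ℝ] SpinAlg n)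
  have h2 := Submodule.finrank_le
    (LinearMap.range (S.connForm cov p : TangentSpace (𝓡 (n * (n + 1) / 2)) p →ₗ[ℝ] SpinAlg n))
  have h3 : Module.finrank ℝ (S.horizontal cov p) ≤ n := by
    have h := LinearMap.finrank_le_finrank_of_injective
      (f := ((S.dproj p).comp (S.horizontal cov p).subtypeL :
        S.horizontal cov p →ₗ[ℝ] TangentSpace (𝓡 n) (S.proj p))) hinj
    rwa [hM] at h
  have h4 : n ≤ Module.finrank ℝ (S.horizontal cov p) := by
    have h5 : Module.finrank ℝ (S.horizontal cov p) = Module.finrank ℝ (LinearMap.ker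
      (S.connForm cov p : TangentSpace (𝓡 (n * (n + 1) / 2)) p →ₗ[ℝ] SpinAlg n)) := rfl
    rw [hP] at h1
    rw [hA] at h2
    have h6 := card_pairs n
    have h7 : n * (n + 1) / 2 = Fintype.card (Pairs n) + n := by
      have : n * (n + 1) = n * (n - 1) + n * 2 := by
        cases n with
        | zero => rfl
        | succ k => simp only [Nat.add_sub_cancel]; ring
      omega
    omega
  have hdim : Module.finrank ℝ (S.horizontal cov p) =
      Module.finrank ℝ (TangentSpace (𝓡 n) (S.proj p)) := by rw [hM]; exact le_antisymm h3 h4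
  have hbij : Function.Bijective ((S.dproj p).comp (S.horizontal cov p).subtypeL :
      S.horizontal cov p →ₗ[ℝ] TangentSpace (𝓡 n) (S.proj p)) :=
    ⟨hinj, (LinearMap.injective_iff_surjective_of_finrank_eq_finrank hdim).1 hinj⟩
  let e : S.horizontal cov p ≃L[ℝ] TangentSpace (𝓡 n) (S.proj p) :=
    (LinearEquiv.ofBijective _ hbij).toContinuousLinearEquiv
  have he : (S.dproj p).comp (S.horizontal cov p).subtypeL = (e : _ →L[ℝ] _) := by
    ext ξ
    rfl
  have h8 : S.horizontalLift cov p = (e.symm : _ →L[ℝ] _) := by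
    rw [horizontalLift, he, ContinuousLinearMap.inverse_equiv]
  rw [h8]
  exact e.apply_symm_apply u

end SpinStructure
end SpinHorizontal

theorem contDiff_sum_inner_smul {E V ι κ : Type*} [NormedAddCommGroup E] [InnerProductSpace ℝ E]
    [NormedAddCommGroup V] [NormedSpace ℝ V] [Fintype ι] [Fintype κ] (m : WithTop ℕ∞) (a : ℝ)
    (c : ι → κ → E) (G : ι → κ → V →L[ℝ] V) :
    ContDiff ℝ m fun A : E ↦ a • ∑ k, ∑ l, (2 * inner ℝ A (c k l) : ℝ) • G k l :=
  .const_smul _ <| .sum fun _ _ ↦ .sum fun _ _ ↦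
    (contDiff_const.mul (contDiff_id.inner ℝ contDiff_const)).smul contDiff_const

theorem eq_zero_of_eq_neg_of_real {V : Type*} [AddCommGroup V] [Module ℝ V] {x : V}
    (h : x = -x) : x = 0 := by
  have h2 : (2 : ℝ) • x = 0 := by
    rw [two_smul]
    nth_rewrite 2 [h]
    exact add_neg_cancel x
  exact (smul_eq_zero.1 h2).resolve_left two_ne_zero

/-! ### Grassmann evaluation of the curvature operator. -/

section Evaluation

variable {n : ℕ} {M : Type*} [TopologicalSpace M] [T2Space M] [ChartedSpace (Euc n) M]
  [IsManifold (𝓡 n) ∞ M]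
  [RiemannianBundle (fun x : M ↦ TangentSpace (𝓡 n) x)]
  [IsContMDiffRiemannianBundle (𝓡 n) ∞ (Euc n) (fun x : M ↦ TangentSpace (𝓡 n) x)]
  {P : Type*} [TopologicalSpace P] [ChartedSpace (Euc (n * (n + 1) / 2)) P]
  [IsManifold (𝓡 (n * (n + 1) / 2)) ∞ P] [MulAction (SpinGrp n)ᵐᵒᵖ P]
  [ContinuousSMul (SpinGrp n)ᵐᵒᵖ P]
  {S : SpinStructure n M P}
  {cov : CovariantDerivative (𝓡 n) (Euc n) (fun x : M ↦ TangentSpace (𝓡 n) x)} {p : P}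

theorem exteriorIdent_dualVec {x : M} (f : Euc n ≃ₗᵢ[ℝ] TangentSpace (𝓡 n) x) (i : Fin n) :
    exteriorIdent f (dualVec i) =
      coframe ((EuclideanSpace.basisFun (Fin n) ℝ).map f) i := by
  rw [exteriorIdent, dualVec, coframe, ExteriorAlgebra.map_apply_ι]
  congr 1

namespace SpinStructure

variable (S) in
/-- The orthonormal basis of the tangent space which belongs to a frame. -/
abbrev frameBasis (p : P) : OrthonormalBasis (Fin n) ℝ (TangentSpace (𝓡 n) (S.proj p)) :=
  (EuclideanSpace.basisFun (Fin n) ℝ).map (S.frame p)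

theorem frameBasis_apply (p : P) (i : Fin n) : S.frameBasis p i = S.frame p (stdVec i) := by
  simp [frameBasis, stdVec]

/-- The curvature operator in terms of the Riemannian curvature. -/
theorem inner_curvatureOp_frame (hcov : IsLeviCivita cov) (A : SpinAlg n) (k l : Fin n) :
    (inner ℝ (S.frameBasis p k) (S.curvatureOp cov p A (S.frameBasis p l)) : ℝ) =
      ∑ ij : Pairs n, A ij * inner ℝ (S.frameBasis p k) (curvatureTensor cov (S.proj p)
        (S.frameBasis p ij.1.1) (S.frameBasis p ij.1.2) (S.frameBasis p l)) := by
  rw [real_inner_comm, inner_curvatureOp, PiLp.inner_apply, Finset.mul_sum]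
  refine Finset.sum_congr rfl fun ij _ ↦ ?_
  -- The factor `2` in the definition of `τ(A · Ω)` cancels the `1 / 2` of the structure equation.
  -- Pair symmetry moves the frame indices `i`, `j` into the form slots of `R`.
  rw [spinCurvature_apply hcov, dproj_horizontalLift hcov, dproj_horizontalLift hcov,
    ← frameBasis_apply, ← frameBasis_apply, real_inner_comm (curvatureTensor _ _ _ _ _),
    inner_curvatureTensor_pair_symm hcov, real_inner_comm (S.frameBasis p k)]
  simp only [RCLike.inner_apply, conj_trivial]
  ring

theorem contDiff_smul_curvatureOp (a : ℝ) :
    ContDiff ℝ ω fun A ↦ a • S.curvatureOp cov p A :=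
  contDiff_sum_inner_smul ω a
    (fun k l ↦ S.spinCurvature cov p (S.horizontalLift cov p (S.frame p (stdVec l)))
      (S.horizontalLift cov p (S.frame p (stdVec k))))
    fun k l ↦ (innerSL ℝ (S.frame p (stdVec l))).smulRight (S.frame p (stdVec k))

theorem curvatureOp_zero : S.curvatureOp cov p 0 = 0 := by
  simp [curvatureOp]

/-- The Grassmann evaluation of half the curvature operator. -/
theorem taylorEvalMatrix_curvatureOp (hcov : IsLeviCivita cov) :
    taylorEvalMatrix SpinAlg.basisVec (scaledTwoForm 2) 0 (Finset.univ : Finset (Pairs n)).toList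
      (S.frameBasis p) (fun A ↦ (1 / 2 : ℝ) • S.curvatureOp cov p A) =
    fun k l ↦ ∑ ij : Pairs n, (inner ℝ (S.frameBasis p k) (curvatureTensor cov (S.proj p)
        (S.frameBasis p ij.1.1) (S.frameBasis p ij.1.2) (S.frameBasis p l)) : ℝ) •
        (dualVec ij.1.1 * dualVec ij.1.2) := by
  ext k l
  let φ : SpinAlg n →L[ℝ] ℝ := ∑ ij : Pairs n, ((1 / 2 : ℝ) * inner ℝ (S.frameBasis p k)
    (curvatureTensor cov (S.proj p) (S.frameBasis p ij.1.1) (S.frameBasis p ij.1.2)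
      (S.frameBasis p l))) • (EuclideanSpace.proj ij : SpinAlg n →L[ℝ] ℝ)
  have hφ : (fun A ↦ (inner ℝ (S.frameBasis p k)
      (((1 / 2 : ℝ) • S.curvatureOp cov p A) (S.frameBasis p l)) : ℝ)) = φ := by
    funext A
    rw [_root_.smul_apply, real_inner_smul_right, inner_curvatureOp_frame hcov, Finset.mul_sum]
    simp only [φ, _root_.sum_apply, _root_.smul_apply, smul_eq_mul]
    refine Finset.sum_congr rfl fun ij _ ↦ ?_
    rw [mul_left_comm, mul_comm]
    rfl
  rw [taylorEvalMatrix, hφ, taylorEval_linear, Finset.sum_map_toList]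
  refine Finset.sum_congr rfl fun ij _ ↦ ?_
  have h : φ (SpinAlg.basisVec ij) = (1 / 2 : ℝ) * inner ℝ (S.frameBasis p k)
      (curvatureTensor cov (S.proj p) (S.frameBasis p ij.1.1) (S.frameBasis p ij.1.2)
        (S.frameBasis p l)) := by
    simp [φ, SpinAlg.basisVec]
  -- The `2` of `2 e^i ∧ e^j` cancels the `1 / 2` in front of the curvature operator, leaving `R_x`
  -- itself.
  rw [h, scaledTwoForm, smul_smul]
  congr 1
  ring

end SpinStructure

end Evaluation

/-! ### The main theorem. -/

theorem theorem2 {n : ℕ} (hn : Even n)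
    {M : Type*} [TopologicalSpace M] [T2Space M] [CompactSpace M] [ChartedSpace (Euc n) M]
    [IsManifold (𝓡 n) ∞ M]
    [RiemannianBundle (fun x : M ↦ TangentSpace (𝓡 n) x)]
    [IsContMDiffRiemannianBundle (𝓡 n) ∞ (Euc n) (fun x : M ↦ TangentSpace (𝓡 n) x)]
    (cov : CovariantDerivative (𝓡 n) (Euc n) (fun x : M ↦ TangentSpace (𝓡 n) x))
    (hcov : IsLeviCivita cov)
    {P : Type*} [TopologicalSpace P] [T2Space P] [ChartedSpace (Euc (n * (n + 1) / 2)) P]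
    [IsManifold (𝓡 (n * (n + 1) / 2)) ∞ P] [MulAction (SpinGrp n)ᵐᵒᵖ P]
    [ContinuousSMul (SpinGrp n)ᵐᵒᵖ P]
    (S : SpinStructure n M P) (p : P) (v : S.horizontal cov p) :
    (∀ᶠ A in 𝓝 (0 : SpinAlg n), IsUnit (S.jacobiOp cov p A)) ∧
    ContDiffAt ℝ ∞ (S.psi cov p v) 0 ∧
    exteriorIdent (S.frame p) (grassmannEval (S.psi cov p v) 0 2) =
      curvatureCoth cov (S.proj p) ((EuclideanSpace.basisFun (Fin n) ℝ).map (S.frame p))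
        (S.dproj p v) := by
  have hfd : FiniteDimensional ℝ (TangentSpace (𝓡 n) (S.proj p)) :=
    inferInstanceAs (FiniteDimensional ℝ (Euc n))
  have hcomp : CompleteSpace (TangentSpace (𝓡 n) (S.proj p)) := FiniteDimensional.complete ℝ _
  let F : SpinAlg n → TangentSpace (𝓡 n) (S.proj p) →L[ℝ] TangentSpace (𝓡 n) (S.proj p) :=
    fun A ↦ (1 / 2 : ℝ) • S.curvatureOp cov p A
  have hF : ContDiffAt ℝ ω F 0 := (SpinStructure.contDiff_smul_curvatureOp (S := S)
    (cov := cov) (p := p) (1 / 2)).contDiffAt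
  have hF0 : F 0 = 0 := by simp only [F, SpinStructure.curvatureOp_zero, smul_zero]
  have hinv := contDiffAt_inverse_oneSubExpNegDiv hF hF0
  have hψ : ContDiffAt ℝ ω (S.psi cov p v) 0 := hinv.inner_apply_omega _ _
  refine ⟨isUnit_oneSubExpNegDiv hF hF0, hψ.of_le le_top, ?_⟩
  let b := S.frameBasis p
  let u := S.dproj p v
  let X := taylorEvalMatrix SpinAlg.basisVec (scaledTwoForm 2) 0
    (Finset.univ : Finset (Pairs n)).toList b F
  have hX : X = _ := SpinStructure.taylorEvalMatrix_curvatureOp (S := S) (p := p) hcov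
  have hXkl : ∀ k l, X k l = ∑ ij : Pairs n, (inner ℝ (b k) (curvatureTensor cov (S.proj p)
      (b ij.1.1) (b ij.1.2) (b l)) : ℝ) • (dualVec ij.1.1 * dualVec ij.1.2) := fun k l ↦ by
    rw [hX]
  have hN : X ^ (n + 1) = 0 := Matrix.pow_eq_zero_of_mem_twoForms fun k l ↦ by
    rw [hXkl]
    exact Submodule.sum_mem _ fun ij _ ↦ Submodule.smul_mem _ _ (dualVec_mul_mem _ _)
  have hsymm : ∀ k l, X k l = -X l k := fun k l ↦ by
    rw [hXkl, hXkl, ← Finset.sum_neg_distrib]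
    refine Finset.sum_congr rfl fun ij _ ↦ ?_
    rw [← neg_smul, ← inner_curvatureTensor_swap hcov, real_inner_comm]
  have hmap : (exteriorIdent (S.frame p)).mapMatrix X = curvatureMatrix cov (S.proj p) b := by
    ext k l
    rw [AlgHom.mapMatrix_apply, Matrix.map_apply, hXkl, curvatureMatrix, map_sum]
    refine Finset.sum_congr rfl fun ij _ ↦ ?_
    rw [map_smul, map_mul, exteriorIdent_dualVec, exteriorIdent_dualVec]
  have hcoth : ∀ k l, exteriorIdent (S.frame p) (nilCoth ((1 / 2 : ℝ) • X) k l) =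
      nilCoth ((1 / 2 : ℝ) • curvatureMatrix cov (S.proj p) b) k l := fun k l ↦ by
    -- The frame identification, applied entrywise, is an algebra homomorphism of matrix rings and
    -- so commutes with power series at nilpotent elements.
    have h := map_nilEval (exteriorIdent (S.frame p)).mapMatrix (X := (1 / 2 : ℝ) • X)
      (N := n + 1) (by rw [smul_pow, hN, smul_zero]) zCothSeries
    rw [map_smul, hmap] at h
    exact congrFun (congrFun h k) l
  have hinvX := taylorEvalMatrix_inverse_oneSubExpNegDiv (b := b) (commute_scaledTwoForm 2)
    (scaledTwoForm_mul_self 2) hF hF0 hN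
  have hψsum : S.psi cov p v = fun A ↦ ∑ k, ∑ l, (inner ℝ (b k) u * inner ℝ (b l) u) *
      inner ℝ (b k) (Ring.inverse (oneSubExpNegDiv (F A)) (b l)) := by
    funext A
    have h : S.psi cov p v A = inner ℝ u (Ring.inverse (oneSubExpNegDiv (F A)) u) := rfl
    rw [h]
    conv_lhs => rw [← b.sum_repr' u]
    simp only [map_sum, map_smul, sum_inner, inner_sum, real_inner_smul_left,
      real_inner_smul_right]
    rw [Finset.sum_comm]
    refine Finset.sum_congr rfl fun k _ ↦ Finset.sum_congr rfl fun l _ ↦ ?_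
    ring
  have heval : grassmannEval (S.psi cov p v) 0 2 = ∑ k, ∑ l,
      ((inner ℝ (b k) u * inner ℝ (b l) u : ℝ)) • nilCoth ((1 / 2 : ℝ) • X) k l := by
    rw [grassmannEval_eq_taylorEval hψ, hψsum, taylorEval_sum _ _ fun k _ ↦
      ContDiffAt.sum fun l _ ↦ contDiffAt_const.mul (hinv.inner_apply_omega _ _)]
    have h1 : ∀ k l, taylorEval SpinAlg.basisVec (scaledTwoForm 2) 0
        (Finset.univ : Finset (Pairs n)).toList
        (fun A ↦ inner ℝ (b k) (Ring.inverse (oneSubExpNegDiv (F A)) (b l))) =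
        nilCoth ((1 / 2 : ℝ) • X) k l + (1 / 2 : ℝ) • X k l := fun k l ↦
      congrFun (congrFun hinvX k) l
    -- The odd part `⟨u, X u⟩ / 2`: the coefficients are symmetric in `k` and `l` while `X` is skew,
    -- so exchanging the indices changes the sign of the sum.
    have h2 : ∑ k, ∑ l, ((inner ℝ (b k) u * inner ℝ (b l) u : ℝ)) • (1 / 2 : ℝ) • X k l = 0 := by
      refine eq_zero_of_eq_neg_of_real (Finset.sum_comm.trans ?_)
      simp only [← Finset.sum_neg_distrib]
      refine Finset.sum_congr rfl fun k _ ↦ Finset.sum_congr rfl fun l _ ↦ ?_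
      rw [hsymm l k, mul_comm, smul_neg, smul_neg]
    refine Eq.trans ?_ (add_zero _)
    rw [← h2, ← Finset.sum_add_distrib]
    refine Finset.sum_congr rfl fun k _ ↦ ?_
    rw [taylorEval_sum _ _ fun l _ ↦ contDiffAt_const.mul (hinv.inner_apply_omega _ _),
      ← Finset.sum_add_distrib]
    refine Finset.sum_congr rfl fun l _ ↦ ?_
    rw [taylorEval_const_smul _ _ (hinv.inner_apply_omega _ _), h1, smul_add]
  rw [heval, curvatureCoth, map_sum]
  refine Finset.sum_congr rfl fun k _ ↦ ?_
  rw [map_sum]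
  refine Finset.sum_congr rfl fun l _ ↦ ?_
  rw [map_smul, hcoth]
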